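/- **Conventions.** For $\alpha<\beta$ let $\mathbb S_{\alpha,\beta}=\{z\in\mathbb C:\alpha<\operatorname{Re}z<\beta\}$. A *compatible couple* $(X,Y)$ in a complex Banach space $V$ consists of two complex Banach spaces that are linear subspaces of $V$ with continuous inclusions; $X\cap Y$ carries the norm $\max(\|\cdot\|_X,\|\cdot\|_Y)$. The couple is *regular* if $X\cap Y$ is dense in $X$ and in $Y$. The Calderón space $\mathscr C(X,Y)$ on $\mathbb S_{\alpha,\beta}$ is the space of bounded analytic functions $f:\mathbb S_{\alpha,\beta}\to V$ that extend continuously to the closed strip and for which $t\mapsto f(\alpha+it)\in X$ and $t\mapsto f(\beta+it)\in Y$ are bounded and continuous, with norm $\|f\|=\max\{\sup_t\|f(\alpha+it)\|_X,\ \sup_t\|f(\beta+it)\|_Y\}$. For $\alpha<c<\beta$, $[X,Y]_c=\{f(c):f\in\mathscr C(X,Y)\}\subset V$, with the quotient norm $\|x\|=\inf\{\|f\|:f(c)=x\}$. **Proposition.** Let $(X_0,X_1)$ be a regular compatible couple of complex Banach spaces in a Banach space $\Sigma$ with $\Sigma=X_0+X_1$, and let $\Delta=X_0\cap X_1$. For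 $n\ge 1$ and $0<\theta<1$ let the Rochberg space $X^{(n)}_\theta\subset\Sigma^n$ be the set of all lists of Taylor coefficients $\left(\frac{f^{(n-1)}(\theta)}{(n-1)!},\dots,f'(\theta),f(\theta)\right)$ with $f\in\mathscr C(X_0,X_1)$ on $\mathbb S_{0,1}$, normed by the infimum of $\|f\|$ over all such $f$ giving the list. Let $0<a<b<1$ and $n\ge1$. Then: 1. $(X^{(n)}_a,X^{(n)}_b)$ is a compatible couple in $\Sigma^n$ (to be interpolated on the strip $\mathbb S_{a,b}$). 2. For every $c$ with $a<c<b$ one has $X^{(n)}_c\subset[X^{(n)}_a,X^{(n)}_b]_c$, and the formal inclusion is an isomorphic embedding: on $X^{(n)}_c$ the two norms are equivalent. 3. If $\Delta^n$ is dense in $X^{(n)}_a\cap X^{(n)}_b$, then $[X^{(n)}_a,X^{(n)}_b]_c=X^{(n)}_c$, with equivalent norms, for every $a<c<b$. 4. If $X_0\subset X_1$, then $\Delta^n$ is dense in $X^{(n)}_a\cap X^{(n)}_b$ (so that 3 applies). -/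

import Mathlib

open scoped BoundedContinuousFunction

noncomputable section

/-! ### Banach spaces sitting inside an ambient space -/

/-- A linear subspace of `V` together with its own seminorm (unrelated, a priori, to any norm of
`V`). Whether it is a Banach space continuously included in `V` is the predicate `IsBanach`
below. -/
structure SeminormedSubspace (V : Type*) [AddCommGroup V] [Module ℂ V] where
  carrier : Submodule ℂ V
  seminorm : Seminorm ℂ carrier

namespace SeminormedSubspace

section Algebra

variable {V : Type*} [AddCommGroup V] [Module ℂ V]

/-- The vector space `X.carrier`, as a type on its own, carrying the (semi)norm and the topology
given by `X.seminorm` (and not the topology induced by `V`). -/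
def Space (X : SeminormedSubspace V) : Type _ := X.carrier

instance (X : SeminormedSubspace V) : AddCommGroup X.Space :=
  inferInstanceAs (AddCommGroup X.carrier)

instance (X : SeminormedSubspace V) : Module ℂ X.Space :=
  inferInstanceAs (Module ℂ X.carrier)

instance (X : SeminormedSubspace V) : SeminormedAddCommGroup X.Space :=
  @AddGroupSeminorm.toSeminormedAddCommGroup X.Space _ X.seminorm.toAddGroupSeminorm

instance (X : SeminormedSubspace V) : NormedSpace ℂ X.Space where
  norm_smul_le r x := (map_smul_eq_mul X.seminorm r x).le

/-- The formal inclusion of `X` into the ambient space. -/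
def incl (X : SeminormedSubspace V) : X.Space →ₗ[ℂ] V := X.carrier.subtype

/-- The intersection of two spaces, with the maximum of the two norms. -/
def inter (X Y : SeminormedSubspace V) : SeminormedSubspace V where
  carrier := X.carrier ⊓ Y.carrier
  seminorm := X.seminorm.comp (Submodule.inclusion inf_le_left) ⊔
    Y.seminorm.comp (Submodule.inclusion inf_le_right)

/-- `D` is a dense subset of `X`, for the norm of `X`. -/
def IsDenseIn (D : Set V) (X : SeminormedSubspace V) : Prop :=
  D ⊆ X.carrier ∧ Dense {x : X.Space | X.incl x ∈ D}

/-- `X` is contained in `Y` and the formal inclusion is an isomorphic embedding: on `X` the norm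
of `X` and the norm of `Y` are equivalent. -/
def IsIsomorphicallyEmbedded (X Y : SeminormedSubspace V) : Prop :=
  ∃ h : X.carrier ≤ Y.carrier, ∃ k K : ℝ, 0 < k ∧ 0 < K ∧ ∀ x : X.carrier,
    k * X.seminorm x ≤ Y.seminorm (Submodule.inclusion h x) ∧
      Y.seminorm (Submodule.inclusion h x) ≤ K * X.seminorm x

/-- `X` and `Y` are the same space, with equivalent norms. -/
def EqWithEquivalentNorms (X Y : SeminormedSubspace V) : Prop :=
  X.carrier = Y.carrier ∧ X.IsIsomorphicallyEmbedded Y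

/-- The range of a linear map `T : F → V` with the quotient norm of `F ⧸ ker T`, that is,
`‖w‖ = inf {‖f‖ : T f = w}`; see `ofRange_seminorm`. -/
def ofRange {F : Type*} [SeminormedAddCommGroup F] [NormedSpace ℂ F] (T : F →ₗ[ℂ] V) :
    SeminormedSubspace V where
  carrier := LinearMap.range T
  seminorm := (normSeminorm ℂ (F ⧸ LinearMap.ker T)).comp T.quotKerEquivRange.symm.toLinearMap

theorem ofRange_seminorm {F : Type*} [SeminormedAddCommGroup F] [NormedSpace ℂ F]
    (T : F →ₗ[ℂ] V) (w : LinearMap.range T) :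
    (ofRange T).seminorm w = sInf {r : ℝ | ∃ f : F, T f = (w : V) ∧ ‖f‖ = r} := by
  have key : ∀ f : F, T f = (w : V) ↔
      (LinearMap.ker T).mkQ f = T.quotKerEquivRange.symm w := by
    intro f
    rw [LinearEquiv.eq_symm_apply, ← Subtype.coe_inj]
    rfl
  change ‖T.quotKerEquivRange.symm w‖ = _
  set q := T.quotKerEquivRange.symm w with hq
  obtain ⟨f₀, hf₀⟩ := (LinearMap.ker T).mkQ_surjective q
  refine le_antisymm (le_csInf ⟨_, f₀, (key f₀).2 hf₀, rfl⟩ ?_) ?_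
  · rintro _ ⟨f, hf, rfl⟩
    rw [← (key f).1 hf]
    exact Submodule.Quotient.norm_mk_le _ f
  · refine le_of_forall_pos_lt_add fun ε hε => ?_
    obtain ⟨f, hf, hlt⟩ := Submodule.Quotient.norm_mk_lt q hε
    refine lt_of_le_of_lt (csInf_le ⟨0, ?_⟩ ⟨f, (key f).2 hf, rfl⟩) hlt
    rintro _ ⟨g, -, rfl⟩
    exact norm_nonneg g

end Algebra

section Normed

variable {V : Type*} [NormedAddCommGroup V] [NormedSpace ℂ V]

/-- `X` is a Banach space continuously included in `V`. -/
structure IsBanach (X : SeminormedSubspace V) : Prop where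
  definite : ∀ x : X.carrier, X.seminorm x = 0 → x = 0
  complete : CompleteSpace X.Space
  continuous_incl : Continuous X.incl

/-- `(X, Y)` is a compatible couple of Banach spaces (a Banach couple): both are Banach spaces,
linearly and continuously included in the same Banach space `V`. -/
def IsCompatibleCouple [CompleteSpace V] (X Y : SeminormedSubspace V) : Prop :=
  X.IsBanach ∧ Y.IsBanach

/-- `(X, Y)` is regular: the intersection is dense in each of the two spaces. -/
def IsRegularCouple (X Y : SeminormedSubspace V) : Prop :=
  IsDenseIn ((X.carrier ⊓ Y.carrier : Submodule ℂ V) : Set V) X ∧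
    IsDenseIn ((X.carrier ⊓ Y.carrier : Submodule ℂ V) : Set V) Y

end Normed

end SeminormedSubspace

/-! ### Calderón spaces -/

/-- The open vertical strip `a < Re z < b`. -/
def openStrip (a b : ℝ) : Set ℂ := {z | a < z.re ∧ z.re < b}

/-- The closed vertical strip `a ≤ Re z ≤ b`. -/
def closedStrip (a b : ℝ) : Set ℂ := {z | a ≤ z.re ∧ z.re ≤ b}

theorem isOpen_openStrip (a b : ℝ) : IsOpen (openStrip a b) :=
  (isOpen_lt continuous_const Complex.continuous_re).inter
    (isOpen_lt Complex.continuous_re continuous_const)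

theorem ofReal_mem_openStrip {a b c : ℝ} (h₁ : a < c) (h₂ : c < b) : (c : ℂ) ∈ openStrip a b :=
  ⟨by simpa using h₁, by simpa using h₂⟩

section Calderon

variable {V : Type*} [NormedAddCommGroup V] [NormedSpace ℂ V]

/-- The functions of the Calderón space of `(X, Y)` on the strip `a < Re z < b`, recorded together
with their two boundary functions: triples `(f, u, v)` where `f` is bounded and analytic on the open
strip, continuous on the closed strip, and `u t = f (a + i t)`, `v t = f (b + i t)` define bounded
continuous functions `u : ℝ → X`, `v : ℝ → Y` (for the norms of `X` and `Y`).
The values of `f` outside the closed strip are irrelevant. -/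
def calderonSubmodule (X Y : SeminormedSubspace V) (a b : ℝ) :
    Submodule ℂ ((ℂ → V) × (ℝ →ᵇ X.Space) × (ℝ →ᵇ Y.Space)) where
  carrier := {p | DifferentiableOn ℂ p.1 (openStrip a b) ∧ ContinuousOn p.1 (closedStrip a b) ∧
    (∃ M : ℝ, ∀ z ∈ openStrip a b, ‖p.1 z‖ ≤ M) ∧
    (∀ t : ℝ, p.1 (a + t * Complex.I) = X.incl (p.2.1 t)) ∧
    (∀ t : ℝ, p.1 (b + t * Complex.I) = Y.incl (p.2.2 t))}
  zero_mem' := by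
    refine ⟨differentiableOn_const 0, continuousOn_const, ⟨0, fun z _ => by simp⟩, ?_, ?_⟩ <;>
      intro t <;> simp
  add_mem' := by
    rintro p q ⟨h1, h2, ⟨M, h3⟩, h4, h5⟩ ⟨k1, k2, ⟨N, k3⟩, k4, k5⟩
    refine ⟨h1.add k1, h2.add k2, ⟨M + N, fun z hz => ?_⟩, fun t => ?_, fun t => ?_⟩
    · exact (norm_add_le _ _).trans (add_le_add (h3 z hz) (k3 z hz))
    · simp [h4, k4]
    · simp [h5, k5]
  smul_mem' := by
    rintro r p ⟨h1, h2, ⟨M, h3⟩, h4, h5⟩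
    refine ⟨h1.const_smul r, h2.const_smul r, ⟨‖r‖ * M, fun z hz => ?_⟩, fun t => ?_, fun t => ?_⟩
    · exact (norm_smul_le r _).trans (mul_le_mul_of_nonneg_left (h3 z hz) (norm_nonneg r))
    · simp [h4]
    · simp [h5]

/-- The Calderón space of the couple `(X, Y)` on the strip `a < Re z < b`. -/
def Calderon (X Y : SeminormedSubspace V) (a b : ℝ) : Type _ := calderonSubmodule X Y a b

instance (X Y : SeminormedSubspace V) (a b : ℝ) : AddCommGroup (Calderon X Y a b) :=
  inferInstanceAs (AddCommGroup (calderonSubmodule X Y a b))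

instance (X Y : SeminormedSubspace V) (a b : ℝ) : Module ℂ (Calderon X Y a b) :=
  inferInstanceAs (Module ℂ (calderonSubmodule X Y a b))

/-- The function `f` of an element of the Calderón space. -/
def Calderon.fn (X Y : SeminormedSubspace V) (a b : ℝ) : Calderon X Y a b →ₗ[ℂ] (ℂ → V) :=
  LinearMap.fst ℂ _ _ ∘ₗ (calderonSubmodule X Y a b).subtype

/-- The two boundary functions of an element of the Calderón space. -/
def Calderon.boundary (X Y : SeminormedSubspace V) (a b : ℝ) :
    Calderon X Y a b →ₗ[ℂ] (ℝ →ᵇ X.Space) × (ℝ →ᵇ Y.Space) :=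
  LinearMap.snd ℂ _ _ ∘ₗ (calderonSubmodule X Y a b).subtype

/-- The norm of the Calderón space,
`‖f‖ = max (sup_t ‖f (a + i t)‖_X) (sup_t ‖f (b + i t)‖_Y)`. -/
instance (X Y : SeminormedSubspace V) (a b : ℝ) : SeminormedAddCommGroup (Calderon X Y a b) :=
  SeminormedAddCommGroup.induced _ _ (Calderon.boundary X Y a b)

instance (X Y : SeminormedSubspace V) (a b : ℝ) : NormedSpace ℂ (Calderon X Y a b) :=
  NormedSpace.induced ℂ _ _ (Calderon.boundary X Y a b)

theorem Calderon.contDiffAt_fn {X Y : SeminormedSubspace V} {a b : ℝ} [CompleteSpace V]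
    (f : Calderon X Y a b) {z : ℂ} (hz : z ∈ openStrip a b) (m : WithTop ℕ∞) :
    ContDiffAt ℂ m (Calderon.fn X Y a b f) z :=
  ((f.2.1.analyticOnNhd (isOpen_openStrip a b)) z hz).contDiffAt

/-- The complex interpolation space `[X, Y]_c` on the strip `a < Re z < b`: the values at `c` of the
functions of the Calderón space, with the quotient norm. -/
def complexInterpolation (X Y : SeminormedSubspace V) (a b c : ℝ) : SeminormedSubspace V :=
  SeminormedSubspace.ofRange (LinearMap.proj (c : ℂ) ∘ₗ Calderon.fn X Y a b)

/-- The list of the first `n` Taylor coefficients `f⁽ⁱ⁾(z) / i!`, `0 ≤ i < n`, of the functions of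
the Calderón space at a point `z` of the strip. -/
def taylorCoeffs [CompleteSpace V] (X Y : SeminormedSubspace V) (a b : ℝ) (n : ℕ) {z : ℂ}
    (hz : z ∈ openStrip a b) : Calderon X Y a b →ₗ[ℂ] (Fin n → V) where
  toFun f i := ((Nat.factorial i : ℂ))⁻¹ • iteratedDeriv i (Calderon.fn X Y a b f) z
  map_add' f g := by
    funext i
    rw [map_add, iteratedDeriv_add (f.contDiffAt_fn hz _) (g.contDiffAt_fn hz _)]
    simp
  map_smul' r f := by
    funext i
    rw [map_smul, iteratedDeriv_const_smul (f.contDiffAt_fn hz _)]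
    simp [smul_comm r]

/-- The `n`-th Rochberg space of `(X, Y)` at the point `z` of the strip `a < Re z < b`, as a subspace
of `Vⁿ`: the lists of the first `n` Taylor coefficients at `z` of the functions of the Calderón
space, with the quotient norm. The entry with index `i` is the coefficient of order `i`. -/
def rochberg [CompleteSpace V] (X Y : SeminormedSubspace V) (a b : ℝ) (n : ℕ) {z : ℂ}
    (hz : z ∈ openStrip a b) : SeminormedSubspace (Fin n → V) :=
  SeminormedSubspace.ofRange (taylorCoeffs X Y a b n hz)

/-- The power `Dⁿ` of a set `D`, inside `Vⁿ`. -/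
def setPower (D : Set V) (n : ℕ) : Set (Fin n → V) := {x | ∀ i, x i ∈ D}

end Calderon

end

/-! Parts 2 and 3 rest on a single equality: the Rochberg space at `c` is the interpolation space at
`c` of the Rochberg spaces at `a` and `b`, with equivalent norms (`rochberg_eqWithEquivalentNorms`).
Part 1 is completeness of quotients of the Calderón space, on which evaluation and Taylor
coefficients are bounded by Phragmén–Lindelöf and Cauchy estimates.

From Rochberg to interpolation (`Calderon.exists_fn_eq_taylorCoeffs`): multiply `f` by a decaying
function that is 1 at `c` to order `n`. The map sending `z` to the Taylor list of the product at `z`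
is analytic. Its value at `a + it` is the list at `a` of a vertical translate, and decay makes
translation norm continuous, so the edge functions are continuous in the Rochberg norms.

From interpolation to Rochberg (`Calderon.exists_taylorCoeffs_eq_fn`): let `G` be in the Calderón
space of the two Rochberg spaces. For `p = a, b` lift `t ↦ G (p + it)` to a bounded continuous
family `Ψ t` in the original Calderón space. With `ζ = p + it`, the function `Ψ t (z - it)` is the
Taylor polynomial `P_ζ (z - ζ)` with coefficients `G ζ`, plus `(z - ζ) ^ n` times a remainder.
Multiply by `((z - c) / (z - ζ)) ^ n` and by a decaying Cauchy kernel `(ζ - c)⁻¹`, then integrate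
over both lines. The remainders give `(z - c) ^ n` times a function analytic on the whole strip. If
`Re z` lies outside `[a, b]`, the polynomial parts form a Cauchy integral of a function of `ζ`
analytic between the lines, so their difference is `2π` times the polynomial with coefficients `G
c`. Hence `P_c (z - c) + (z - c) ^ n E z`, with `E` analytic on the strip, has Taylor list `G c` at
`c`, while on the outer edges it is a difference of integrals converging in `X` or in `Y`. A last
cutoff makes it bounded.

Part 4: if `X₀ ⊆ X₁` then `X₁` is all of `Σ`. The same construction with one line and constant
coefficients embeds the space at `a` into the space at `b`
(`Calderon.exists_taylorCoeffs_eq_taylorCoeffs`), so density need only be checked in the norm at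
`a`. Vertical Gaussian averages approximate any decaying `f`; shifting the contour to the left edge
writes them as analytic functions with values in `X₀`, whose Taylor coefficients therefore lie in
`X₀ = Δ`. -/

set_option linter.unusedSectionVars false

noncomputable section

open MeasureTheory Filter Topology Set

/-! ### Taylor coefficients and iterated divided differences -/

section Taylor

variable {V : Type*} [NormedAddCommGroup V] [NormedSpace ℂ V] [CompleteSpace V]

/-- Leibniz's rule with a linear factor. It is kept on a neighbourhood of `p` rather than at `p`
alone, so that the induction can differentiate it. -/
theorem iteratedDeriv_succ_of_eventuallyEq_add_smul {f g : ℂ → V} {p : ℂ} {v : V}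
    (hg : AnalyticAt ℂ g p) (hf : f =ᶠ[𝓝 p] fun z => v + (z - p) • g z) (i : ℕ) :
    iteratedDeriv (i + 1) f =ᶠ[𝓝 p]
      fun z => (z - p) • iteratedDeriv (i + 1) g z + ((i : ℂ) + 1) • iteratedDeriv i g z := by
  have hd : ∀ j, ∀ᶠ z in 𝓝 p, DifferentiableAt ℂ (iteratedDeriv j g) z := by
    intro j
    have h : AnalyticAt ℂ (iteratedDeriv j g) p := by
      rw [iteratedDeriv_eq_iterate]; exact hg.iterated_deriv j
    exact h.eventually_analyticAt.mono fun z hz => hz.differentiableAt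
  induction i with
  | zero =>
    rw [iteratedDeriv_succ, iteratedDeriv_zero]
    refine hf.deriv.trans ?_
    filter_upwards [hd 0] with z hz
    rw [iteratedDeriv_zero] at hz
    have h1 : HasDerivAt (fun z => v + (z - p) • g z) ((z - p) • deriv g z + (1 : ℂ) • g z) z :=
      (((hasDerivAt_id z).sub_const p).smul hz.hasDerivAt).const_add v
    rw [h1.deriv]
    simp [iteratedDeriv_one]
  | succ i ih =>
    rw [iteratedDeriv_succ]
    refine ih.deriv.trans ?_
    filter_upwards [hd (i + 1), hd i] with z hz hz'
    have h1 := (((hasDerivAt_id z).sub_const p).smul hz.hasDerivAt).add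
      (hz'.hasDerivAt.const_smul ((i : ℂ) + 1))
    have h2 := h1.deriv
    simp only [← iteratedDeriv_succ] at h2
    refine Eq.trans ?_ (h2.trans ?_)
    · rfl
    · push_cast; simp only [id]; module

theorem taylorCoeff_succ_of_eventuallyEq_add_smul {f g : ℂ → V} {p : ℂ} {v : V}
    (hg : AnalyticAt ℂ g p) (hf : f =ᶠ[𝓝 p] fun z => v + (z - p) • g z) (i : ℕ) :
    (((i + 1).factorial : ℂ))⁻¹ • iteratedDeriv (i + 1) f p =
      ((i.factorial : ℂ))⁻¹ • iteratedDeriv i g p := by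
  rw [(iteratedDeriv_succ_of_eventuallyEq_add_smul hg hf i).eq_of_nhds, sub_self, zero_smul,
    zero_add, smul_smul]
  congr 1
  have h1 : ((i : ℂ) + 1) ≠ 0 := by exact_mod_cast i.succ_ne_zero
  have h2 : ((i.factorial : ℂ)) ≠ 0 := by exact_mod_cast i.factorial_ne_zero
  rw [Nat.factorial_succ]; push_cast; field_simp

/-- The Taylor coefficients of order less than `n` of a function of the form
`∑ j < n, (z - p) ^ j • v j + (z - p) ^ n • E z`. -/
theorem taylorCoeff_of_eventuallyEq {p : ℂ} {E : ℂ → V} (hE : AnalyticAt ℂ E p) (n : ℕ) :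
    ∀ {f : ℂ → V} {v : ℕ → V},
    (f =ᶠ[𝓝 p] fun z => ∑ j ∈ Finset.range n, (z - p) ^ j • v j + (z - p) ^ n • E z) →
    ∀ i < n, ((i.factorial : ℂ))⁻¹ • iteratedDeriv i f p = v i := by
  induction n with
  | zero => intro f v _ i hi; omega
  | succ n ih =>
    intro f v hf i hi
    set g : ℂ → V := fun z =>
      ∑ j ∈ Finset.range n, (z - p) ^ j • v (j + 1) + (z - p) ^ n • E z with hgdef
    have hg : AnalyticAt ℂ g p := by
      have h1 : AnalyticAt ℂ (fun z => ∑ j ∈ Finset.range n, (z - p) ^ j • v (j + 1)) p := by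
        refine Finset.analyticAt_fun_sum _ fun j _ => ?_
        fun_prop
      exact h1.add (by fun_prop)
    have hfg : f =ᶠ[𝓝 p] fun z => v 0 + (z - p) • g z := by
      refine hf.trans (Eventually.of_forall fun z => ?_)
      simp only [hgdef, Finset.sum_range_succ', smul_add, Finset.smul_sum, smul_smul, pow_succ',
        pow_zero, one_smul]
      abel
    cases i with
    | zero => simpa using hfg.eq_of_nhds
    | succ i =>
      rw [taylorCoeff_succ_of_eventuallyEq_add_smul hg hfg]
      exact ih (v := fun j => v (j + 1)) (Eventually.of_forall fun z => rfl) i (by omega)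

/-- Since `f z = f p + (z - p) • dslope f p z`, each `dslope` shifts the Taylor coefficients by one.
Thus the iterates serve both as coefficients and as globally defined remainders. -/
theorem taylorCoeff_eq_iterate_dslope {p : ℂ} {f : ℂ → V} (hf : AnalyticAt ℂ f p) (i : ℕ) :
    ((i.factorial : ℂ))⁻¹ • iteratedDeriv i f p = ((Function.swap dslope p)^[i] f) p := by
  induction i generalizing f with
  | zero => simp
  | succ i ih =>
    have hg : AnalyticAt ℂ (dslope f p) p := by
      obtain ⟨q, hq⟩ := hf
      exact ⟨_, hq.has_fpower_series_dslope_fslope⟩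
    rw [Function.iterate_succ_apply, ← ih (f := dslope f p) hg]
    refine taylorCoeff_succ_of_eventuallyEq_add_smul (v := f p) hg (Eventually.of_forall fun z => ?_) i
    simp only [sub_smul_dslope]; abel

theorem eq_sum_add_pow_smul_iterate_dslope (p : ℂ) (f : ℂ → V) (n : ℕ) (z : ℂ) :
    f z = ∑ j ∈ Finset.range n, (z - p) ^ j • ((Function.swap dslope p)^[j] f) p +
      (z - p) ^ n • ((Function.swap dslope p)^[n] f) z := by
  induction n with
  | zero => simp
  | succ n ih =>
    rw [Finset.sum_range_succ, Function.iterate_succ_apply']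
    refine ih.trans ?_
    rw [add_assoc, pow_succ, ← smul_smul, ← smul_add]
    change _ = _ + (z - p) ^ n • (_ + (z - p) • dslope _ p z)
    rw [sub_smul_dslope]; simp

theorem differentiableOn_iterate_dslope {p : ℂ} {f : ℂ → V} {s : Set ℂ} (hs : s ∈ 𝓝 p)
    (hf : DifferentiableOn ℂ f s) (n : ℕ) :
    DifferentiableOn ℂ ((Function.swap dslope p)^[n] f) s := by
  induction n with
  | zero => exact hf
  | succ n ih =>
    rw [Function.iterate_succ_apply']
    exact (Complex.differentiableOn_dslope hs).2 ih

theorem continuousOn_iterate_dslope {p : ℂ} {f : ℂ → V} {s t : Set ℂ} (hs : s ∈ 𝓝 p) (hst : s ⊆ t)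
    (hf : DifferentiableOn ℂ f s) (hc : ContinuousOn f t) (n : ℕ) :
    ContinuousOn ((Function.swap dslope p)^[n] f) t := by
  induction n with
  | zero => exact hc
  | succ n ih =>
    rw [Function.iterate_succ_apply']
    refine (continuousOn_dslope (mem_of_superset hs hst)).2 ⟨ih, ?_⟩
    exact (differentiableOn_iterate_dslope hs hf n).differentiableAt hs

/-- The increment `f z - f p` is at most `2 * M`. Schwarz's lemma handles the ball; outside it one
divides by `‖z - p‖ ≥ d`. -/
theorem norm_dslope_le {p : ℂ} {f : ℂ → V} {s : Set ℂ} {d M : ℝ} (hd : 0 < d)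
    (hs : Metric.ball p d ⊆ s) (hf : DifferentiableOn ℂ f (Metric.ball p d))
    (hM : ∀ z ∈ s, ‖f z‖ ≤ M) {z : ℂ} (hz : z ∈ s) : ‖dslope f p z‖ ≤ 2 / d * M := by
  have hp : ‖f p‖ ≤ M := hM p (hs (Metric.mem_ball_self hd))
  have hsub : ∀ w ∈ s, ‖f w - f p‖ ≤ 2 * M := fun w hw =>
    (norm_sub_le _ _).trans (by linarith [hM w hw])
  by_cases hzb : z ∈ Metric.ball p d
  · refine (Complex.norm_dslope_le_div_of_mapsTo_ball (R₂ := 2 * M) hf (fun w hw => ?_)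
      hzb).trans_eq (by field_simp)
    rw [Metric.mem_closedBall, dist_eq_norm]
    exact hsub w (hs hw)
  · have hne : d ≤ ‖z - p‖ := by simpa [dist_eq_norm] using hzb
    have hne' : z ≠ p := by rintro rfl; simp at hne; linarith
    rw [dslope_of_ne _ hne', slope_def_module, norm_smul, norm_inv]
    have h0 : 0 ≤ M := (norm_nonneg _).trans hp
    calc ‖z - p‖⁻¹ * ‖f z - f p‖ ≤ d⁻¹ * (2 * M) := by
          gcongr
          exact hsub z hz
      _ = 2 / d * M := by field_simp

theorem norm_iterate_dslope_le {p : ℂ} {f : ℂ → V} {s : Set ℂ} {d M : ℝ} (hd : 0 < d)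
    (hs : Metric.ball p d ⊆ s) (hf : DifferentiableOn ℂ f (Metric.ball p d))
    (hM : ∀ z ∈ s, ‖f z‖ ≤ M) (n : ℕ) {z : ℂ} (hz : z ∈ s) :
    ‖((Function.swap dslope p)^[n] f) z‖ ≤ (2 / d) ^ n * M := by
  induction n generalizing z with
  | zero => simpa using hM z hz
  | succ n ih =>
    rw [Function.iterate_succ_apply', pow_succ', mul_assoc]
    exact norm_dslope_le hd hs
      (differentiableOn_iterate_dslope (Metric.ball_mem_nhds p hd) hf n) (fun w hw => ih hw) hz

end Taylor

/-! ### Integrals depending holomorphically on a parameter -/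

section Parameter

variable {W : Type*} [NormedAddCommGroup W] [NormedSpace ℂ W] [CompleteSpace W]

/-- No bound on the derivative is assumed: Cauchy's estimate on circles of radius `r` turns the
majorant `G` of `φ` into the majorant `G / r` of its derivative. -/
theorem differentiableOn_integral_of_dominated {φ : ℂ → ℝ → W} {U : Set ℂ} (hU : IsOpen U)
    {G : ℝ → ℝ} (hG : Integrable G) (hd : ∀ t, DifferentiableOn ℂ (fun z => φ z t) U)
    (hm : ∀ z ∈ U, AEStronglyMeasurable (φ z)) (hb : ∀ z ∈ U, ∀ t, ‖φ z t‖ ≤ G t) :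
    DifferentiableOn ℂ (fun z => ∫ t, φ z t) U := by
  intro z₀ hz₀
  obtain ⟨r, hr, hrU⟩ : ∃ r > 0, Metric.closedBall z₀ (2 * r) ⊆ U := by
    obtain ⟨ε, hε, h⟩ := Metric.nhds_basis_closedBall.mem_iff.1 (hU.mem_nhds hz₀)
    exact ⟨ε / 2, by positivity, by simpa [mul_div_cancel₀] using h⟩
  have hsub : ∀ z ∈ Metric.ball z₀ r, Metric.closedBall z r ⊆ U := fun z hz w hw =>
    hrU (by
      rw [Metric.mem_closedBall] at hw ⊢
      rw [Metric.mem_ball] at hz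
      linarith [dist_triangle w z z₀])
  have hderiv : ∀ t, ∀ z ∈ Metric.ball z₀ r, HasDerivAt (fun z => φ z t) (deriv (fun z => φ z t) z) z :=
    fun t z hz => ((hd t).differentiableAt
      (hU.mem_nhds (hsub z hz (Metric.mem_closedBall_self hr.le)))).hasDerivAt
  -- The derivative is measurable in `t` as a limit of difference quotients along the sequence `z₀ +
  -- r / (m + 1)`.
  have hmeas : AEStronglyMeasurable (fun t => deriv (fun z => φ z t) z₀) := by
    set h : ℕ → ℂ := fun m => ((r / (m + 1) : ℝ) : ℂ) with hh
    have hpos : ∀ m : ℕ, 0 < r / ((m : ℝ) + 1) := fun m => by positivity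
    have hle : ∀ m : ℕ, r / ((m : ℝ) + 1) ≤ r := fun m => div_le_self hr.le (by simp)
    have h0 : Tendsto (fun m => z₀ + h m) atTop (𝓝[≠] z₀) := by
      refine tendsto_nhdsWithin_iff.2 ⟨?_, Eventually.of_forall fun m => ?_⟩
      · have h1 : Tendsto (fun m : ℕ => r / ((m : ℝ) + 1)) atTop (𝓝 0) := by
          have := (tendsto_one_div_add_atTop_nhds_zero_nat (𝕜 := ℝ)).const_mul r
          simpa [div_eq_mul_inv] using this
        have h2 := (Complex.continuous_ofReal.tendsto 0).comp h1
        simpa [h, Function.comp_def] using (tendsto_const_nhds (x := z₀)).add h2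
      · have : h m ≠ 0 := Complex.ofReal_ne_zero.2 (hpos m).ne'
        simpa using this
    refine aestronglyMeasurable_of_tendsto_ae atTop
      (f := fun m t => slope (fun z => φ z t) z₀ (z₀ + h m)) (fun m => ?_)
      (Eventually.of_forall fun t => ?_)
    · simp only [slope_def_module]
      refine AEStronglyMeasurable.const_smul (AEStronglyMeasurable.sub (hm _ ?_) (hm _ hz₀)) _
      refine hrU ?_
      rw [Metric.mem_closedBall, dist_eq_norm, add_sub_cancel_left, Complex.norm_real,
        Real.norm_of_nonneg (hpos m).le]
      linarith [hle m]
    · exact (hasDerivAt_iff_tendsto_slope.1 (hderiv t z₀ (Metric.mem_ball_self hr))).comp h0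
  have key := hasDerivAt_integral_of_dominated_loc_of_deriv_le (μ := volume)
    (F := φ) (F' := fun z t => deriv (fun z => φ z t) z) (bound := fun t => G t / r)
    (Metric.ball_mem_nhds z₀ hr)
    (Filter.Eventually.mono (p := fun z => z ∈ U) (hU.mem_nhds hz₀) fun z hz => hm z hz)
    (hG.mono' (hm z₀ hz₀) (Eventually.of_forall (hb z₀ hz₀))) hmeas
    (Eventually.of_forall fun t z hz => Complex.norm_deriv_le_of_forall_mem_sphere_norm_le hr
      (((hd t).mono (hsub z hz)).diffContOnCl_ball subset_rfl)
      fun w hw => hb w (hsub z hz (Metric.sphere_subset_closedBall hw)) t)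
    (hG.div_const r) (Eventually.of_forall fun t z hz => hderiv t z hz)
  exact key.2.differentiableAt.differentiableWithinAt

end Parameter

/-! ### Cauchy's theorem and Cauchy's formula in strips -/

section Strip

theorem add_mul_I_mem_closedStrip {a b x : ℝ} (h₁ : a ≤ x) (h₂ : x ≤ b) (t : ℝ) :
    (x + t * Complex.I : ℂ) ∈ closedStrip a b := by simp [closedStrip, h₁, h₂]

theorem openStrip_subset_closedStrip (a b : ℝ) : openStrip a b ⊆ closedStrip a b :=
  fun _ hz => ⟨hz.1.le, hz.2.le⟩

theorem mul_one_add_sq_le_norm_sq {δ : ℝ} (hδ : 0 ≤ δ) (hδ1 : δ ≤ 1) {z : ℂ} (hz : δ ≤ |z.re|) :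
    δ ^ 2 * (1 + z.im ^ 2) ≤ ‖z‖ ^ 2 := by
  rw [Complex.sq_norm, Complex.normSq_apply]
  have h1 : δ ^ 2 ≤ z.re ^ 2 := by rw [← sq_abs z.re]; gcongr
  have h2 : δ ^ 2 ≤ 1 := pow_le_one₀ hδ hδ1
  nlinarith [sq_nonneg z.im]

theorem norm_inv_mul_inv_le {δ : ℝ} (hδ : 0 < δ) (hδ1 : δ ≤ 1) {z w : ℂ} (hz : δ ≤ |z.re|)
    (hw : δ ≤ |w.re|) (him : z.im = w.im) : ‖z⁻¹ * w⁻¹‖ ≤ (δ ^ 2)⁻¹ * (1 + z.im ^ 2)⁻¹ := by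
  have h1 := mul_one_add_sq_le_norm_sq hδ.le hδ1 hz
  have h2 := mul_one_add_sq_le_norm_sq hδ.le hδ1 hw
  rw [← him] at h2
  rw [norm_mul, norm_inv, norm_inv, ← mul_inv, ← mul_inv]
  refine inv_anti₀ (by positivity) ?_
  refine abs_le_of_sq_le_sq' ?_ (by positivity) |>.2
  rw [mul_pow ‖z‖ ‖w‖, sq (δ ^ 2 * _)]
  exact mul_le_mul h1 h2 (by positivity) (by positivity)

theorem continuous_inv_vertical {x : ℝ} (hx : x ≠ 0) :
    Continuous fun t : ℝ => ((x : ℂ) + t * Complex.I)⁻¹ := by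
  refine Continuous.inv₀ (by fun_prop) fun t h => hx ?_
  simpa using congrArg Complex.re h

/-- Neither term is integrable alone; the difference is a multiple of the product of the two
inverses, hence decays quadratically. -/
theorem integrable_inv_sub_inv {x y : ℝ} (hx : x ≠ 0) (hy : y ≠ 0) :
    Integrable fun t : ℝ => ((x : ℂ) + t * Complex.I)⁻¹ - ((y : ℂ) + t * Complex.I)⁻¹ := by
  set δ := min (min |x| |y|) 1 with hδ
  have hδ0 : 0 < δ := by simp [hδ, hx, hy]
  refine (integrable_inv_one_add_sq.const_mul (|y - x| * (δ ^ 2)⁻¹)).mono'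
    ((continuous_inv_vertical hx).sub (continuous_inv_vertical hy)).aestronglyMeasurable
    (Eventually.of_forall fun t => ?_)
  have h1 : ((x : ℂ) + t * Complex.I) ≠ 0 := fun h => hx (by simpa using congrArg Complex.re h)
  have h2 : ((y : ℂ) + t * Complex.I) ≠ 0 := fun h => hy (by simpa using congrArg Complex.re h)
  have h3 : ((x : ℂ) + t * Complex.I)⁻¹ - ((y : ℂ) + t * Complex.I)⁻¹ =
      ((y - x : ℝ) : ℂ) * (((x : ℂ) + t * Complex.I)⁻¹ * ((y : ℂ) + t * Complex.I)⁻¹) := by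
    field_simp; push_cast; ring
  rw [h3, norm_mul, Complex.norm_real, Real.norm_eq_abs, mul_assoc]
  gcongr
  refine (norm_inv_mul_inv_le hδ0 (min_le_right _ _) ?_ ?_ ?_).trans_eq ?_
  · simp [hδ]
  · simp [hδ]
  · simp
  · simp

theorem integral_univ_div_sq_add_sq {x : ℝ} (hx : x ≠ 0) :
    Integrable (fun t : ℝ => x / (x ^ 2 + t ^ 2)) ∧
      ∫ t : ℝ, x / (x ^ 2 + t ^ 2) = SignType.sign x * Real.pi := by
  have h : ∀ t : ℝ, x / (x ^ 2 + t ^ 2) = x⁻¹ * (1 + (t / x) ^ 2)⁻¹ := fun t => by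
    field_simp
  simp only [h]
  refine ⟨(integrable_inv_one_add_sq.comp_div hx).const_mul _, ?_⟩
  rw [integral_const_mul, Measure.integral_comp_div (fun t : ℝ => (1 + t ^ 2)⁻¹),
    integral_univ_inv_one_add_sq, smul_eq_mul, ← mul_assoc]
  congr 1
  rcases lt_or_gt_of_ne hx with h | h
  · rw [abs_of_neg h, sign_neg h]; simp [hx]
  · rw [abs_of_pos h, sign_pos h]; simp [hx]

/-- Averaging over `t` and `-t` leaves only the real parts, which are Poisson kernels of integral
`±π` according to the side of the imaginary axis. -/
theorem integral_inv_sub_inv {x y : ℝ} (hx : x ≠ 0) (hy : y ≠ 0) :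
    ∫ t : ℝ, (((x : ℂ) + t * Complex.I)⁻¹ - ((y : ℂ) + t * Complex.I)⁻¹) =
      (((SignType.sign x : ℝ) - (SignType.sign y : ℝ)) * Real.pi : ℝ) := by
  set h : ℝ → ℂ := fun t => ((x : ℂ) + t * Complex.I)⁻¹ - ((y : ℂ) + t * Complex.I)⁻¹ with hh
  have hi : Integrable h := integrable_inv_sub_inv hx hy
  have hsum : ∀ t, h t + h (-t) = ((2 * (x / (x ^ 2 + t ^ 2) - y / (y ^ 2 + t ^ 2)) : ℝ) : ℂ) := by
    intro t
    have key : ∀ {x : ℝ}, x ≠ 0 → ((x : ℂ) + t * Complex.I)⁻¹ + ((x : ℂ) + (-t : ℝ) * Complex.I)⁻¹ =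
        ((2 * (x / (x ^ 2 + t ^ 2)) : ℝ) : ℂ) := by
      intro x hx
      have h1 : ((x : ℂ) + t * Complex.I) ≠ 0 := fun h => hx (by simpa using congrArg Complex.re h)
      have h2 : ((x : ℂ) + (-t : ℝ) * Complex.I) ≠ 0 :=
        fun h => hx (by simpa using congrArg Complex.re h)
      have h3 : ((x : ℂ) ^ 2 + t ^ 2) = (x + t * Complex.I) * (x + (-t : ℝ) * Complex.I) := by
        push_cast; ring_nf; simp
      push_cast at h2 h3 ⊢
      rw [h3, inv_add_inv h1 h2]
      ring
    have h1 := key hx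
    have h2 := key hy
    simp only [hh]
    rw [mul_sub, Complex.ofReal_sub, ← h1, ← h2]
    ring
  have h2 : ∫ t, (h t + h (-t)) = 2 * ∫ t, h t := by
    rw [integral_add hi hi.comp_neg, integral_neg_eq_self, two_mul]
  obtain ⟨ix, ex⟩ := integral_univ_div_sq_add_sq hx
  obtain ⟨iy, ey⟩ := integral_univ_div_sq_add_sq hy
  simp only [hsum] at h2
  rw [integral_complex_ofReal, integral_const_mul, integral_sub ix iy, ex, ey] at h2
  have h3 : (2 : ℂ) ≠ 0 := two_ne_zero
  refine mul_left_cancel₀ h3 (h2.symm.trans ?_)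
  push_cast; ring

variable {W : Type*} [NormedAddCommGroup W] [NormedSpace ℂ W] [CompleteSpace W]

/-- Cauchy's theorem on rectangles of height `2T`; the bound `K / |z.im|` kills the horizontal sides
as `T → ∞`. -/
theorem integral_vertical_line_eq {a b : ℝ} (hab : a ≤ b) {φ : ℂ → W}
    (hd : DifferentiableOn ℂ φ (openStrip a b)) (hc : ContinuousOn φ (closedStrip a b))
    (hia : Integrable fun t : ℝ => φ (a + t * Complex.I))
    (hib : Integrable fun t : ℝ => φ (b + t * Complex.I)) {K : ℝ}
    (hK : ∀ z ∈ closedStrip a b, 1 ≤ |z.im| → ‖φ z‖ ≤ K / |z.im|) :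
    ∫ t : ℝ, φ (a + t * Complex.I) = ∫ t : ℝ, φ (b + t * Complex.I) := by
  have hrect : ∀ T : ℝ, 0 < T → (∫ x : ℝ in a..b, φ (x + (-T : ℝ) * Complex.I)) -
      (∫ x : ℝ in a..b, φ (x + T * Complex.I)) +
      Complex.I • (∫ y : ℝ in (-T)..T, φ (b + y * Complex.I)) -
      Complex.I • (∫ y : ℝ in (-T)..T, φ (a + y * Complex.I)) = 0 := by
    intro T hT
    have h := Complex.integral_boundary_rect_eq_zero_of_continuousOn_of_differentiableOn φ
      (a + (-T : ℝ) * Complex.I) (b + T * Complex.I) ?_ ?_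
    · simpa using h
    · refine hc.mono fun z hz => ?_
      simp only [Complex.add_re, Complex.ofReal_re, Complex.mul_re, Complex.I_re, mul_zero,
        Complex.ofReal_im, Complex.I_im, mul_one, sub_self, add_zero, uIcc_of_le hab] at hz
      exact hz.1
    · refine hd.mono fun z hz => ?_
      simp only [Complex.add_re, Complex.ofReal_re, Complex.mul_re, Complex.I_re, mul_zero,
        Complex.ofReal_im, Complex.I_im, mul_one, sub_self, add_zero, min_eq_left hab,
        max_eq_right hab] at hz
      exact hz.1
  have hhor : ∀ s : ℝ, |s| = 1 →
      Tendsto (fun T : ℝ => ∫ x : ℝ in a..b, φ (x + (s * T : ℝ) * Complex.I)) atTop (𝓝 0) := by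
    intro s hs
    refine squeeze_zero_norm' (a := fun T : ℝ => K / T * |b - a|) ?_ ?_
    · filter_upwards [eventually_ge_atTop 1] with T hT
      have habs : |s * T| = T := by rw [abs_mul, hs, one_mul, abs_of_nonneg (by linarith)]
      refine intervalIntegral.norm_integral_le_of_norm_le_const fun x hx => ?_
      rw [uIoc_of_le hab] at hx
      have := hK _ (add_mul_I_mem_closedStrip hx.1.le hx.2 (s * T)) (by simpa [habs] using hT)
      simpa [habs] using this
    · have : Tendsto (fun T : ℝ => K / T) atTop (𝓝 0) := tendsto_const_nhds.div_atTop tendsto_id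
      simpa using this.mul_const |b - a|
  have h1 := hhor (-1) (by simp)
  have h2 := hhor 1 (by simp)
  have h3 := (intervalIntegral_tendsto_integral hib tendsto_neg_atTop_atBot tendsto_id).const_smul
    Complex.I
  have h4 := (intervalIntegral_tendsto_integral hia tendsto_neg_atTop_atBot tendsto_id).const_smul
    Complex.I
  have h5 := ((h1.sub h2).add h3).sub h4
  have h6 : Tendsto (fun _ : ℝ => (0 : W)) atTop (𝓝 0) := tendsto_const_nhds
  have h7 := tendsto_nhds_unique (h6.congr' ?_) h5
  · rw [sub_self, zero_add, eq_comm, sub_eq_zero] at h7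
    exact (smul_right_injective W Complex.I_ne_zero h7).symm
  · filter_upwards [eventually_gt_atTop 0] with T hT
    rw [← hrect T hT]
    simp

theorem integrable_inv_smul_vertical {x c K : ℝ} (hx : x ≠ c) {φ : ℂ → W}
    (hc : Continuous fun t : ℝ => φ (x + t * Complex.I))
    (hK : ∀ t : ℝ, ‖φ (x + t * Complex.I)‖ ≤ K * (1 + t ^ 2)⁻¹) :
    Integrable fun t : ℝ => (x + t * Complex.I - c : ℂ)⁻¹ • φ (x + t * Complex.I) := by
  have hx' : x - c ≠ 0 := sub_ne_zero.2 hx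
  have e : ∀ t : ℝ, (x + t * Complex.I - c : ℂ) = ((x - c : ℝ) : ℂ) + t * Complex.I := fun t => by
    push_cast; ring
  simp only [e]
  refine (integrable_inv_one_add_sq.const_mul (|x - c|⁻¹ * K)).mono'
    ((continuous_inv_vertical hx').smul hc).aestronglyMeasurable (Eventually.of_forall fun t => ?_)
  rw [norm_smul, norm_inv, mul_assoc]
  gcongr
  · simpa using Complex.abs_re_le_norm (((x - c : ℝ) : ℂ) + t * Complex.I)
  · exact hK t

theorem continuous_vertical {a b x : ℝ} (h₁ : a ≤ x) (h₂ : x ≤ b) {φ : ℂ → W}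
    (hc : ContinuousOn φ (closedStrip a b)) : Continuous fun t : ℝ => φ (x + t * Complex.I) :=
  hc.comp_continuous (by fun_prop) fun t => add_mul_I_mem_closedStrip h₁ h₂ t

/-- Cauchy's integral formula in a strip. -/
theorem cauchy_formula_strip {a b c : ℝ} (hac : a < c) (hcb : c < b) {φ : ℂ → W}
    (hd : DifferentiableOn ℂ φ (openStrip a b)) (hc : ContinuousOn φ (closedStrip a b)) {K : ℝ}
    (hK : ∀ z ∈ closedStrip a b, ‖φ z‖ ≤ K * (1 + z.im ^ 2)⁻¹) :
    (∫ t : ℝ, (b + t * Complex.I - c : ℂ)⁻¹ • φ (b + t * Complex.I)) -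
      (∫ t : ℝ, (a + t * Complex.I - c : ℂ)⁻¹ • φ (a + t * Complex.I)) =
      (2 * Real.pi : ℂ) • φ c := by
  have hab : a ≤ b := (hac.trans hcb).le
  -- The pole of `φ z / (z - c)` is removed by subtracting `ω z • φ c`, where `ω c = 1` and the pole
  -- of `ω`, at `c - M = a - 1`, lies to the left of the strip. Then `dslope ψ c` has equal
  -- integrals over both edges. The correction contributes nothing on the edge `b` and `-2π • φ c`
  -- on the edge `a`.
  set M : ℝ := c - a + 1 with hM
  set ω : ℂ → ℂ := fun z => M / (M + z - c) with hω
  set ψ : ℂ → W := fun z => φ z - ω z • φ c with hψ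
  have hmem : openStrip a b ∈ 𝓝 (c : ℂ) :=
    (isOpen_openStrip a b).mem_nhds (ofReal_mem_openStrip hac hcb)
  have hre : ∀ z ∈ closedStrip a b, 1 ≤ ‖(M + z - c : ℂ)‖ := fun z hz => by
    have h1 : 1 ≤ (M + z - c : ℂ).re := by simp [hM]; linarith [hz.1]
    exact h1.trans ((le_abs_self _).trans (Complex.abs_re_le_norm _))
  have hne : ∀ z ∈ closedStrip a b, (M + z - c : ℂ) ≠ 0 := fun z hz h => by
    have := hre z hz; rw [h] at this; simp at this; linarith
  have hψd : DifferentiableOn ℂ ψ (openStrip a b) := by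
    refine hd.sub (DifferentiableOn.smul_const (fun z hz => ?_) _)
    have := hne z (openStrip_subset_closedStrip a b hz)
    exact DifferentiableAt.differentiableWithinAt (by fun_prop (disch := assumption))
  have hψc : ContinuousOn ψ (closedStrip a b) := by
    refine hc.sub (ContinuousOn.smul (fun z hz => ?_) continuousOn_const)
    have := hne z hz
    exact ContinuousAt.continuousWithinAt (by fun_prop (disch := assumption))
  have hψ0 : ψ c = 0 := by
    have : (M : ℂ) ≠ 0 := Complex.ofReal_ne_zero.2 (by linarith)
    simp [hψ, hω, this]
  have hformula : ∀ z ∈ closedStrip a b, z ≠ c → dslope ψ c z =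
      (z - c)⁻¹ • φ z - ((z - c)⁻¹ - (M + z - c)⁻¹) • φ c := by
    intro z hz hzc
    have h1 := hne z hz
    have h2 := sub_ne_zero.2 hzc
    rw [dslope_of_ne _ hzc, slope_def_module, hψ0, sub_zero, smul_sub, smul_smul]
    congr 2
    simp only [hω]
    field_simp
    ring
  have hdec : ∀ z ∈ closedStrip a b, 1 ≤ |z.im| →
      ‖dslope ψ c z‖ ≤ (K + M * ‖φ c‖) / |z.im| := by
    intro z hz him
    have hzc : z ≠ c := by rintro rfl; simp at him; linarith
    have him' : |z.im| ≤ ‖z - c‖ := by simpa using Complex.abs_im_le_norm (z - c)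
    rw [dslope_of_ne _ hzc, slope_def_module, hψ0, sub_zero, norm_smul, norm_inv, div_eq_inv_mul]
    have hK0 : 0 ≤ K := by
      have := (norm_nonneg _).trans (hK z hz)
      by_contra hneg
      push Not at hneg
      have h2 : 0 < (1 + z.im ^ 2)⁻¹ := by positivity
      nlinarith
    have hb : ‖ψ z‖ ≤ K + M * ‖φ c‖ := by
      refine (norm_sub_le _ _).trans (add_le_add ((hK z hz).trans ?_) ?_)
      · exact mul_le_of_le_one_right hK0 (inv_le_one_of_one_le₀ (by nlinarith [sq_nonneg z.im]))
      · rw [norm_smul]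
        gcongr
        simp only [hω, norm_div, Complex.norm_real]
        rw [Real.norm_of_nonneg (by linarith)]
        exact div_le_self (by linarith) (hre z hz)
    gcongr
  have hline : ∀ x : ℝ, a ≤ x → x ≤ b → x ≠ c →
      Integrable (fun t : ℝ => dslope ψ c (x + t * Complex.I)) ∧
      ∫ t : ℝ, dslope ψ c (x + t * Complex.I) =
        (∫ t : ℝ, (x + t * Complex.I - c : ℂ)⁻¹ • φ (x + t * Complex.I)) -
        ((((SignType.sign (x - c) : ℝ) - 1) * Real.pi : ℝ) : ℂ) • φ c := by
    intro x h1 h2 h3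
    have hx1 : x - c ≠ 0 := sub_ne_zero.2 h3
    have hx2 : 0 < M + x - c := by linarith
    have hf : ∀ t : ℝ, dslope ψ c (x + t * Complex.I) =
        (x + t * Complex.I - c : ℂ)⁻¹ • φ (x + t * Complex.I) -
        ((((x - c : ℝ) : ℂ) + t * Complex.I)⁻¹ - (((M + x - c : ℝ) : ℂ) + t * Complex.I)⁻¹) •
          φ c := by
      intro t
      rw [hformula _ (add_mul_I_mem_closedStrip h1 h2 t)]
      · congr 4 <;> push_cast <;> ring
      · intro h
        have := congrArg Complex.re h
        simp at this
        exact h3 this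
    simp only [hf]
    have i1 := integrable_inv_smul_vertical h3 (continuous_vertical h1 h2 hc)
      (fun t => by simpa using hK _ (add_mul_I_mem_closedStrip h1 h2 t))
    have i2 := (integrable_inv_sub_inv hx1 hx2.ne').smul_const (φ c)
    refine ⟨i1.sub i2, ?_⟩
    rw [integral_sub i1 i2, integral_smul_const, integral_inv_sub_inv hx1 hx2.ne', sign_pos hx2]
    simp
  obtain ⟨ia, ea⟩ := hline a le_rfl hab hac.ne
  obtain ⟨ib, eb⟩ := hline b hab le_rfl hcb.ne'
  have hct := integral_vertical_line_eq hab ((Complex.differentiableOn_dslope hmem).2 hψd)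
    ((continuousOn_dslope (mem_of_superset hmem (openStrip_subset_closedStrip a b))).2
      ⟨hψc, hψd.differentiableAt hmem⟩) ia ib hdec
  rw [ea, eb, sign_neg (sub_neg.2 hac), sign_pos (sub_pos.2 hcb)] at hct
  have h3 := sub_eq_zero.2 hct
  rw [← sub_eq_zero, ← neg_eq_zero, ← h3]
  push_cast
  simp only [SignType.coe_one]
  push_cast
  module

/-- Cauchy's integral formula in a right half-plane. -/
theorem cauchy_formula_halfPlane {a c : ℝ} (hac : a < c) {φ : ℂ → W}
    (hd : DifferentiableOn ℂ φ {z | a < z.re}) (hc : ContinuousOn φ {z | a ≤ z.re}) {K : ℝ}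
    (hK : ∀ z : ℂ, a ≤ z.re → ‖φ z‖ ≤ K * (1 + z.im ^ 2)⁻¹) :
    (∫ t : ℝ, (a + t * Complex.I - c : ℂ)⁻¹ • φ (a + t * Complex.I)) =
      -((2 * Real.pi : ℂ) • φ c) := by
  rw [← add_eq_zero_iff_eq_neg, ← norm_le_zero_iff]
  -- The strip formula is applied with right edge `R → ∞`; the integral over that edge is at most
  -- this majorant.
  have hlim : Tendsto (fun R : ℝ => ∫ t : ℝ, (R - c)⁻¹ * (K * (1 + t ^ 2)⁻¹)) atTop (𝓝 0) := by
    simp only [integral_const_mul]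
    have : Tendsto (fun R : ℝ => (R - c)⁻¹) atTop (𝓝 0) :=
      tendsto_inv_atTop_zero.comp (tendsto_atTop_add_const_right _ _ tendsto_id)
    simpa only [zero_mul] using this.mul_const (K * ∫ t : ℝ, (1 + t ^ 2)⁻¹)
  refine ge_of_tendsto hlim ?_
  filter_upwards [eventually_gt_atTop c] with R hR
  have h := cauchy_formula_strip hac hR (hd.mono fun z hz => hz.1) (hc.mono fun z hz => hz.1)
    (fun z hz => hK z hz.1)
  rw [← h, add_sub_cancel]
  refine norm_integral_le_of_norm_le ((integrable_inv_one_add_sq.const_mul K).const_mul _)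
    (Eventually.of_forall fun t => ?_)
  rw [norm_smul, norm_inv]
  have hb := hK (R + t * Complex.I) (by simpa using (hac.trans hR).le)
  simp only [Complex.add_im, Complex.ofReal_im, Complex.mul_im, Complex.ofReal_re, Complex.I_im,
    mul_one, Complex.I_re, mul_zero, add_zero, zero_add] at hb
  have hn : R - c ≤ ‖(R + t * Complex.I - c : ℂ)‖ := by
    simpa using (le_abs_self _).trans (Complex.abs_re_le_norm (R + t * Complex.I - c : ℂ))
  gcongr

end Strip

/-! ### Subspaces with their own norm -/

namespace SeminormedSubspace

section Algebra

variable {V : Type*} [AddCommGroup V] [Module ℂ V]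

theorem space_norm_eq (X : SeminormedSubspace V) (x : X.carrier) :
    ‖(show X.Space from x)‖ = X.seminorm x := rfl

theorem incl_injective (X : SeminormedSubspace V) : Function.Injective X.incl :=
  Subtype.val_injective

theorem incl_mem (X : SeminormedSubspace V) (x : X.Space) : X.incl x ∈ X.carrier :=
  Subtype.property (show X.carrier from x)

theorem exists_incl_eq (X : SeminormedSubspace V) {v : V} (hv : v ∈ X.carrier) :
    ∃ x : X.Space, X.incl x = v := ⟨(⟨v, hv⟩ : X.carrier), rfl⟩

section OfRange

variable {F : Type*} [SeminormedAddCommGroup F] [NormedSpace ℂ F]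

/-- A linear map `T` as a map onto the space `ofRange T`. -/
def toRange (T : F →ₗ[ℂ] V) : F →ₗ[ℂ] (ofRange T).Space := T.rangeRestrict

theorem norm_toRange_le (T : F →ₗ[ℂ] V) (f : F) : ‖toRange T f‖ ≤ ‖f‖ := by
  refine (ofRange_seminorm T (T.rangeRestrict f)).trans_le (csInf_le ⟨0, ?_⟩ ⟨f, rfl, rfl⟩)
  rintro _ ⟨g, -, rfl⟩
  exact norm_nonneg g

theorem exists_toRange_eq (T : F →ₗ[ℂ] V) (w : (ofRange T).Space) {ε : ℝ} (hε : 0 < ε) :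
    ∃ f, toRange T f = w ∧ ‖f‖ < ‖w‖ + ε := by
  obtain ⟨f₀, hf₀⟩ : ∃ f, T f = (ofRange T).incl w := (ofRange T).incl_mem w
  have hw : ‖w‖ = sInf {r : ℝ | ∃ f : F, T f = (ofRange T).incl w ∧ ‖f‖ = r} :=
    ofRange_seminorm T w
  obtain ⟨_, ⟨f, hf, rfl⟩, hlt⟩ := exists_lt_of_csInf_lt (s := {r : ℝ | ∃ f : F,
    T f = (ofRange T).incl w ∧ ‖f‖ = r}) ⟨_, f₀, hf₀, rfl⟩ (b := ‖w‖ + ε) (by rw [← hw]; linarith)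
  exact ⟨f, (ofRange T).incl_injective hf, hlt⟩

theorem norm_le_of_forall_toRange {T : F →ₗ[ℂ] V} {w : (ofRange T).Space} {K B : ℝ} (hK : 0 ≤ K)
    (h : ∀ f, toRange T f = w → B ≤ K * ‖f‖) : B ≤ K * ‖w‖ := by
  refine le_of_forall_pos_le_add fun ε hε => ?_
  -- Dividing by `K + 1` rather than by `K` covers `K = 0`.
  obtain ⟨f, hf, hlt⟩ := exists_toRange_eq T w (ε := ε / (K + 1)) (by positivity)
  have h1 : K * (ε / (K + 1)) ≤ ε := by
    rw [mul_div_assoc', div_le_iff₀ (by positivity)]; nlinarith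
  have h2 := mul_le_mul_of_nonneg_left hlt.le hK
  linarith [h f hf]

theorem completeSpace_ofRange [CompleteSpace F] (T : F →ₗ[ℂ] V) :
    CompleteSpace (ofRange T).Space := by
  let e : (ofRange T).Space ≃ₗᵢ[ℂ] F ⧸ LinearMap.ker T :=
    { (show (ofRange T).Space ≃ₗ[ℂ] F ⧸ LinearMap.ker T from T.quotKerEquivRange.symm) with
      norm_map' := fun x => rfl }
  exact (e.isometry.isUniformInducing.completeSpace_congr e.surjective).2 inferInstance

end OfRange

end Algebra

section Normed

variable {V : Type*} [NormedAddCommGroup V] [NormedSpace ℂ V] {X : SeminormedSubspace V}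

theorem IsBanach.eq_of_dist_eq_zero (hX : X.IsBanach) {x y : X.Space} (h : dist x y = 0) :
    x = y :=
  sub_eq_zero.1 (hX.definite (show X.carrier from x - y) (by rw [← h, dist_eq_norm]; rfl))

/-- The norm of a Banach space included in `V`. -/
@[reducible] def IsBanach.normedAddCommGroup (hX : X.IsBanach) : NormedAddCommGroup X.Space :=
  { (inferInstance : SeminormedAddCommGroup X.Space) with
    eq_of_dist_eq_zero := hX.eq_of_dist_eq_zero }

/-- The inclusion of a Banach space into `V`, as a continuous linear map. -/
def IsBanach.inclL (hX : X.IsBanach) : X.Space →L[ℂ] V := ⟨X.incl, hX.continuous_incl⟩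

theorem IsBanach.exists_norm_incl_le (hX : X.IsBanach) :
    ∃ K, 0 ≤ K ∧ ∀ x : X.Space, ‖X.incl x‖ ≤ K * ‖x‖ :=
  ⟨‖hX.inclL‖, norm_nonneg _, hX.inclL.le_opNorm⟩

/-- The integral is taken in `X`, so an integral computed in `V` is recognised as an element of `X`
with control of its `X`-norm and continuity in the parameter. -/
theorem IsBanach.exists_integral [CompleteSpace V] (hX : X.IsBanach) {w : ℝ → ℝ → X.Space}
    (hw : ∀ y, Continuous (w y)) (hw' : ∀ t, Continuous fun y => w y t) {G : ℝ → ℝ}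
    (hG : Integrable G) (hwG : ∀ y t, ‖w y t‖ ≤ G t) :
    ∃ U : ℝ →ᵇ X.Space, ‖U‖ ≤ ∫ t, G t ∧ ∀ y, X.incl (U y) = ∫ t, X.incl (w y t) := by
  let := hX.normedAddCommGroup
  have : CompleteSpace X.Space := hX.complete
  have hint : ∀ y, Integrable (w y) := fun y =>
    hG.mono' (hw y).aestronglyMeasurable (Eventually.of_forall (hwG y))
  have hc : Continuous fun y => ∫ t, w y t :=
    continuous_of_dominated (fun y => (hw y).aestronglyMeasurable)
      (fun y => Eventually.of_forall (hwG y)) hG (Eventually.of_forall hw')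
  have hb : ∀ y, ‖∫ t, w y t‖ ≤ ∫ t, G t := fun y =>
    norm_integral_le_of_norm_le hG (Eventually.of_forall (hwG y))
  refine ⟨BoundedContinuousFunction.ofNormedAddCommGroup (fun y => ∫ t, w y t) hc _ hb, ?_, ?_⟩
  · refine BoundedContinuousFunction.norm_ofNormedAddCommGroup_le hc ?_ hb
    exact (norm_nonneg _).trans (hb 0)
  · intro y
    exact (hX.inclL.integral_comp_comm (hint y)).symm

theorem isBanach_ofRange {F : Type*} [SeminormedAddCommGroup F] [NormedSpace ℂ F] [CompleteSpace F]
    {T : F →ₗ[ℂ] V} {K : ℝ} (hK : 0 ≤ K) (hT : ∀ f, ‖T f‖ ≤ K * ‖f‖) : (ofRange T).IsBanach := by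
  have hb : ∀ w : (ofRange T).Space, ‖(ofRange T).incl w‖ ≤ K * ‖w‖ := fun w =>
    norm_le_of_forall_toRange hK fun f hf => by rw [← hf]; exact hT f
  refine ⟨fun x hx => ?_, completeSpace_ofRange T, ?_⟩
  · have h := hb x
    rw [space_norm_eq, hx, mul_zero, norm_le_zero_iff] at h
    exact (ofRange T).incl_injective (h.trans (map_zero _).symm)
  · exact AddMonoidHomClass.continuous_of_bound (ofRange T).incl K hb

end Normed

/-! ### Continuous lifting through quotient maps -/

section Lift

variable {F Y : Type*} [SeminormedAddCommGroup F] [NormedSpace ℂ F] [SeminormedAddCommGroup Y]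
  [NormedSpace ℂ Y]

/-- Approximate lifts of norm at most `2 * m` form convex sets, and a lift of `u t` remains
admissible for nearby parameters. A partition of unity glues these locally constant choices. -/
theorem exists_boundedContinuous_approx_lift {π : F →L[ℂ] Y}
    (hlift : ∀ y, ∀ ε > 0, ∃ f, π f = y ∧ ‖f‖ < ‖y‖ + ε) (u : ℝ →ᵇ Y) {m : ℝ} (hm : 0 < m)
    (hu : ‖u‖ ≤ m) :
    ∃ ψ : ℝ →ᵇ F, ‖ψ‖ ≤ 2 * m ∧ ∀ t, ‖u t - π (ψ t)‖ ≤ m / 2 := by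
  set S : ℝ → Set F := fun t => {f : F | ‖f‖ ≤ 2 * m} ∩ {f : F | ‖u t - π f‖ ≤ m / 2} with hS
  have hconv : ∀ t, Convex ℝ (S t) := fun t => by
    have h1 : {f : F | ‖f‖ ≤ 2 * m} = Metric.closedBall 0 (2 * m) := by ext; simp
    have h2 : {f : F | ‖u t - π f‖ ≤ m / 2} =
        (π.toLinearMap.restrictScalars ℝ) ⁻¹' Metric.closedBall (u t) (m / 2) := by
      ext; simp [dist_eq_norm, norm_sub_rev]
    simp only [hS]
    rw [h1, h2]
    exact (convex_closedBall _ _).inter ((convex_closedBall _ _).linear_preimage _)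
  have hloc : ∀ t, ∃ f : F, ∀ᶠ s in 𝓝 t, f ∈ S s := fun t => by
    obtain ⟨f, hf, hlt⟩ := hlift (u t) m hm
    refine ⟨f, ?_⟩
    have h1 : ∀ᶠ s in 𝓝 t, ‖u s - u t‖ < m / 2 := by
      simpa only [dist_eq_norm] using
        Metric.tendsto_nhds.1 (u.continuous.tendsto t) (m / 2) (by positivity)
    filter_upwards [h1] with s hs
    refine ⟨?_, ?_⟩
    · have := u.norm_coe_le_norm t
      change ‖f‖ ≤ 2 * m; linarith
    · change ‖u s - π f‖ ≤ m / 2; rw [hf]; exact hs.le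
  obtain ⟨g, hg⟩ := exists_continuous_forall_mem_convex_of_local_const hconv hloc
  exact ⟨BoundedContinuousFunction.ofNormedAddCommGroup g g.continuous _ fun t => (hg t).1,
    BoundedContinuousFunction.norm_ofNormedAddCommGroup_le g.continuous (by positivity)
      fun t => (hg t).1, fun t => (hg t).2⟩

/-- A bounded continuous function with values in a quotient of a complete space lifts to a bounded
continuous function. -/
theorem exists_boundedContinuous_lift [CompleteSpace F] {π : F →L[ℂ] Y}
    (hlift : ∀ y, ∀ ε > 0, ∃ f, π f = y ∧ ‖f‖ < ‖y‖ + ε) (hY : ∀ y : Y, ‖y‖ = 0 → y = 0)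
    (u : ℝ →ᵇ Y) : ∃ ψ : ℝ →ᵇ F, ‖ψ‖ ≤ 4 * ‖u‖ ∧ ∀ t, π (ψ t) = u t := by
  rcases (norm_nonneg u).eq_or_lt with h0 | hpos
  · refine ⟨0, by simp, fun t => ?_⟩
    have : ‖u t‖ = 0 := le_antisymm ((u.norm_coe_le_norm t).trans_eq h0.symm) (norm_nonneg _)
    simp [hY _ this]
  set m := ‖u‖ with hm
  -- Each approximate lift halves the residual. The corrections, of norm at most `2 * (m / 2 ^ k)`,
  -- sum to norm at most `4 * m`.
  have step : ∀ k : ℕ, ∀ v : {v : ℝ →ᵇ Y // ‖v‖ ≤ m / 2 ^ k}, ∃ ψ : ℝ →ᵇ F,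
      ‖ψ‖ ≤ 2 * (m / 2 ^ k) ∧
      ‖v.1 - (ContinuousLinearMap.compLeftContinuousBounded ℝ π) ψ‖ ≤ m / 2 ^ (k + 1) := by
    intro k v
    obtain ⟨ψ, h1, h2⟩ := exists_boundedContinuous_approx_lift hlift v.1
      (m := m / 2 ^ k) (by positivity) v.2
    refine ⟨ψ, h1, (BoundedContinuousFunction.norm_le (by positivity)).2 fun t => ?_⟩
    refine (h2 t).trans_eq ?_
    rw [pow_succ, div_div]
  choose Ψ hΨ1 hΨ2 using step
  let v : (k : ℕ) → {v : ℝ →ᵇ Y // ‖v‖ ≤ m / 2 ^ k} := fun k =>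
    Nat.rec ⟨u, by simp [hm]⟩
      (fun k w => ⟨w.1 - (ContinuousLinearMap.compLeftContinuousBounded ℝ π) (Ψ k w), hΨ2 k w⟩) k
  have hvs : ∀ k, (v (k + 1)).1 = (v k).1 -
      (ContinuousLinearMap.compLeftContinuousBounded ℝ π) (Ψ k (v k)) := fun k => rfl
  have hgeo : HasSum (fun k : ℕ => 2 * (m / 2 ^ k)) (4 * m) := by
    have := (hasSum_geometric_two).mul_left (2 * m)
    have e : (fun k : ℕ => 2 * (m / 2 ^ k)) = fun k : ℕ => 2 * m * (1 / 2) ^ k := by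
      funext k; rw [div_pow, one_pow]; ring
    rw [e, show 4 * m = 2 * m * 2 by ring]
    exact this
  have hsum : Summable fun k => Ψ k (v k) :=
    Summable.of_norm_bounded hgeo.summable fun k => hΨ1 k (v k)
  obtain ⟨ψ, hψ⟩ := hsum
  have hpart : ∀ k, (ContinuousLinearMap.compLeftContinuousBounded ℝ π)
      (∑ i ∈ Finset.range k, Ψ i (v i)) = u - (v k).1 := by
    intro k
    induction k with
    | zero => simp [v]
    | succ k ih => rw [Finset.sum_range_succ, map_add, ih, hvs]; abel
  have hlim := hψ.tendsto_sum_nat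
  refine ⟨ψ, ?_, fun t => ?_⟩
  · refine le_of_tendsto hlim.norm (Eventually.of_forall fun k => ?_)
    exact (norm_sum_le_of_le _ fun i _ => hΨ1 i (v i)).trans
      (sum_le_hasSum _ (fun i _ => by positivity) hgeo)
  · rw [← sub_eq_zero]
    refine hY _ ?_
    have h1 : Tendsto (fun k => ‖π ((∑ i ∈ Finset.range k, Ψ i (v i)) t) - u t‖) atTop
        (𝓝 ‖π (ψ t) - u t‖) := by
      have : Tendsto (fun k => (∑ i ∈ Finset.range k, Ψ i (v i)) t) atTop (𝓝 (ψ t)) :=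
        ((continuous_eval_const t).tendsto ψ).comp hlim
      exact (((π.continuous.tendsto _).comp this).sub_const _).norm
    have h2 : Tendsto (fun k => ‖π ((∑ i ∈ Finset.range k, Ψ i (v i)) t) - u t‖) atTop (𝓝 0) := by
      refine squeeze_zero (fun _ => norm_nonneg _) (g := fun k : ℕ => m / 2 ^ k) (fun k => ?_) ?_
      · have h3 : π ((∑ i ∈ Finset.range k, Ψ i (v i)) t) = (u - (v k).1) t := by
          rw [← hpart k]; rfl
        rw [h3, BoundedContinuousFunction.coe_sub, Pi.sub_apply, sub_sub_cancel_left, norm_neg]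
        exact ((v k).1.norm_coe_le_norm t).trans (v k).2
      · have := (tendsto_pow_atTop_nhds_zero_of_lt_one (r := (1 / 2 : ℝ)) (by norm_num)
          (by norm_num)).const_mul m
        simpa [div_eq_mul_inv] using this
    exact tendsto_nhds_unique h1 h2

end Lift

end SeminormedSubspace

/-! ### Basic properties of Calderón spaces -/

namespace Calderon

variable {V : Type*} [NormedAddCommGroup V] [NormedSpace ℂ V] {X Y : SeminormedSubspace V} {a b : ℝ}

/-- The boundary function on the left edge. -/
def left : Calderon X Y a b →ₗ[ℂ] (ℝ →ᵇ X.Space) := LinearMap.fst ℂ _ _ ∘ₗ boundary X Y a b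

/-- The boundary function on the right edge. -/
def right : Calderon X Y a b →ₗ[ℂ] (ℝ →ᵇ Y.Space) := LinearMap.snd ℂ _ _ ∘ₗ boundary X Y a b

theorem differentiableOn_fn (f : Calderon X Y a b) :
    DifferentiableOn ℂ (fn X Y a b f) (openStrip a b) := f.2.1

theorem continuousOn_fn (f : Calderon X Y a b) :
    ContinuousOn (fn X Y a b f) (closedStrip a b) := f.2.2.1

theorem fn_left (f : Calderon X Y a b) (t : ℝ) :
    fn X Y a b f (a + t * Complex.I) = X.incl (left f t) := f.2.2.2.2.1 t

theorem fn_right (f : Calderon X Y a b) (t : ℝ) :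
    fn X Y a b f (b + t * Complex.I) = Y.incl (right f t) := f.2.2.2.2.2 t

theorem exists_norm_fn_le_of_mem (f : Calderon X Y a b) :
    ∃ M : ℝ, ∀ z ∈ openStrip a b, ‖fn X Y a b f z‖ ≤ M := f.2.2.2.1

theorem norm_eq_max (f : Calderon X Y a b) : ‖f‖ = max ‖left f‖ ‖right f‖ := rfl

theorem norm_left_le (f : Calderon X Y a b) (t : ℝ) : ‖left f t‖ ≤ ‖f‖ :=
  ((left f).norm_coe_le_norm t).trans (le_max_left _ _)

theorem norm_right_le (f : Calderon X Y a b) (t : ℝ) : ‖right f t‖ ≤ ‖f‖ :=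
  ((right f).norm_coe_le_norm t).trans (le_max_right _ _)

theorem isUniformInducing_boundary : IsUniformInducing (boundary X Y a b) := ⟨rfl⟩

theorem continuous_left : Continuous (left : Calderon X Y a b → _) :=
  continuous_fst.comp (isUniformInducing_boundary (X := X) (Y := Y)).uniformContinuous.continuous

theorem continuous_right : Continuous (right : Calderon X Y a b → _) :=
  continuous_snd.comp (isUniformInducing_boundary (X := X) (Y := Y)).uniformContinuous.continuous

/-- The element of the Calderón space given by a function and its boundary functions. -/
def ofFn (f : ℂ → V) (u : ℝ →ᵇ X.Space) (v : ℝ →ᵇ Y.Space)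
    (hd : DifferentiableOn ℂ f (openStrip a b)) (hc : ContinuousOn f (closedStrip a b))
    (hM : ∃ M : ℝ, ∀ z ∈ openStrip a b, ‖f z‖ ≤ M)
    (hu : ∀ t : ℝ, f (a + t * Complex.I) = X.incl (u t))
    (hv : ∀ t : ℝ, f (b + t * Complex.I) = Y.incl (v t)) : Calderon X Y a b :=
  ⟨(f, u, v), hd, hc, hM, hu, hv⟩

/-- The a priori bound in the definition depends on `f` and is not controlled by `‖f‖`. It only
supplies the growth condition for Phragmén–Lindelöf, which then bounds `f` by its edge values. -/
theorem exists_norm_fn_le (hX : X.IsBanach) (hY : Y.IsBanach) (hab : a < b) :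
    ∃ K, 0 ≤ K ∧ ∀ f : Calderon X Y a b, ∀ z ∈ closedStrip a b, ‖fn X Y a b f z‖ ≤ K * ‖f‖ := by
  obtain ⟨K, hK, hKX⟩ := hX.exists_norm_incl_le
  obtain ⟨L, hL, hLY⟩ := hY.exists_norm_incl_le
  refine ⟨max K L, le_max_of_le_left hK, fun f z hz => ?_⟩
  obtain ⟨M, hM⟩ := f.exists_norm_fn_le_of_mem
  have hline : ∀ x : ℝ, ∀ z : ℂ, z.re = x → z = x + z.im * Complex.I := fun x z h => by
    rw [← h, Complex.re_add_im]
  have hclosed : IsClosed (closedStrip a b) :=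
    (isClosed_le continuous_const Complex.continuous_re).inter
      (isClosed_le Complex.continuous_re continuous_const)
  refine PhragmenLindelof.vertical_strip (a := a) (b := b) (f := fn X Y a b f) ?_
    ⟨0, by have := sub_pos.2 hab; positivity, 0, ?_⟩ (fun w hw => ?_) (fun w hw => ?_) hz.1 hz.2
  · exact ⟨f.differentiableOn_fn, f.continuousOn_fn.mono
      (closure_minimal (openStrip_subset_closedStrip a b) hclosed)⟩
  · refine Asymptotics.IsBigO.of_bound M ?_
    filter_upwards [mem_inf_of_right (mem_principal_self _)] with w hw
    simpa using hM w hw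
  · rw [hline a w hw, f.fn_left]
    refine (hKX _).trans ?_
    gcongr
    exacts [le_max_left _ _, f.norm_left_le _]
  · rw [hline b w hw, f.fn_right]
    refine (hLY _).trans ?_
    gcongr
    exacts [le_max_right _ _, f.norm_right_le _]

/-- The norm sees only the edges, but by the maximum principle a Cauchy sequence is uniformly Cauchy
on the closed strip, so analyticity and continuity pass to the limit. -/
theorem completeSpace [CompleteSpace V] (hX : X.IsBanach) (hY : Y.IsBanach) (hab : a < b) :
    CompleteSpace (Calderon X Y a b) := by
  have := hX.complete
  have := hY.complete
  obtain ⟨K, hK, hKf⟩ := exists_norm_fn_le hX hY hab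
  refine Metric.complete_of_cauchySeq_tendsto fun f hf => ?_
  obtain ⟨⟨u, v⟩, huv⟩ := cauchySeq_tendsto_of_complete
    ((isUniformInducing_boundary (X := X) (Y := Y)).uniformContinuous.comp_cauchySeq hf)
  have hu : ∀ t, Tendsto (fun k => left (f k) t) atTop (𝓝 (u t)) := fun t =>
    ((continuous_eval_const t).tendsto u).comp ((continuous_fst.tendsto (u, v)).comp huv)
  have hv : ∀ t, Tendsto (fun k => right (f k) t) atTop (𝓝 (v t)) := fun t =>
    ((continuous_eval_const t).tendsto v).comp ((continuous_snd.tendsto (u, v)).comp huv)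
  have hcau : ∀ ε > 0, ∃ N, ∀ m ≥ N, ∀ n ≥ N, ∀ z ∈ closedStrip a b,
      ‖fn X Y a b (f m) z - fn X Y a b (f n) z‖ ≤ ε := by
    intro ε hε
    obtain ⟨N, hN⟩ := Metric.cauchySeq_iff.1 hf (ε / (K + 1)) (by positivity)
    refine ⟨N, fun m hm n hn z hz => ?_⟩
    have h1 := hKf (f m - f n) z hz
    rw [map_sub, Pi.sub_apply] at h1
    have h2 := (hN m hm n hn).le
    rw [dist_eq_norm, le_div_iff₀ (by positivity)] at h2
    nlinarith [norm_nonneg (f m - f n)]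
  have hlim : ∀ z, ∃ w, z ∈ closedStrip a b →
      Tendsto (fun k => fn X Y a b (f k) z) atTop (𝓝 w) := by
    intro z
    by_cases hz : z ∈ closedStrip a b
    · obtain ⟨w, hw⟩ := cauchySeq_tendsto_of_complete (u := fun k => fn X Y a b (f k) z) (by
        refine Metric.cauchySeq_iff'.2 fun ε hε => ?_
        obtain ⟨N, hN⟩ := hcau (ε / 2) (by positivity)
        exact ⟨N, fun n hn => by
          rw [dist_eq_norm]; linarith [hN n hn N le_rfl z hz]⟩)
      exact ⟨w, fun _ => hw⟩
    · exact ⟨0, fun h => absurd h hz⟩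
  choose F hF using hlim
  have hunif : TendstoUniformlyOn (fun k => fn X Y a b (f k)) F atTop (closedStrip a b) := by
    refine Metric.tendstoUniformlyOn_iff.2 fun ε hε => ?_
    obtain ⟨N, hN⟩ := hcau (ε / 2) (by positivity)
    filter_upwards [eventually_ge_atTop N] with n hn z hz
    rw [dist_eq_norm]
    have : ‖F z - fn X Y a b (f n) z‖ ≤ ε / 2 :=
      le_of_tendsto ((hF z hz).sub_const _).norm
        ((eventually_ge_atTop N).mono fun m hm => hN m hm n hn z hz)
    linarith
  have hFc : ContinuousOn F (closedStrip a b) :=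
    hunif.continuousOn (Eventually.of_forall fun k => (f k).continuousOn_fn).frequently
  have hFd : DifferentiableOn ℂ F (openStrip a b) :=
    (hunif.mono (openStrip_subset_closedStrip a b)).tendstoLocallyUniformlyOn.differentiableOn
      (Eventually.of_forall fun k => (f k).differentiableOn_fn) (isOpen_openStrip a b)
  have hFb : ∃ M : ℝ, ∀ z ∈ openStrip a b, ‖F z‖ ≤ M := by
    obtain ⟨N, hN⟩ := hcau 1 one_pos
    refine ⟨1 + K * ‖f N‖, fun z hz => ?_⟩
    have hz' := openStrip_subset_closedStrip a b hz
    refine le_of_tendsto (hF z hz').norm ((eventually_ge_atTop N).mono fun m hm => ?_)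
    have h1 := hN m hm N le_rfl z hz'
    have h2 := hKf (f N) z hz'
    linarith [norm_le_norm_sub_add (fn X Y a b (f m) z) (fn X Y a b (f N) z)]
  refine ⟨ofFn F u v hFd hFc hFb (fun t => ?_) (fun t => ?_), ?_⟩
  · refine tendsto_nhds_unique (hF _ (add_mul_I_mem_closedStrip le_rfl hab.le t)) ?_
    simp only [fn_left]
    exact (hX.continuous_incl.tendsto _).comp (hu t)
  · refine tendsto_nhds_unique (hF _ (add_mul_I_mem_closedStrip hab.le le_rfl t)) ?_
    simp only [fn_right]
    exact (hY.continuous_incl.tendsto _).comp (hv t)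
  · exact (isUniformInducing_boundary (X := X) (Y := Y)).isInducing.tendsto_nhds_iff.2 huv

theorem continuous_eval_fn (hX : X.IsBanach) (hY : Y.IsBanach) (hab : a < b)
    {Ψ : ℝ → Calderon X Y a b} (hΨ : Continuous Ψ) {γ : ℝ → ℂ} (hγ : Continuous γ)
    (hγs : ∀ t, γ t ∈ closedStrip a b) : Continuous fun t => fn X Y a b (Ψ t) (γ t) := by
  obtain ⟨K, hK, hKf⟩ := exists_norm_fn_le hX hY hab
  refine continuous_iff_continuousAt.2 fun t₀ => ?_
  have h1 : Tendsto (fun t => fn X Y a b (Ψ t₀) (γ t)) (𝓝 t₀) (𝓝 (fn X Y a b (Ψ t₀) (γ t₀))) :=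
    ((Ψ t₀).continuousOn_fn.comp_continuous hγ hγs).tendsto t₀
  have h2 : Tendsto (fun t => fn X Y a b (Ψ t - Ψ t₀) (γ t)) (𝓝 t₀) (𝓝 0) := by
    refine squeeze_zero_norm (fun t => hKf _ _ (hγs t)) ?_
    have := (tendsto_iff_norm_sub_tendsto_zero.1 (hΨ.tendsto t₀)).const_mul K
    simpa using this
  refine ((h2.add h1).congr fun t => ?_).trans_eq (by rw [zero_add])
  rw [map_sub, Pi.sub_apply, sub_add_cancel]

/-! ### Vertical translations -/

section Translate

theorem add_mul_I_mem_openStrip_iff {z : ℂ} {s : ℝ} :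
    z + s * Complex.I ∈ openStrip a b ↔ z ∈ openStrip a b := by simp [openStrip]

theorem add_mul_I_mem_closedStrip_iff {z : ℂ} {s : ℝ} :
    z + s * Complex.I ∈ closedStrip a b ↔ z ∈ closedStrip a b := by simp [closedStrip]

/-- Vertical translation of a bounded continuous function. -/
def shift {W : Type*} [SeminormedAddCommGroup W] (s : ℝ) (u : ℝ →ᵇ W) : ℝ →ᵇ W :=
  u.compContinuous ⟨fun t => t + s, by fun_prop⟩

theorem shift_apply {W : Type*} [SeminormedAddCommGroup W] (s : ℝ) (u : ℝ →ᵇ W) (t : ℝ) :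
    shift s u t = u (t + s) := rfl

/-- Translation is sup-norm continuous only on uniformly continuous functions; vanishing at infinity
ensures this. This is why elements of the Calderón space are multiplied by a cutoff before being
translated. -/
theorem continuous_shift {W : Type*} [SeminormedAddCommGroup W] {u : ℝ →ᵇ W}
    (hu : Tendsto u (cocompact ℝ) (𝓝 0)) : Continuous fun s => shift s u := by
  have huc : UniformContinuous u := u.continuous.uniformContinuous_of_tendsto_cocompact hu
  refine Metric.continuous_iff.2 fun s ε hε => ?_
  obtain ⟨δ, hδ, h⟩ := Metric.uniformContinuous_iff.1 huc (ε / 2) (by positivity)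
  refine ⟨δ, hδ, fun s' hs' => ?_⟩
  refine lt_of_le_of_lt ((BoundedContinuousFunction.dist_le (by positivity)).2 fun t => ?_)
    (half_lt_self hε)
  exact (h (by simpa [shift_apply] using hs')).le

/-- Vertical translation of an element of the Calderón space. -/
def translate (s : ℝ) (f : Calderon X Y a b) : Calderon X Y a b :=
  ofFn (fun z => fn X Y a b f (z + s * Complex.I)) (shift s (left f)) (shift s (right f))
    (f.differentiableOn_fn.comp (by fun_prop) fun _ hz => add_mul_I_mem_openStrip_iff.2 hz)
    (f.continuousOn_fn.comp (by fun_prop) fun _ hz => add_mul_I_mem_closedStrip_iff.2 hz)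
    (by
      obtain ⟨M, hM⟩ := f.exists_norm_fn_le_of_mem
      exact ⟨M, fun z hz => hM _ (add_mul_I_mem_openStrip_iff.2 hz)⟩)
    (fun t => by
      rw [shift_apply, ← fn_left]; exact congrArg _ (by push_cast; ring))
    (fun t => by
      rw [shift_apply, ← fn_right]; exact congrArg _ (by push_cast; ring))

theorem norm_translate_le (s : ℝ) (f : Calderon X Y a b) : ‖translate s f‖ ≤ ‖f‖ := by
  rw [norm_eq_max]
  refine max_le ?_ ?_
  · exact (BoundedContinuousFunction.norm_le (norm_nonneg _)).2 fun t => f.norm_left_le _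
  · exact (BoundedContinuousFunction.norm_le (norm_nonneg _)).2 fun t => f.norm_right_le _

theorem continuous_translate {f : Calderon X Y a b} (hl : Tendsto (left f) (cocompact ℝ) (𝓝 0))
    (hr : Tendsto (right f) (cocompact ℝ) (𝓝 0)) : Continuous fun s => translate s f :=
  (isUniformInducing_boundary (X := X) (Y := Y)).isInducing.continuous_iff.2
    ((continuous_shift hl).prodMk (continuous_shift hr))

end Translate

/-- The product of a bounded continuous function with a bounded continuous scalar function. -/
theorem exists_smul {W : Type*} [SeminormedAddCommGroup W] [NormedSpace ℂ W] (u : ℝ →ᵇ W)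
    {m : ℝ → ℂ} (hm : Continuous m) {K : ℝ} (hK : ∀ t, ‖m t‖ ≤ K) :
    ∃ v : ℝ →ᵇ W, (∀ t, v t = m t • u t) ∧ ‖v‖ ≤ K * ‖u‖ := by
  have hb : ∀ t, ‖m t • u t‖ ≤ K * ‖u‖ := fun t => by
    rw [norm_smul]
    exact mul_le_mul (hK t) (u.norm_coe_le_norm t) (norm_nonneg _) ((norm_nonneg _).trans (hK t))
  exact ⟨BoundedContinuousFunction.ofNormedAddCommGroup _ (hm.smul u.continuous) _ hb,
    fun t => rfl, BoundedContinuousFunction.norm_ofNormedAddCommGroup_le _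
      ((norm_nonneg _).trans (hb 0)) hb⟩

/-- Multiplication by a bounded analytic function. -/
theorem exists_mul (hab : a ≤ b) (f : Calderon X Y a b) {m : ℂ → ℂ}
    (hd : DifferentiableOn ℂ m (openStrip a b)) (hc : ContinuousOn m (closedStrip a b)) {K : ℝ}
    (hK : ∀ z ∈ closedStrip a b, ‖m z‖ ≤ K) :
    ∃ g : Calderon X Y a b, (∀ z, fn X Y a b g z = m z • fn X Y a b f z) ∧ ‖g‖ ≤ K * ‖f‖ ∧
      (∀ t : ℝ, left g t = m (a + t * Complex.I) • left f t) ∧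
      (∀ t : ℝ, right g t = m (b + t * Complex.I) • right f t) := by
  have hK0 : 0 ≤ K := (norm_nonneg _).trans
    (hK _ (add_mul_I_mem_closedStrip le_rfl hab 0))
  obtain ⟨u, hu, hun⟩ := exists_smul (left f) (continuous_vertical le_rfl hab hc)
    (fun t => hK _ (add_mul_I_mem_closedStrip le_rfl hab t))
  obtain ⟨v, hv, hvn⟩ := exists_smul (right f) (continuous_vertical hab le_rfl hc)
    (fun t => hK _ (add_mul_I_mem_closedStrip hab le_rfl t))
  refine ⟨ofFn (fun z => m z • fn X Y a b f z) u v (hd.smul f.differentiableOn_fn)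
    (hc.smul f.continuousOn_fn) ?_ (fun t => ?_) (fun t => ?_), fun z => rfl, ?_, hu, hv⟩
  · obtain ⟨M, hM⟩ := f.exists_norm_fn_le_of_mem
    refine ⟨K * M, fun z hz => ?_⟩
    rw [norm_smul]
    exact mul_le_mul (hK z (openStrip_subset_closedStrip a b hz)) (hM z hz) (norm_nonneg _) hK0
  · rw [hu, map_smul, fn_left]
  · rw [hv, map_smul, fn_right]
  · rw [norm_eq_max]
    refine max_le (hun.trans ?_) (hvn.trans ?_)
    · exact mul_le_mul_of_nonneg_left (le_max_left _ _) hK0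
    · exact mul_le_mul_of_nonneg_left (le_max_right _ _) hK0

end Calderon

/-! ### Decaying weights -/

section Weights

/-- A rational function equal to `1` at `c` which decays like `|z| ^ (-2 (n + 1))`. -/
def decay (c : ℝ) (n : ℕ) (z : ℂ) : ℂ := (2 / (2 + z - c)) ^ (2 * (n + 1))

/-- A function which decays like `decay c n` and agrees with `1` at `c` to order `n`. -/
def cutoff (c : ℝ) (n : ℕ) (z : ℂ) : ℂ := 1 - (1 - decay c n z) ^ n

variable {c : ℝ} {n : ℕ}

theorem decay_self (c : ℝ) (n : ℕ) : decay c n c = 1 := by simp [decay]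

theorem one_add_im_sq_le {z : ℂ} (hz : c - 1 ≤ z.re) : 1 + z.im ^ 2 ≤ ‖2 + z - c‖ ^ 2 := by
  have h1 : (1 : ℝ) ≤ |(2 + z - c : ℂ).re| := by
    refine le_trans ?_ (le_abs_self _)
    simp; linarith
  simpa using mul_one_add_sq_le_norm_sq zero_le_one le_rfl h1

theorem two_add_sub_ne_zero {z : ℂ} (hz : c - 1 ≤ z.re) : 2 + z - c ≠ 0 := fun h => by
  have := one_add_im_sq_le hz
  rw [h] at this
  simp at this
  nlinarith [sq_nonneg z.im]

theorem differentiableAt_decay {z : ℂ} (hz : c - 1 ≤ z.re) : DifferentiableAt ℂ (decay c n) z := by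
  have := two_add_sub_ne_zero hz
  unfold decay
  fun_prop (disch := assumption)

theorem differentiableAt_cutoff {z : ℂ} (hz : c - 1 ≤ z.re) :
    DifferentiableAt ℂ (cutoff c n) z := by
  have := differentiableAt_decay (n := n) hz
  unfold cutoff
  fun_prop

theorem norm_decay_le {z : ℂ} (hz : c - 1 ≤ z.re) :
    ‖decay c n z‖ ≤ 4 ^ (n + 1) * ((1 + z.im ^ 2) ^ (n + 1))⁻¹ := by
  have h := one_add_im_sq_le hz
  rw [decay, norm_pow, norm_div, pow_mul, div_pow, Complex.norm_ofNat, ← inv_pow, ← mul_pow,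
    div_eq_mul_inv]
  norm_num
  gcongr

/-- Raised to the power `n`, this factorisation gives `1 - cutoff c n z = (z - c) ^ n * e z ^ n`:
the cutoff does not affect Taylor coefficients at `c` of order less than `n`. -/
theorem exists_one_sub_decay (c : ℝ) (n : ℕ) : ∃ e : ℂ → ℂ,
    (∀ z : ℂ, c - 1 ≤ z.re → DifferentiableAt ℂ e z ∧ 1 - decay c n z = (z - c) * e z) := by
  refine ⟨fun z => (2 + z - c)⁻¹ * ∑ i ∈ Finset.range (2 * (n + 1)), (2 / (2 + z - c)) ^ i,
    fun z hz => ?_⟩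
  have h := two_add_sub_ne_zero hz
  refine ⟨by fun_prop (disch := assumption), ?_⟩
  rw [decay, ← mul_neg_geom_sum, ← mul_assoc]
  congr 1
  field_simp
  ring

/-- The geometric sum makes the cutoff a bounded multiple of `decay c n`. For `n = 0` the cutoff is
zero, and there are no coefficients to preserve. -/
theorem exists_norm_cutoff_le (c : ℝ) (n : ℕ) : ∃ K, 0 ≤ K ∧ ∀ z : ℂ, c - 1 ≤ z.re →
    ‖cutoff c n z‖ ≤ K * ((1 + z.im ^ 2) ^ (n + 1))⁻¹ := by
  refine ⟨(∑ i ∈ Finset.range n, (1 + 4 ^ (n + 1) : ℝ) ^ i) * 4 ^ (n + 1), by positivity,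
    fun z hz => ?_⟩
  have h := norm_decay_le (n := n) hz
  have h1 : ‖decay c n z‖ ≤ 4 ^ (n + 1) := h.trans (mul_le_of_le_one_right (by positivity)
    (inv_le_one_of_one_le₀ (one_le_pow₀ (by nlinarith [sq_nonneg z.im]))))
  have h2 : cutoff c n z = (∑ i ∈ Finset.range n, (1 - decay c n z) ^ i) * decay c n z := by
    rw [cutoff, ← geom_sum_mul_neg]; ring
  rw [h2, norm_mul, mul_assoc]
  gcongr
  refine norm_sum_le_of_le _ fun i _ => ?_
  rw [norm_pow]
  gcongr
  refine (norm_sub_le _ _).trans ?_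
  simpa using h1

end Weights

/-! ### Taylor polynomials of elements of the Calderón space -/

/-- The polynomial with coefficients `v`, at the point `u`. -/
def polyEval {V : Type*} [AddCommGroup V] [Module ℂ V] {n : ℕ} (v : Fin n → V) (u : ℂ) : V :=
  ∑ i : Fin n, u ^ (i : ℕ) • v i

section PolyEval

variable {V : Type*} [NormedAddCommGroup V] [NormedSpace ℂ V] {n : ℕ}

theorem continuous_polyEval : Continuous fun q : (Fin n → V) × ℂ => polyEval q.1 q.2 := by
  unfold polyEval; fun_prop

theorem differentiable_polyEval (v : Fin n → V) : Differentiable ℂ (polyEval v) := by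
  unfold polyEval; fun_prop

theorem polyEval_eq_sum_range (v : Fin n → V) (u : ℂ) :
    polyEval v u = ∑ i ∈ Finset.range n, u ^ i • (fun i => if h : i < n then v ⟨i, h⟩ else 0) i := by
  rw [polyEval, Finset.sum_range]
  simp

theorem norm_polyEval_le (v : Fin n → V) {u : ℂ} {r : ℝ} (hr : 1 ≤ r) (hu : ‖u‖ ≤ r) :
    ‖polyEval v u‖ ≤ r ^ n * ∑ i, ‖v i‖ := by
  rw [polyEval, Finset.mul_sum]
  refine norm_sum_le_of_le _ fun i _ => ?_
  rw [norm_smul, norm_pow]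
  have : ‖u‖ ^ (i : ℕ) ≤ r ^ n :=
    (pow_le_pow_left₀ (norm_nonneg _) hu _).trans (pow_le_pow_right₀ hr i.2.le)
  gcongr

end PolyEval

namespace Calderon

variable {V : Type*} [NormedAddCommGroup V] [NormedSpace ℂ V] [CompleteSpace V]
  {X Y : SeminormedSubspace V} {a b : ℝ} {n : ℕ}

theorem taylorCoeffs_eq_of_eventuallyEq (f : Calderon X Y a b) {z : ℂ} (hz : z ∈ openStrip a b)
    {v : Fin n → V} {E : ℂ → V} (hE : AnalyticAt ℂ E z)
    (h : fn X Y a b f =ᶠ[𝓝 z] fun w => polyEval v (w - z) + (w - z) ^ n • E w) :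
    taylorCoeffs X Y a b n hz f = v := by
  funext i
  have := taylorCoeff_of_eventuallyEq hE n (f := fn X Y a b f)
    (v := fun i => if h : i < n then v ⟨i, h⟩ else 0)
    (h.trans (Eventually.of_forall fun w => by simp only [polyEval_eq_sum_range])) i i.2
  exact this.trans (by simp)

/-- The remainder of the Taylor expansion of order `n` at `p`, divided by `(z - p) ^ n`. -/
def remainder (n : ℕ) (p : ℂ) (f : Calderon X Y a b) : ℂ → V :=
  (Function.swap dslope p)^[n] (fn X Y a b f)

theorem analyticAt_fn (f : Calderon X Y a b) {z : ℂ} (hz : z ∈ openStrip a b) :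
    AnalyticAt ℂ (fn X Y a b f) z :=
  f.differentiableOn_fn.analyticAt ((isOpen_openStrip a b).mem_nhds hz)

theorem fn_eq_polyEval_add (f : Calderon X Y a b) {p : ℂ} (hp : p ∈ openStrip a b) (z : ℂ) :
    fn X Y a b f z = polyEval (taylorCoeffs X Y a b n hp f) (z - p) +
      (z - p) ^ n • remainder n p f z := by
  refine (eq_sum_add_pow_smul_iterate_dslope p _ n z).trans ?_
  rw [polyEval, Finset.sum_range]
  congr 1
  refine Finset.sum_congr rfl fun i _ => ?_
  rw [← taylorCoeff_eq_iterate_dslope (f.analyticAt_fn hp)]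
  rfl

theorem differentiableOn_remainder (f : Calderon X Y a b) {p : ℂ} (hp : p ∈ openStrip a b) :
    DifferentiableOn ℂ (remainder n p f) (openStrip a b) :=
  differentiableOn_iterate_dslope ((isOpen_openStrip a b).mem_nhds hp) f.differentiableOn_fn n

theorem continuousOn_remainder (f : Calderon X Y a b) {p : ℂ} (hp : p ∈ openStrip a b) :
    ContinuousOn (remainder n p f) (closedStrip a b) :=
  continuousOn_iterate_dslope ((isOpen_openStrip a b).mem_nhds hp)
    (openStrip_subset_closedStrip a b) f.differentiableOn_fn f.continuousOn_fn n

theorem ball_subset_openStrip {p : ℂ} {d : ℝ} (h₁ : a + d ≤ p.re) (h₂ : p.re + d ≤ b) :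
    Metric.ball p d ⊆ openStrip a b := fun z hz => by
  rw [Metric.mem_ball, dist_eq_norm] at hz
  have := abs_lt.1 ((Complex.abs_re_le_norm (z - p)).trans_lt hz)
  rw [Complex.sub_re] at this
  exact ⟨by linarith [this.1], by linarith [this.2]⟩

theorem norm_remainder_le (f : Calderon X Y a b) {p : ℂ} {d M : ℝ} (hd : 0 < d)
    (h₁ : a + d ≤ p.re) (h₂ : p.re + d ≤ b) (hM : ∀ z ∈ closedStrip a b, ‖fn X Y a b f z‖ ≤ M)
    (n : ℕ) {z : ℂ} (hz : z ∈ closedStrip a b) : ‖remainder n p f z‖ ≤ (2 / d) ^ n * M := by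
  have h := ball_subset_openStrip h₁ h₂
  exact norm_iterate_dslope_le hd (h.trans (openStrip_subset_closedStrip a b))
    (f.differentiableOn_fn.mono h) hM n hz

theorem norm_taylorCoeffs_apply_le (f : Calderon X Y a b) {p : ℂ} (hp : p ∈ openStrip a b)
    {d M : ℝ} (hd : 0 < d) (h₁ : a + d ≤ p.re) (h₂ : p.re + d ≤ b)
    (hM : ∀ z ∈ closedStrip a b, ‖fn X Y a b f z‖ ≤ M) (i : Fin n) :
    ‖taylorCoeffs X Y a b n hp f i‖ ≤ (2 / d) ^ (i : ℕ) * M := by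
  have h := norm_remainder_le f hd h₁ h₂ hM i (openStrip_subset_closedStrip a b hp)
  rw [remainder, ← taylorCoeff_eq_iterate_dslope (f.analyticAt_fn hp)] at h
  exact h

theorem exists_norm_taylorCoeffs_le (hX : X.IsBanach) (hY : Y.IsBanach) {p : ℂ}
    (hp : p ∈ openStrip a b) (n : ℕ) :
    ∃ K, 0 ≤ K ∧ ∀ f, ‖taylorCoeffs X Y a b n hp f‖ ≤ K * ‖f‖ := by
  obtain ⟨K, hK, hKf⟩ := exists_norm_fn_le hX hY (hp.1.trans hp.2)
  set d := min (p.re - a) (b - p.re) with hd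
  have hd0 : 0 < d := lt_min (sub_pos.2 hp.1) (sub_pos.2 hp.2)
  refine ⟨∑ i : Fin n, (2 / d) ^ (i : ℕ) * K, by positivity, fun f => ?_⟩
  refine (pi_norm_le_iff_of_nonneg (by positivity)).2 fun i => ?_
  refine (norm_taylorCoeffs_apply_le f hp hd0 (by linarith [min_le_left (p.re - a) (b - p.re)])
    (by linarith [min_le_right (p.re - a) (b - p.re)]) (hKf f) i).trans ?_
  rw [← mul_assoc]
  gcongr
  exact Finset.single_le_sum (f := fun i : Fin n => (2 / d) ^ (i : ℕ) * K)
    (fun i _ => by positivity) (Finset.mem_univ i)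

theorem _root_.SeminormedSubspace.isBanach_rochberg (hX : X.IsBanach) (hY : Y.IsBanach) {p : ℂ}
    (hp : p ∈ openStrip a b) (n : ℕ) : (rochberg X Y a b n hp).IsBanach := by
  have := completeSpace hX hY (hp.1.trans hp.2)
  obtain ⟨K, hK, h⟩ := exists_norm_taylorCoeffs_le hX hY hp n
  exact SeminormedSubspace.isBanach_ofRange hK h

theorem taylorCoeffs_translate (f : Calderon X Y a b) {p q : ℂ} (hp : p ∈ openStrip a b)
    (hq : q ∈ openStrip a b) {s : ℝ} (h : q = p + s * Complex.I) :
    taylorCoeffs X Y a b n hp (translate s f) = taylorCoeffs X Y a b n hq f := by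
  funext i
  change ((Nat.factorial i : ℂ))⁻¹ • iteratedDeriv i (fun z => fn X Y a b f (z + s * Complex.I)) p =
    ((Nat.factorial i : ℂ))⁻¹ • iteratedDeriv i (fn X Y a b f) q
  rw [iteratedDeriv_comp_add_const, h]

theorem closedStrip_re (h : b - a ≤ 1) {c : ℝ} (hcb : c ≤ b) {z : ℂ} (hz : z ∈ closedStrip a b) :
    c - 1 ≤ z.re := by linarith [hz.1]

/-- The product with a cutoff function has the same Taylor coefficients. -/
theorem exists_mul_cutoff (f : Calderon X Y a b) (hab : b - a ≤ 1) {c : ℝ} (hac : a < c)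
    (hcb : c < b) {K : ℝ} (hK0 : 0 ≤ K)
    (hK : ∀ z : ℂ, c - 1 ≤ z.re → ‖cutoff c n z‖ ≤ K * ((1 + z.im ^ 2) ^ (n + 1))⁻¹) :
    ∃ g : Calderon X Y a b, ‖g‖ ≤ K * ‖f‖ ∧
      taylorCoeffs X Y a b n (ofReal_mem_openStrip hac hcb) g =
        taylorCoeffs X Y a b n (ofReal_mem_openStrip hac hcb) f ∧
      Tendsto (left g) (cocompact ℝ) (𝓝 0) ∧ Tendsto (right g) (cocompact ℝ) (𝓝 0) := by
  have hle : ∀ t : ℝ, ((1 + t ^ 2) ^ (n + 1))⁻¹ ≤ 1 := fun t =>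
    inv_le_one_of_one_le₀ (one_le_pow₀ (by nlinarith [sq_nonneg t]))
  have hre : ∀ z ∈ closedStrip a b, c - 1 ≤ z.re := fun z hz => closedStrip_re hab hcb.le hz
  obtain ⟨g, hg, hgn, hl, hr⟩ := exists_mul (hac.trans hcb).le f (m := cutoff c n) (K := K)
    (fun z hz => (differentiableAt_cutoff
      (hre z (openStrip_subset_closedStrip a b hz))).differentiableWithinAt)
    (fun z hz => (differentiableAt_cutoff (hre z hz)).continuousAt.continuousWithinAt)
    (fun z hz => (hK z (hre z hz)).trans (mul_le_of_le_one_right hK0 (hle _)))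
  have hlim : Tendsto (fun t : ℝ => K * ((1 + t ^ 2) ^ (n + 1))⁻¹) (cocompact ℝ) (𝓝 0) := by
    have h1 : Tendsto (fun t : ℝ => 1 + t ^ 2) (cocompact ℝ) atTop := by
      refine tendsto_atTop_add_const_left _ _ ?_
      have := (tendsto_pow_atTop (α := ℝ) two_ne_zero).comp (tendsto_norm_cocompact_atTop (E := ℝ))
      simpa [Function.comp_def] using this
    have h2 := (tendsto_inv_atTop_zero.comp
      ((tendsto_pow_atTop (α := ℝ) n.succ_ne_zero).comp h1)).const_mul K
    simpa [Function.comp_def] using h2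
  have hedge : ∀ {x : ℝ}, a ≤ x → x ≤ b → ∀ t : ℝ,
      ‖cutoff c n (x + t * Complex.I)‖ ≤ K * ((1 + t ^ 2) ^ (n + 1))⁻¹ := fun h1 h2 t => by
    simpa using hK _ (hre _ (add_mul_I_mem_closedStrip h1 h2 t))
  refine ⟨g, hgn, ?_, ?_, ?_⟩
  · obtain ⟨e, he⟩ := exists_one_sub_decay c n
    have hp := ofReal_mem_openStrip hac hcb
    have hmem := (isOpen_openStrip a b).mem_nhds hp
    -- The product is `f - (z - c) ^ n • (e ^ n • f)`, so only the remainder of `f` changes.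
    refine taylorCoeffs_eq_of_eventuallyEq g hp
      (E := fun z => remainder n c f z - e z ^ n • fn X Y a b f z) ?_ ?_
    · refine DifferentiableOn.analyticAt (s := openStrip a b) ?_ hmem
      refine (f.differentiableOn_remainder hp).sub (DifferentiableOn.smul (fun z hz => ?_)
        f.differentiableOn_fn)
      exact ((he z (hre z (openStrip_subset_closedStrip a b hz))).1.pow n).differentiableWithinAt
    · filter_upwards [hmem] with z hz
      rw [hg, cutoff, (he z (hre z (openStrip_subset_closedStrip a b hz))).2, sub_smul, one_smul,
        mul_pow, smul_sub, smul_smul, ← add_sub_assoc, ← fn_eq_polyEval_add f hp z]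
  · refine squeeze_zero_norm (fun t => ?_) (by simpa using hlim.mul_const ‖f‖)
    rw [hl, norm_smul]
    exact mul_le_mul (hedge le_rfl (hac.trans hcb).le t) (f.norm_left_le t) (norm_nonneg _)
      (by positivity)
  · refine squeeze_zero_norm (fun t => ?_) (by simpa using hlim.mul_const ‖f‖)
    rw [hr, norm_smul]
    exact mul_le_mul (hedge (hac.trans hcb).le le_rfl t) (f.norm_right_le t) (norm_nonneg _)
      (by positivity)

/-- Since `‖z - c‖ ≤ 2 * (1 + z.im ^ 2)`, the vector grows at most like the `n`-th power of `1 +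
z.im ^ 2`; the cutoff has exponent `n + 1` to absorb it. -/
theorem exists_norm_cutoff_smul_le (c : ℝ) (n : ℕ) : ∃ K, 0 ≤ K ∧
    ∀ {z : ℂ}, |z.re - c| ≤ 1 → ∀ (v : Fin n → V) (e : V),
      ‖cutoff c n z • (polyEval v (z - c) + (z - c) ^ n • e)‖ ≤ K * (∑ i, ‖v i‖ + ‖e‖) := by
  obtain ⟨K, hK0, hK⟩ := exists_norm_cutoff_le c n
  refine ⟨K * 2 ^ n, by positivity, fun {z} hz v e => ?_⟩
  have hzc : ‖z - c‖ ≤ 2 * (1 + z.im ^ 2) := by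
    have h1 := Complex.norm_le_abs_re_add_abs_im (z - c)
    simp only [Complex.sub_re, Complex.ofReal_re, Complex.sub_im, Complex.ofReal_im, sub_zero] at h1
    nlinarith [sq_nonneg (|z.im| - 1), sq_abs z.im]
  have hr : (1 : ℝ) ≤ 2 * (1 + z.im ^ 2) := by nlinarith [sq_nonneg z.im]
  have h1 : ‖polyEval v (z - c) + (z - c) ^ n • e‖ ≤
      (2 * (1 + z.im ^ 2)) ^ n * (∑ i, ‖v i‖ + ‖e‖) := by
    refine (norm_add_le _ _).trans ?_
    rw [mul_add, norm_smul, norm_pow]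
    gcongr
    exact norm_polyEval_le v hr hzc
  have h2 := hK z (by linarith [(abs_le.1 hz).1])
  have hp : (0 : ℝ) < 1 + z.im ^ 2 := by positivity
  rw [norm_smul]
  calc ‖cutoff c n z‖ * ‖polyEval v (z - c) + (z - c) ^ n • e‖
      ≤ (K * ((1 + z.im ^ 2) ^ (n + 1))⁻¹) * ((2 * (1 + z.im ^ 2)) ^ n * (∑ i, ‖v i‖ + ‖e‖)) := by
        gcongr
    _ = (K * 2 ^ n * (∑ i, ‖v i‖ + ‖e‖)) * (1 + z.im ^ 2)⁻¹ := by
        rw [mul_pow, pow_succ]; field_simp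
    _ ≤ K * 2 ^ n * (∑ i, ‖v i‖ + ‖e‖) :=
        mul_le_of_le_one_right (by positivity)
          (inv_le_one_of_one_le₀ (by nlinarith [sq_nonneg z.im]))

/-- An element of the Calderón space with prescribed Taylor coefficients. -/
theorem exists_taylorCoeffs_eq (hab : b - a ≤ 1) {c : ℝ} (hac : a < c) (hcb : c < b)
    (v : Fin n → V) {E : ℂ → V} (hd : DifferentiableOn ℂ E (openStrip a b))
    (hc : ContinuousOn E (closedStrip a b)) {M : ℝ} (hM : ∀ z ∈ closedStrip a b, ‖E z‖ ≤ M)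
    (u : ℝ →ᵇ X.Space) (w : ℝ →ᵇ Y.Space)
    (hu : ∀ t : ℝ, X.incl (u t) = cutoff c n (a + t * Complex.I) •
      (polyEval v (a + t * Complex.I - c) + (a + t * Complex.I - c : ℂ) ^ n • E (a + t * Complex.I)))
    (hw : ∀ t : ℝ, Y.incl (w t) = cutoff c n (b + t * Complex.I) •
      (polyEval v (b + t * Complex.I - c) +
        (b + t * Complex.I - c : ℂ) ^ n • E (b + t * Complex.I))) :
    ∃ f : Calderon X Y a b, taylorCoeffs X Y a b n (ofReal_mem_openStrip hac hcb) f = v ∧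
      ‖f‖ = max ‖u‖ ‖w‖ := by
  have hre : ∀ z ∈ closedStrip a b, c - 1 ≤ z.re := fun z hz => closedStrip_re hab hcb.le hz
  obtain ⟨K, hK0, hK⟩ := exists_norm_cutoff_smul_le (V := V) c n
  set H : ℂ → V := fun z => polyEval v (z - c) + (z - c) ^ n • E z with hH
  have hpd : Differentiable ℂ fun z : ℂ => polyEval v (z - c) :=
    (differentiable_polyEval v).comp (by fun_prop)
  have hHd : DifferentiableOn ℂ H (openStrip a b) :=
    hpd.differentiableOn.add (DifferentiableOn.smul (by fun_prop) hd)
  have hHc : ContinuousOn H (closedStrip a b) :=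
    hpd.continuous.continuousOn.add (ContinuousOn.smul (by fun_prop) hc)
  have hp := ofReal_mem_openStrip hac hcb
  have hmem := (isOpen_openStrip a b).mem_nhds hp
  refine ⟨ofFn (fun z => cutoff c n z • H z) u w (DifferentiableOn.smul (fun z hz =>
    (differentiableAt_cutoff
      (hre z (openStrip_subset_closedStrip a b hz))).differentiableWithinAt) hHd)
    (ContinuousOn.smul (fun z hz =>
      (differentiableAt_cutoff (hre z hz)).continuousAt.continuousWithinAt) hHc)
    ⟨K * (∑ i, ‖v i‖ + M), fun z hz => (hK (abs_le.2 ?_) v (E z)).trans ?_⟩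
    (fun t => (hu t).symm) fun t => (hw t).symm, ?_, rfl⟩
  · constructor <;> linarith [hz.1, hz.2]
  · have := hM z (openStrip_subset_closedStrip a b hz)
    gcongr
  · obtain ⟨e, he⟩ := exists_one_sub_decay c n
    refine taylorCoeffs_eq_of_eventuallyEq _ hp (E := fun z => E z - e z ^ n • H z) ?_ ?_
    · refine DifferentiableOn.analyticAt (s := openStrip a b) ?_ hmem
      refine hd.sub (DifferentiableOn.smul (fun z hz => ?_) hHd)
      exact ((he z (hre z (openStrip_subset_closedStrip a b hz))).1.pow n).differentiableWithinAt
    · filter_upwards [hmem] with z hz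
      change cutoff c n z • H z = _
      rw [cutoff, (he z (hre z (openStrip_subset_closedStrip a b hz))).2, sub_smul, one_smul,
        mul_pow, smul_sub, smul_smul, ← add_sub_assoc]

end Calderon

/-! ### Integrals along a vertical line -/

/-- The Cauchy kernel at `c`, on the line `Re z = p`, with a decaying weight. -/
def lineWeight (c : ℝ) (n : ℕ) (p t : ℝ) : ℂ :=
  (p + t * Complex.I - c : ℂ)⁻¹ * decay c n (p + t * Complex.I)

section LineWeight

variable {c p d : ℝ} {n : ℕ}

theorem continuous_lineWeight (hpc : p ≠ c) (hp : c - 1 ≤ p) : Continuous (lineWeight c n p) := by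
  refine Continuous.mul (Continuous.inv₀ (by fun_prop) fun t h => hpc ?_) ?_
  · have := congrArg Complex.re h
    simp at this
    linarith
  · refine continuous_iff_continuousAt.2 fun t => ?_
    refine ContinuousAt.comp (g := decay c n) (f := fun t : ℝ => (p + t * Complex.I : ℂ)) ?_
      (by fun_prop)
    exact (differentiableAt_decay (by simpa using hp)).continuousAt

theorem norm_lineWeight_le (hpc : p ≠ c) (hp : c - 1 ≤ p) (t : ℝ) :
    ‖lineWeight c n p t‖ ≤ |p - c|⁻¹ * 4 ^ (n + 1) * ((1 + t ^ 2) ^ (n + 1))⁻¹ := by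
  rw [lineWeight, norm_mul, norm_inv, mul_assoc]
  have h1 := norm_decay_le (c := c) (n := n) (z := p + t * Complex.I) (by simpa using hp)
  have h2 := Complex.abs_re_le_norm (p + t * Complex.I - c : ℂ)
  simp only [Complex.sub_re, Complex.add_re, Complex.ofReal_re, Complex.mul_re, Complex.I_re,
    mul_zero, Complex.ofReal_im, Complex.I_im, mul_one, sub_self, add_zero] at h2
  have h3 : 0 < |p - c| := abs_pos.2 (sub_ne_zero.2 hpc)
  gcongr
  simpa using h1

/-- By `‖z - c‖ ≤ ‖z - ζ‖ + ‖ζ - c‖` with `ζ = p + t * I`, the bound is uniform in `z` off the line.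
Its growth in `t`, raised to the power `n`, is paid for by the weight. -/
theorem norm_ratio_le (hd : 0 < d) (hd1 : d ≤ 1) (hpc1 : |p - c| ≤ 1) {z : ℂ}
    (hz : d ≤ |z.re - p|) (t : ℝ) :
    ‖(z - c) / (z - (p + t * Complex.I))‖ ≤ 3 / d * (1 + t ^ 2) := by
  have h1 : d ≤ ‖z - (p + t * Complex.I)‖ := by
    have := Complex.abs_re_le_norm (z - (p + t * Complex.I))
    simp at this
    linarith
  have h2 : ‖(p + t * Complex.I - c : ℂ)‖ ≤ 1 + |t| := by
    have := Complex.norm_le_abs_re_add_abs_im (p + t * Complex.I - c : ℂ)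
    simp at this
    linarith
  have h3 : ‖z - c‖ ≤ ‖z - (p + t * Complex.I)‖ + (1 + |t|) := by
    have := norm_add_le (z - (p + t * Complex.I)) (p + t * Complex.I - c : ℂ)
    rw [sub_add_sub_cancel] at this
    linarith
  have hpos := hd.trans_le h1
  rw [norm_div, div_le_iff₀ hpos, div_mul_eq_mul_div, div_mul_eq_mul_div, le_div_iff₀ hd]
  have h4 : |t| ≤ (1 + t ^ 2) / 2 := by nlinarith [sq_nonneg (|t| - 1), sq_abs t]
  set r := ‖z - (p + t * Complex.I)‖
  have h5 : (1 + |t|) * d ≤ (1 + |t|) * r := by gcongr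
  have h6 : r * d ≤ r * 1 := by gcongr
  have h7 := mul_le_mul_of_nonneg_right h3 hd.le
  nlinarith [mul_le_mul_of_nonneg_right h4 hpos.le, mul_nonneg (sq_nonneg t) hpos.le]

theorem norm_lineWeight_mul_ratio_le (hd : 0 < d) (hd1 : d ≤ 1) (hpc : p ≠ c) (hpc1 : |p - c| ≤ 1) {z : ℂ}
    (hz : d ≤ |z.re - p|) (t : ℝ) :
    ‖lineWeight c n p t * ((z - c) / (z - (p + t * Complex.I))) ^ n‖ ≤
      |p - c|⁻¹ * 4 ^ (n + 1) * (3 / d) ^ n * (1 + t ^ 2)⁻¹ := by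
  rw [norm_mul, norm_pow]
  have hp : (0 : ℝ) < 1 + t ^ 2 := by positivity
  calc _ ≤ (|p - c|⁻¹ * 4 ^ (n + 1) * ((1 + t ^ 2) ^ (n + 1))⁻¹) * (3 / d * (1 + t ^ 2)) ^ n := by
        gcongr
        · exact norm_lineWeight_le hpc (by linarith [(abs_le.1 hpc1).1]) t
        · exact norm_ratio_le hd hd1 hpc1 hz t
    _ = _ := by rw [mul_pow, pow_succ (1 + t ^ 2)]; field_simp

theorem integrable_lineWeight (hpc : p ≠ c) (hp : c - 1 ≤ p) :
    Integrable fun t => ‖lineWeight c n p t‖ := by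
  refine (integrable_inv_one_add_sq.const_mul (|p - c|⁻¹ * 4 ^ (n + 1))).mono'
    (continuous_lineWeight hpc hp).norm.aestronglyMeasurable (Eventually.of_forall fun t => ?_)
  rw [norm_norm]
  refine (norm_lineWeight_le hpc hp t).trans ?_
  gcongr
  exact le_self_pow₀ (by nlinarith [sq_nonneg t]) (by omega)

theorem sub_vertical_ne_zero {z : ℂ} (hz : z.re ≠ p) (t : ℝ) : z - (p + t * Complex.I) ≠ 0 :=
  fun h => hz (by have := congrArg Complex.re h; simp at this; linarith)

theorem continuous_lineWeight_mul_ratio (hpc : p ≠ c) (hp : c - 1 ≤ p) {z : ℂ} (hz : z.re ≠ p) :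
    Continuous fun t : ℝ => lineWeight c n p t * ((z - c) / (z - (p + t * Complex.I))) ^ n :=
  (continuous_lineWeight hpc hp).mul ((Continuous.div continuous_const (by fun_prop)
    (sub_vertical_ne_zero hz)).pow n)

end LineWeight

namespace SeminormedSubspace

variable {V : Type*} [NormedAddCommGroup V] [NormedSpace ℂ V] [CompleteSpace V]

/-- On an edge at distance at least `d` from the line of integration the kernel is not singular, and
the integral converges in the norm of `X`, uniformly in `y`. -/
theorem IsBanach.exists_line_integral {X : SeminormedSubspace V} (hX : X.IsBanach) {c p d x : ℝ}
    (n : ℕ) (hd : 0 < d) (hd1 : d ≤ 1) (hpc : |p - c| ≤ 1) (hpc' : p ≠ c) (hx : d ≤ |x - p|)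
    {u : ℝ → (ℝ →ᵇ X.Space)} (hu : Continuous u) {N : ℝ} (hN : ∀ t s, ‖u t s‖ ≤ N) :
    ∃ U : ℝ →ᵇ X.Space, ‖U‖ ≤ |p - c|⁻¹ * 4 ^ (n + 1) * (3 / d) ^ n * Real.pi * N ∧
      ∀ y : ℝ, X.incl (U y) = ∫ t : ℝ, (lineWeight c n p t *
        ((x + y * Complex.I - c) / (x + y * Complex.I - (p + t * Complex.I))) ^ n) •
          X.incl (u t (y - t)) := by
  have hp : c - 1 ≤ p := by linarith [(abs_le.1 hpc).1]
  have hxp : x ≠ p := by rintro rfl; simp at hx; linarith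
  set w : ℝ → ℝ → X.Space := fun y t => (lineWeight c n p t *
      ((x + y * Complex.I - c) / (x + y * Complex.I - (p + t * Complex.I))) ^ n) • u t (y - t)
  have h1 : ∀ y, Continuous (w y) := fun y =>
    (continuous_lineWeight_mul_ratio hpc' hp (by simpa using hxp)).smul (hu.eval (by fun_prop))
  have h2 : ∀ t, Continuous fun y => w y t := fun t => by
    have h : Continuous fun y : ℝ => lineWeight c n p t *
        ((x + y * Complex.I - c) / (x + y * Complex.I - (p + t * Complex.I))) ^ n :=
      continuous_const.mul ((Continuous.div (by fun_prop) (by fun_prop) fun y =>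
        sub_vertical_ne_zero (by simpa using hxp) t).pow n)
    exact h.smul ((u t).continuous.comp (continuous_id.sub continuous_const))
  have h3 : ∀ y t, ‖w y t‖ ≤ |p - c|⁻¹ * 4 ^ (n + 1) * (3 / d) ^ n * N * (1 + t ^ 2)⁻¹ :=
    fun y t => by
      rw [norm_smul, mul_right_comm]
      have := norm_lineWeight_mul_ratio_le (n := n) hd hd1 hpc' hpc (z := x + y * Complex.I)
        (by simpa using hx) t
      exact mul_le_mul this (hN t _) (norm_nonneg _) ((norm_nonneg _).trans this)
  obtain ⟨U, hU, hUy⟩ := hX.exists_integral h1 h2 (integrable_inv_one_add_sq.const_mul _) h3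
  refine ⟨U, hU.trans_eq ?_, fun y => ?_⟩
  · rw [integral_const_mul, integral_univ_inv_one_add_sq]; ring
  · rw [hUy]; simp only [w, map_smul]

end SeminormedSubspace

namespace Calderon

variable {V : Type*} [NormedAddCommGroup V] [NormedSpace ℂ V] [CompleteSpace V]
  {X Y : SeminormedSubspace V} {a b : ℝ} {n : ℕ}

/-- The integral along the line `Re z = p` of the translated Taylor polynomials at `p`. -/
def polyIntegral (c : ℝ) {n : ℕ} (p : ℝ) (v : ℝ → Fin n → V) (z : ℂ) : V :=
  ∫ t : ℝ, lineWeight c n p t • ((z - (p + t * Complex.I)) ^ n)⁻¹ •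
    polyEval (v t) (z - (p + t * Complex.I))

/-- The integral along the line `Re z = p` of the translated Taylor remainders at `p`. -/
def remainderIntegral (c : ℝ) (n : ℕ) (p : ℝ) (Ψ : ℝ → Calderon X Y a b) (z : ℂ) : V :=
  ∫ t : ℝ, lineWeight c n p t • remainder n p (Ψ t) (z - t * Complex.I)

theorem sub_mul_I_mem_openStrip_iff {z : ℂ} {s : ℝ} :
    z - s * Complex.I ∈ openStrip a b ↔ z ∈ openStrip a b := by simp [openStrip]

theorem sub_mul_I_mem_closedStrip_iff {z : ℂ} {s : ℝ} :
    z - s * Complex.I ∈ closedStrip a b ↔ z ∈ closedStrip a b := by simp [closedStrip]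

theorem continuous_taylorCoeffs (hX : X.IsBanach) (hY : Y.IsBanach) {p : ℂ}
    (hp : p ∈ openStrip a b) (n : ℕ) : Continuous (taylorCoeffs X Y a b n hp) := by
  obtain ⟨K, -, h⟩ := exists_norm_taylorCoeffs_le hX hY hp n
  exact AddMonoidHomClass.continuous_of_bound _ K h

/-- Except possibly at `t = z.im`, the remainder is the function minus its Taylor polynomial,
divided by `(z - t * I - p) ^ n`; numerator and denominator are continuous in `t`. -/
theorem aestronglyMeasurable_remainder (hX : X.IsBanach) (hY : Y.IsBanach) {p : ℝ} (hap : a < p)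
    (hpb : p < b) {Ψ : ℝ → Calderon X Y a b} (hΨ : Continuous Ψ) (n : ℕ) {z : ℂ}
    (hz : z ∈ closedStrip a b) :
    AEStronglyMeasurable fun t : ℝ => remainder n p (Ψ t) (z - t * Complex.I) := by
  have hp := ofReal_mem_openStrip hap hpb
  have h1 : Continuous fun t : ℝ => fn X Y a b (Ψ t) (z - t * Complex.I) :=
    continuous_eval_fn hX hY (hap.trans hpb) hΨ (by fun_prop) fun t =>
      sub_mul_I_mem_closedStrip_iff.2 hz
  have h2 : Continuous fun t : ℝ => polyEval (taylorCoeffs X Y a b n hp (Ψ t))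
      (z - t * Complex.I - p) :=
    continuous_polyEval.comp (((continuous_taylorCoeffs hX hY hp n).comp hΨ).prodMk (by fun_prop))
  have h3 : Measurable fun t : ℝ => ((z - t * Complex.I - p : ℂ) ^ n)⁻¹ :=
    (Continuous.measurable (by fun_prop)).inv
  refine (h3.aestronglyMeasurable.smul (h1.sub h2).aestronglyMeasurable).congr ?_
  filter_upwards [Measure.ae_ne volume z.im] with t ht
  have h0 : (z - t * Complex.I - p : ℂ) ^ n ≠ 0 := pow_ne_zero _ fun h => ht <| by
    have := congrArg Complex.im h
    simp at this
    linarith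
  change ((z - t * Complex.I - p : ℂ) ^ n)⁻¹ • (fn X Y a b (Ψ t) (z - t * Complex.I) -
    polyEval (taylorCoeffs X Y a b n hp (Ψ t)) (z - t * Complex.I - p)) = _
  rw [fn_eq_polyEval_add (n := n) (Ψ t) hp, add_sub_cancel_left, smul_smul,
    inv_mul_cancel₀ h0, one_smul]

/-- Remainders have no singularity on the line `Re z = p`, so their integral is analytic on the
whole strip. Off that line it splits into the integral of the full functions and that of the Taylor
polynomials, each of which has a singular kernel there. -/
theorem exists_remainderIntegral (hX : X.IsBanach) (hY : Y.IsBanach) (hab : b - a ≤ 1) {c p : ℝ}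
    (hac : a < c) (hcb : c < b) (hap : a < p) (hpb : p < b) (hpc : p ≠ c) (n : ℕ) :
    ∃ K, 0 ≤ K ∧ ∀ Ψ : ℝ →ᵇ Calderon X Y a b,
      DifferentiableOn ℂ (remainderIntegral c n p Ψ) (openStrip a b) ∧
      ContinuousOn (remainderIntegral c n p Ψ) (closedStrip a b) ∧
      (∀ z ∈ closedStrip a b, ‖remainderIntegral c n p Ψ z‖ ≤ K * ‖Ψ‖) ∧
      ∀ z ∈ closedStrip a b, z.re ≠ p → (z - c) ^ n • remainderIntegral c n p Ψ z =
        (∫ t : ℝ, (lineWeight c n p t * ((z - c) / (z - (p + t * Complex.I))) ^ n) •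
          fn X Y a b (Ψ t) (z - t * Complex.I)) -
        (z - c) ^ n • polyIntegral c p
          (fun t => taylorCoeffs X Y a b n (ofReal_mem_openStrip hap hpb) (Ψ t)) z := by
  obtain ⟨K, hK, hKf⟩ := exists_norm_fn_le hX hY (hap.trans hpb)
  set d := min (p - a) (b - p) with hd
  have hd0 : 0 < d := lt_min (sub_pos.2 hap) (sub_pos.2 hpb)
  have hp := ofReal_mem_openStrip hap hpb
  have hcp : c - 1 ≤ p := by linarith
  have hpc1 : |p - c| ≤ 1 := abs_le.2 ⟨by linarith, by linarith⟩
  set I := ∫ t, ‖lineWeight c n p t‖ with hI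
  refine ⟨(2 / d) ^ n * K * I, by positivity, fun Ψ => ?_⟩
  have hb : ∀ z ∈ closedStrip a b, ∀ t : ℝ,
      ‖lineWeight c n p t • remainder n p (Ψ t) (z - t * Complex.I)‖ ≤
        ‖lineWeight c n p t‖ * ((2 / d) ^ n * K * ‖Ψ‖) := fun z hz t => by
    rw [norm_smul, mul_assoc]
    gcongr
    refine norm_remainder_le (Ψ t) hd0 ?_ ?_ (fun w hw => (hKf _ w hw).trans ?_) n
      (sub_mul_I_mem_closedStrip_iff.2 hz)
    · rw [Complex.ofReal_re]; linarith [min_le_left (p - a) (b - p)]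
    · rw [Complex.ofReal_re]; linarith [min_le_right (p - a) (b - p)]
    · gcongr; exact Ψ.norm_coe_le_norm t
  have hm : ∀ z ∈ closedStrip a b, AEStronglyMeasurable fun t : ℝ =>
      lineWeight c n p t • remainder n p (Ψ t) (z - t * Complex.I) := fun z hz =>
    (continuous_lineWeight hpc hcp).aestronglyMeasurable.smul
      (aestronglyMeasurable_remainder hX hY hap hpb Ψ.continuous n hz)
  have hG : Integrable fun t => ‖lineWeight c n p t‖ * ((2 / d) ^ n * K * ‖Ψ‖) :=
    (integrable_lineWeight hpc hcp).mul_const _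
  refine ⟨?_, ?_, fun z hz => ?_, fun z hz hzp => ?_⟩
  · refine differentiableOn_integral_of_dominated (isOpen_openStrip a b) hG (fun t => ?_)
      (fun z hz => hm z (openStrip_subset_closedStrip a b hz))
      (fun z hz => hb z (openStrip_subset_closedStrip a b hz))
    refine DifferentiableOn.const_smul (DifferentiableOn.comp (t := openStrip a b)
      ((Ψ t).differentiableOn_remainder hp) (by fun_prop) fun z hz => ?_) _
    exact sub_mul_I_mem_openStrip_iff.2 hz
  · refine continuousOn_of_dominated hm (fun z hz => Eventually.of_forall (hb z hz)) hG
      (Eventually.of_forall fun t => ?_)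
    refine ContinuousOn.const_smul (ContinuousOn.comp (t := closedStrip a b)
      ((Ψ t).continuousOn_remainder hp) (by fun_prop) fun z hz => ?_) _
    exact sub_mul_I_mem_closedStrip_iff.2 hz
  · refine (norm_integral_le_of_norm_le hG (Eventually.of_forall (hb z hz))).trans_eq ?_
    rw [integral_mul_const]; ring
  · have hne := sub_vertical_ne_zero hzp
    have hpt : ∀ t : ℝ, (z - c) ^ n • lineWeight c n p t • ((z - (p + t * Complex.I)) ^ n)⁻¹ •
        polyEval (taylorCoeffs X Y a b n hp (Ψ t)) (z - (p + t * Complex.I)) =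
        (lineWeight c n p t * ((z - c) / (z - (p + t * Complex.I))) ^ n) •
          fn X Y a b (Ψ t) (z - t * Complex.I) -
        (z - c) ^ n • lineWeight c n p t • remainder n p (Ψ t) (z - t * Complex.I) := by
      intro t
      rw [fn_eq_polyEval_add (n := n) (Ψ t) hp (z - t * Complex.I),
        show z - t * Complex.I - p = z - (p + t * Complex.I) by ring, div_pow]
      have h0 := pow_ne_zero n (hne t)
      generalize (z - (p + t * Complex.I)) ^ n = q at h0 ⊢
      rw [smul_add, smul_smul _ q]
      have : lineWeight c n p t * ((z - c) ^ n / q) * q = (z - c) ^ n * lineWeight c n p t := by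
        field_simp
      rw [this, ← smul_smul ((z - c) ^ n), add_sub_cancel_right, smul_smul, smul_smul]
      congr 1
      rw [div_eq_mul_inv]; ring
    rw [polyIntegral, remainderIntegral, ← integral_smul, ← integral_smul]
    simp only [hpt]
    rw [integral_sub, sub_sub_cancel]
    · have hzd : 0 < min |z.re - p| 1 := lt_min (abs_pos.2 (sub_ne_zero.2 hzp)) one_pos
      refine (integrable_inv_one_add_sq.const_mul (|p - c|⁻¹ * 4 ^ (n + 1) *
        (3 / (min |z.re - p| 1)) ^ n * (K * ‖Ψ‖))).mono'
        ((continuous_lineWeight_mul_ratio hpc hcp hzp).smul (continuous_eval_fn hX hY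
          (hap.trans hpb) Ψ.continuous (by fun_prop) fun t =>
          sub_mul_I_mem_closedStrip_iff.2 hz)).aestronglyMeasurable
        (Eventually.of_forall fun t => ?_)
      rw [norm_smul, mul_right_comm]
      refine mul_le_mul (norm_lineWeight_mul_ratio_le hzd (min_le_right _ _) hpc hpc1
        (min_le_left _ _) t) ?_ (norm_nonneg _) (by positivity)
      refine (hKf _ _ (sub_mul_I_mem_closedStrip_iff.2 hz)).trans ?_
      gcongr
      exact Ψ.norm_coe_le_norm t
    · exact (hG.mono' (hm z hz) (Eventually.of_forall (hb z hz))).smul _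

theorem fn_sub_left (f : Calderon X Y a b) (y t : ℝ) :
    fn X Y a b f (a + y * Complex.I - t * Complex.I) = X.incl (left f (y - t)) := by
  rw [← fn_left]; exact congrArg _ (by push_cast; ring)

theorem fn_sub_right (f : Calderon X Y a b) (y t : ℝ) :
    fn X Y a b f (b + y * Complex.I - t * Complex.I) = Y.incl (right f (y - t)) := by
  rw [← fn_right]; exact congrArg _ (by push_cast; ring)

theorem exists_remainderIntegral_left (hX : X.IsBanach) {c p : ℝ} (hab : b - a ≤ 1)
    (hac : a < c) (hcb : c < b) (hap : a < p) (hpb : p < b) (hpc : p ≠ c) (n : ℕ) :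
    ∃ K, 0 ≤ K ∧ ∀ Ψ : ℝ →ᵇ Calderon X Y a b, ∃ U : ℝ →ᵇ X.Space, ‖U‖ ≤ K * ‖Ψ‖ ∧
      ∀ y : ℝ, X.incl (U y) = ∫ t : ℝ, (lineWeight c n p t *
        ((a + y * Complex.I - c) / (a + y * Complex.I - (p + t * Complex.I))) ^ n) •
          fn X Y a b (Ψ t) (a + y * Complex.I - t * Complex.I) := by
  have hpc1 : |p - c| ≤ 1 := abs_le.2 ⟨by linarith, by linarith⟩
  have hd : |a - p| = p - a := by rw [abs_sub_comm, abs_of_pos (by linarith)]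
  have hpos : 0 < p - a := by linarith
  refine ⟨|p - c|⁻¹ * 4 ^ (n + 1) * (3 / (p - a)) ^ n * Real.pi, by positivity, fun Ψ => ?_⟩
  simp only [fn_sub_left]
  exact hX.exists_line_integral n (sub_pos.2 hap) (by linarith) hpc1 hpc hd.ge
    (u := fun t => left (Ψ t)) (continuous_left.comp Ψ.continuous)
    fun t s => (norm_left_le _ s).trans (Ψ.norm_coe_le_norm t)

theorem exists_remainderIntegral_right (hY : Y.IsBanach) {c p : ℝ} (hab : b - a ≤ 1)
    (hac : a < c) (hcb : c < b) (hap : a < p) (hpb : p < b) (hpc : p ≠ c) (n : ℕ) :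
    ∃ K, 0 ≤ K ∧ ∀ Ψ : ℝ →ᵇ Calderon X Y a b, ∃ U : ℝ →ᵇ Y.Space, ‖U‖ ≤ K * ‖Ψ‖ ∧
      ∀ y : ℝ, Y.incl (U y) = ∫ t : ℝ, (lineWeight c n p t *
        ((b + y * Complex.I - c) / (b + y * Complex.I - (p + t * Complex.I))) ^ n) •
          fn X Y a b (Ψ t) (b + y * Complex.I - t * Complex.I) := by
  have hpc1 : |p - c| ≤ 1 := abs_le.2 ⟨by linarith, by linarith⟩
  have hd : |b - p| = b - p := abs_of_pos (by linarith)
  have hpos : 0 < b - p := by linarith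
  refine ⟨|p - c|⁻¹ * 4 ^ (n + 1) * (3 / (b - p)) ^ n * Real.pi, by positivity, fun Ψ => ?_⟩
  simp only [fn_sub_right]
  exact hY.exists_line_integral n (sub_pos.2 hpb) (by linarith) hpc1 hpc hd.ge
    (u := fun t => right (Ψ t)) (continuous_right.comp Ψ.continuous)
    fun t s => (norm_right_le _ s).trans (Ψ.norm_coe_le_norm t)

end Calderon

/-! ### Reiteration -/

/-! ### Cauchy's formula for the Taylor-polynomial kernel -/

section PolyKernel

variable {V : Type*} [NormedAddCommGroup V] [NormedSpace ℂ V] {n : ℕ}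

/-- A polynomial of degree less than `n` divided by `u ^ n` is bounded away from zero; thus the
kernel keeps all the decay of its weight. -/
theorem norm_inv_pow_smul_polyEval_le (v : Fin n → V) {u : ℂ} {δ : ℝ} (hδ : 0 < δ) (hδ1 : δ ≤ 1)
    (hu : δ ≤ ‖u‖) : ‖(u ^ n)⁻¹ • polyEval v u‖ ≤ δ⁻¹ ^ n * ∑ i, ‖v i‖ := by
  have hu0 := hδ.trans_le hu
  have h := norm_polyEval_le v (u := u) (r := ‖u‖ / δ) ((one_le_div hδ).2 hu)
    (le_div_self hu0.le hδ hδ1)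
  rw [norm_smul, norm_inv, norm_pow]
  calc _ ≤ (‖u‖ ^ n)⁻¹ * ((‖u‖ / δ) ^ n * ∑ i, ‖v i‖) := by gcongr
    _ = _ := by rw [div_pow, inv_pow]; field_simp

/-- The function whose integral against the Cauchy kernel is `Calderon.polyIntegral`. -/
def polyKernel (c : ℝ) (F : ℂ → Fin n → V) (z ζ : ℂ) : V :=
  decay c n ζ • ((z - ζ) ^ n)⁻¹ • polyEval (F ζ) (z - ζ)

variable {c : ℝ} {F : ℂ → Fin n → V} {z : ℂ}

theorem polyKernel_self : polyKernel c F z c = ((z - c) ^ n)⁻¹ • polyEval (F c) (z - c) := by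
  rw [polyKernel, decay_self, one_smul]

theorem polyIntegral_eq (p : ℝ) : Calderon.polyIntegral c p (fun t => F (p + t * Complex.I)) z =
    ∫ t : ℝ, (p + t * Complex.I - c : ℂ)⁻¹ • polyKernel c F z (p + t * Complex.I) := by
  simp only [Calderon.polyIntegral, polyKernel, lineWeight, mul_smul]

theorem differentiableOn_polyKernel {s : Set ℂ} (hF : DifferentiableOn ℂ F s)
    (hs : ∀ ζ ∈ s, c - 1 ≤ ζ.re ∧ ζ ≠ z) : DifferentiableOn ℂ (polyKernel c F z) s := by
  refine DifferentiableOn.smul (fun ζ hζ =>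
    (differentiableAt_decay (hs ζ hζ).1).differentiableWithinAt) (DifferentiableOn.smul ?_ ?_)
  · exact DifferentiableOn.inv (by fun_prop) fun ζ hζ =>
      pow_ne_zero _ (sub_ne_zero.2 (hs ζ hζ).2.symm)
  · refine DifferentiableOn.fun_sum fun i _ => DifferentiableOn.smul (by fun_prop) ?_
    exact differentiableOn_pi.1 hF i

theorem continuousOn_polyKernel {s : Set ℂ} (hF : ContinuousOn F s)
    (hs : ∀ ζ ∈ s, c - 1 ≤ ζ.re ∧ ζ ≠ z) : ContinuousOn (polyKernel c F z) s := by
  refine ContinuousOn.smul (fun ζ hζ =>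
    (differentiableAt_decay (hs ζ hζ).1).continuousAt.continuousWithinAt) (ContinuousOn.smul ?_ ?_)
  · exact ContinuousOn.inv₀ (by fun_prop) fun ζ hζ =>
      pow_ne_zero _ (sub_ne_zero.2 (hs ζ hζ).2.symm)
  · refine continuousOn_finsetSum _ fun i _ => ContinuousOn.smul (by fun_prop) ?_
    exact continuousOn_pi.1 hF i

theorem norm_polyKernel_le {ζ : ℂ} (hζ : c - 1 ≤ ζ.re) {δ M : ℝ} (hδ : 0 < δ) (hδ1 : δ ≤ 1)
    (hz : δ ≤ |z.re - ζ.re|) (hM : ‖F ζ‖ ≤ M) :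
    ‖polyKernel c F z ζ‖ ≤ 4 ^ (n + 1) * (δ⁻¹ ^ n * (n * M)) * (1 + ζ.im ^ 2)⁻¹ := by
  have h1 : δ ≤ ‖z - ζ‖ := hz.trans (by simpa using Complex.abs_re_le_norm (z - ζ))
  have h2 := norm_inv_pow_smul_polyEval_le (F ζ) hδ hδ1 h1
  have h3 : ∑ i, ‖F ζ i‖ ≤ n * M := by
    refine (Finset.sum_le_card_nsmul _ _ M fun i _ => (norm_le_pi_norm _ i).trans hM).trans_eq ?_
    simp
  have h4 : ‖decay c n ζ‖ ≤ 4 ^ (n + 1) * (1 + ζ.im ^ 2)⁻¹ := by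
    refine (norm_decay_le hζ).trans ?_
    gcongr
    exact le_self_pow₀ (by nlinarith [sq_nonneg ζ.im]) (by omega)
  rw [polyKernel, norm_smul, mul_right_comm]
  gcongr
  exact h2.trans (by gcongr)

variable [CompleteSpace V]

/-- With `z` off the closed strip, the kernel is analytic in `ζ` between the two lines, where `F` is
analytic. Cauchy's formula at `c`, where the weight is 1, leaves only the list `F c`. -/
theorem polyIntegral_sub_polyIntegral {a b : ℝ} (hac : a < c) (hcb : c < b) (hab : b - a ≤ 1)
    (hd : DifferentiableOn ℂ F (openStrip a b)) (hc : ContinuousOn F (closedStrip a b)) {M : ℝ}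
    (hM : ∀ ζ ∈ closedStrip a b, ‖F ζ‖ ≤ M) (hz : z.re < a ∨ b < z.re) :
    Calderon.polyIntegral c b (fun t => F (b + t * Complex.I)) z -
      Calderon.polyIntegral c a (fun t => F (a + t * Complex.I)) z =
      (2 * Real.pi : ℂ) • ((z - c) ^ n)⁻¹ • polyEval (F c) (z - c) := by
  obtain ⟨δ, hδ, hδ1, hδz⟩ : ∃ δ, 0 < δ ∧ δ ≤ 1 ∧ ∀ ζ ∈ closedStrip a b, δ ≤ |z.re - ζ.re| := by
    rcases hz with h | h
    · refine ⟨min (a - z.re) 1, lt_min (by linarith) one_pos, min_le_right _ _, fun ζ hζ => ?_⟩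
      rw [abs_sub_comm]
      exact (min_le_left _ _).trans (le_trans (by linarith [hζ.1]) (le_abs_self _))
    · refine ⟨min (z.re - b) 1, lt_min (by linarith) one_pos, min_le_right _ _, fun ζ hζ => ?_⟩
      exact (min_le_left _ _).trans (le_trans (by linarith [hζ.2]) (le_abs_self _))
  have hs : ∀ ζ ∈ closedStrip a b, c - 1 ≤ ζ.re ∧ ζ ≠ z := fun ζ hζ => by
    refine ⟨by linarith [hζ.1], ?_⟩
    rintro rfl
    have := hδz ζ hζ
    simp at this
    linarith
  rw [polyIntegral_eq, polyIntegral_eq, ← polyKernel_self]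
  exact cauchy_formula_strip hac hcb
    (differentiableOn_polyKernel hd fun ζ hζ => hs ζ (openStrip_subset_closedStrip a b hζ))
    (continuousOn_polyKernel hc hs)
    fun ζ hζ => norm_polyKernel_le (hs ζ hζ).1 hδ hδ1 (hδz ζ hζ) (hM ζ hζ)

/-- Constant coefficients make the kernel analytic on the whole half-plane to the right of `a`, so
one line suffices. -/
theorem polyIntegral_const {a : ℝ} (hac : a < c) (hca : c - 1 ≤ a) (v : Fin n → V)
    (hz : z.re < a) :
    Calderon.polyIntegral c a (fun _ => v) z =
      -((2 * Real.pi : ℂ) • ((z - c) ^ n)⁻¹ • polyEval v (z - c)) := by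
  have hs : ∀ ζ : ℂ, a ≤ ζ.re → c - 1 ≤ ζ.re ∧ ζ ≠ z := fun ζ hζ => by
    refine ⟨by linarith, ?_⟩
    rintro rfl
    linarith
  rw [← polyKernel_self (F := fun _ => v), ← cauchy_formula_halfPlane (φ := polyKernel c (fun _ => v) z) hac
    (differentiableOn_polyKernel (by fun_prop) fun ζ hζ => hs ζ (le_of_lt hζ))
    (continuousOn_polyKernel (by fun_prop) hs)
    fun ζ hζ => norm_polyKernel_le (hs ζ hζ).1 (δ := min (a - z.re) 1)
      (lt_min (by linarith) one_pos) (min_le_right _ _) ?_ le_rfl]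
  · exact polyIntegral_eq (F := fun _ => v) a
  · rw [abs_sub_comm]
    exact (min_le_left _ _).trans (le_trans (by linarith) (le_abs_self _))

end PolyKernel

/-! ### The two inclusions between Rochberg and interpolation spaces -/

namespace Calderon

variable {V : Type*} [NormedAddCommGroup V] [NormedSpace ℂ V] [CompleteSpace V]
  {X Y : SeminormedSubspace V} {α β : ℝ} {n : ℕ}

/-- The list of Taylor coefficients, as an element of the Rochberg space. -/
def toRochberg (n : ℕ) {z : ℂ} (hz : z ∈ openStrip α β) :
    Calderon X Y α β →L[ℂ] (rochberg X Y α β n hz).Space :=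
  LinearMap.mkContinuous (SeminormedSubspace.toRange (taylorCoeffs X Y α β n hz)) 1 fun f => by
    rw [one_mul]; exact SeminormedSubspace.norm_toRange_le _ f

theorem incl_toRochberg {z : ℂ} (hz : z ∈ openStrip α β) (f : Calderon X Y α β) :
    (rochberg X Y α β n hz).incl (toRochberg n hz f) = taylorCoeffs X Y α β n hz f := rfl

theorem norm_toRochberg_le {z : ℂ} (hz : z ∈ openStrip α β) (f : Calderon X Y α β) :
    ‖toRochberg n hz f‖ ≤ ‖f‖ := SeminormedSubspace.norm_toRange_le _ f

theorem exists_lift_rochberg (hX : X.IsBanach) (hY : Y.IsBanach) {p : ℂ} (hp : p ∈ openStrip α β)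
    (u : ℝ →ᵇ (rochberg X Y α β n hp).Space) : ∃ Ψ : ℝ →ᵇ Calderon X Y α β, ‖Ψ‖ ≤ 4 * ‖u‖ ∧
      ∀ t, taylorCoeffs X Y α β n hp (Ψ t) = (rochberg X Y α β n hp).incl (u t) := by
  have := completeSpace hX hY (hp.1.trans hp.2)
  obtain ⟨Ψ, h1, h2⟩ := SeminormedSubspace.exists_boundedContinuous_lift
    (π := toRochberg (X := X) (Y := Y) n hp)
    (fun y ε hε => SeminormedSubspace.exists_toRange_eq _ y hε)
    (SeminormedSubspace.isBanach_rochberg hX hY hp n).definite u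
  exact ⟨Ψ, h1, fun t => by rw [← h2, incl_toRochberg]⟩

theorem closedStrip_subset_openStrip {a b : ℝ} (ha : α < a) (hb : b < β) :
    closedStrip a b ⊆ openStrip α β := fun _ hz => ⟨ha.trans_le hz.1, hz.2.trans_lt hb⟩

/-- Every list of Taylor coefficients at `c` is the value at `c` of an element of the Calderón space
of the Rochberg spaces at `a` and `b`. -/
theorem exists_fn_eq_taylorCoeffs (hX : X.IsBanach) (hY : Y.IsBanach) (hαβ : β - α ≤ 1)
    {a b c : ℝ} (ha : α < a) (hac : a < c) (hcb : c < b) (hb : b < β) (n : ℕ) :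
    ∃ K, 0 ≤ K ∧ ∀ f : Calderon X Y α β,
      ∃ G : Calderon
        (rochberg X Y α β n (ofReal_mem_openStrip ha (hac.trans (hcb.trans hb))))
        (rochberg X Y α β n (ofReal_mem_openStrip (ha.trans (hac.trans hcb)) hb)) a b,
        fn _ _ a b G c =
          taylorCoeffs X Y α β n (ofReal_mem_openStrip (ha.trans hac) (hcb.trans hb)) f ∧
        ‖G‖ ≤ K * ‖f‖ := by
  obtain ⟨K, hK0, hK⟩ := exists_norm_cutoff_le c n
  obtain ⟨L, hL0, hL⟩ := exists_norm_fn_le hX hY (ha.trans (hac.trans (hcb.trans hb)))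
  refine ⟨K, hK0, fun f => ?_⟩
  obtain ⟨g, hgn, hgc, hgl, hgr⟩ := f.exists_mul_cutoff (n := n) hαβ (ha.trans hac) (hcb.trans hb)
    hK0 hK
  have hp := ofReal_mem_openStrip ha (hac.trans (hcb.trans hb))
  have hq := ofReal_mem_openStrip (ha.trans (hac.trans hcb)) hb
  have hsub := closedStrip_subset_openStrip ha hb
  -- The list of `g` at `a + t * I` is the list at `a` of a translate of `g`; continuity of
  -- translation thus gives continuity of the edge functions in the Rochberg norms.
  have hcont := continuous_translate hgl hgr
  have hun : ∀ t, ‖toRochberg n hp (translate t g)‖ ≤ ‖g‖ := fun t =>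
    (norm_toRochberg_le hp _).trans (norm_translate_le t g)
  have hwn : ∀ t, ‖toRochberg n hq (translate t g)‖ ≤ ‖g‖ := fun t =>
    (norm_toRochberg_le hq _).trans (norm_translate_le t g)
  set u := BoundedContinuousFunction.ofNormedAddCommGroup
    (fun t => toRochberg n hp (translate t g)) ((toRochberg n hp).continuous.comp hcont) _ hun
  set w := BoundedContinuousFunction.ofNormedAddCommGroup
    (fun t => toRochberg n hq (translate t g)) ((toRochberg n hq).continuous.comp hcont) _ hwn
  set F : ℂ → Fin n → V := fun z i =>
    ((Nat.factorial i : ℂ))⁻¹ • iteratedDeriv i (fn X Y α β g) z with hF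
  have hFt : ∀ {z : ℂ} (hz : z ∈ openStrip α β), F z = taylorCoeffs X Y α β n hz g :=
    fun hz => rfl
  have hFd : DifferentiableOn ℂ F (openStrip α β) := by
    refine differentiableOn_pi.2 fun i => DifferentiableOn.const_smul (fun z hz => ?_) _
    have h : AnalyticAt ℂ (iteratedDeriv i (fn X Y α β g)) z := by
      rw [iteratedDeriv_eq_iterate]; exact (g.analyticAt_fn hz).iterated_deriv i
    exact h.differentiableAt.differentiableWithinAt
  set d := min (a - α) (β - b) with hd
  have hd0 : 0 < d := lt_min (sub_pos.2 ha) (sub_pos.2 hb)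
  refine ⟨ofFn F u w (hFd.mono fun z hz => hsub (openStrip_subset_closedStrip a b hz))
    (hFd.continuousOn.mono hsub) ⟨∑ i : Fin n, (2 / d) ^ (i : ℕ) * (L * ‖g‖), fun z hz => ?_⟩
    (fun t => ?_) (fun t => ?_), hgc, ?_⟩
  · have hz' := hsub (openStrip_subset_closedStrip a b hz)
    rw [hFt hz']
    refine (pi_norm_le_iff_of_nonneg (by positivity)).2 fun i => ?_
    refine (norm_taylorCoeffs_apply_le g hz' hd0
      (by linarith [min_le_left (a - α) (β - b), hz.1])
      (by linarith [min_le_right (a - α) (β - b), hz.2]) (hL g) i).trans ?_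
    exact Finset.single_le_sum (f := fun i : Fin n => (2 / d) ^ (i : ℕ) * (L * ‖g‖))
      (fun i _ => by positivity) (Finset.mem_univ i)
  · have h := hsub (add_mul_I_mem_closedStrip le_rfl (hac.trans hcb).le t)
    rw [hFt h, ← taylorCoeffs_translate g hp h rfl]
    rfl
  · have h := hsub (add_mul_I_mem_closedStrip (hac.trans hcb).le le_rfl t)
    rw [hFt h, ← taylorCoeffs_translate g hq h rfl]
    rfl
  · refine le_trans ?_ hgn
    rw [norm_eq_max]
    exact max_le (BoundedContinuousFunction.norm_ofNormedAddCommGroup_le _ (norm_nonneg _) hun)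
      (BoundedContinuousFunction.norm_ofNormedAddCommGroup_le _ (norm_nonneg _) hwn)

theorem continuous_cutoff_vertical {c x : ℝ} {n : ℕ} (hx : c - 1 ≤ x) :
    Continuous fun t : ℝ => cutoff c n (x + t * Complex.I) :=
  continuous_iff_continuousAt.2 fun t =>
    ContinuousAt.comp (g := cutoff c n) (f := fun t : ℝ => (x + t * Complex.I : ℂ))
      (differentiableAt_cutoff (by simpa using hx)).continuousAt (by fun_prop)

theorem exists_cutoff_smul {Z : SeminormedSubspace V} {c x : ℝ} {n : ℕ} {K : ℝ}
    (hK : ∀ z : ℂ, c - 1 ≤ z.re → ‖cutoff c n z‖ ≤ K * ((1 + z.im ^ 2) ^ (n + 1))⁻¹) (hK0 : 0 ≤ K)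
    (hx : c - 1 ≤ x) (U : ℝ →ᵇ Z.Space) :
    ∃ u : ℝ →ᵇ Z.Space, (∀ t : ℝ, u t = cutoff c n (x + t * Complex.I) • U t) ∧
      ‖u‖ ≤ K * ‖U‖ :=
  exists_smul U (m := fun t => cutoff c n (x + t * Complex.I))
    (continuous_cutoff_vertical hx) fun t =>
    (hK _ (by simpa using hx)).trans (mul_le_of_le_one_right hK0
      (inv_le_one_of_one_le₀ (one_le_pow₀ (by simpa using sq_nonneg t))))

/-- The value at `c` of an element of the Calderón space of the Rochberg spaces at `a` and `b` is a
list of Taylor coefficients at `c`. -/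
theorem exists_taylorCoeffs_eq_fn (hX : X.IsBanach) (hY : Y.IsBanach) (hαβ : β - α ≤ 1)
    {a b c : ℝ} (ha : α < a) (hac : a < c) (hcb : c < b) (hb : b < β) (n : ℕ) :
    ∃ K, 0 ≤ K ∧ ∀ G : Calderon
        (rochberg X Y α β n (ofReal_mem_openStrip ha (hac.trans (hcb.trans hb))))
        (rochberg X Y α β n (ofReal_mem_openStrip (ha.trans (hac.trans hcb)) hb)) a b,
      ∃ f : Calderon X Y α β,
        taylorCoeffs X Y α β n (ofReal_mem_openStrip (ha.trans hac) (hcb.trans hb)) f =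
          fn _ _ a b G c ∧
        ‖f‖ ≤ K * ‖G‖ := by
  have hαc := ha.trans hac
  have hcβ := hcb.trans hb
  have haβ := hac.trans hcβ
  have hαb := hαc.trans hcb
  have hp := ofReal_mem_openStrip ha haβ
  have hq := ofReal_mem_openStrip hαb hb
  obtain ⟨K, hK0, hK⟩ := exists_norm_cutoff_le c n
  obtain ⟨M, -, hM⟩ := exists_norm_fn_le (SeminormedSubspace.isBanach_rochberg hX hY hp n)
    (SeminormedSubspace.isBanach_rochberg hX hY hq n) (hac.trans hcb)
  obtain ⟨Ra, hRa0, hRa⟩ := exists_remainderIntegral hX hY hαβ hαc hcβ ha haβ hac.ne n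
  obtain ⟨Rb, hRb0, hRb⟩ := exists_remainderIntegral hX hY hαβ hαc hcβ hαb hb hcb.ne' n
  obtain ⟨Aa, hAa0, hAa⟩ := exists_remainderIntegral_left (Y := Y) hX hαβ hαc hcβ ha haβ hac.ne n
  obtain ⟨Ab, hAb0, hAb⟩ := exists_remainderIntegral_left (Y := Y) hX hαβ hαc hcβ hαb hb hcb.ne' n
  obtain ⟨Ba, hBa0, hBa⟩ := exists_remainderIntegral_right (X := X) hY hαβ hαc hcβ ha haβ hac.ne n
  obtain ⟨Bb, hBb0, hBb⟩ := exists_remainderIntegral_right (X := X) hY hαβ hαc hcβ hαb hb hcb.ne' n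
  refine ⟨K * (4 * max (Aa + Ab) (Ba + Bb)), by positivity, fun G => ?_⟩
  -- The Taylor list of `Ψa t` at `a` is `G (a + t * I)`; `Ψb` plays the same role at `b`.
  obtain ⟨Ψa, hΨan, hΨa⟩ := exists_lift_rochberg hX hY hp (left G)
  obtain ⟨Ψb, hΨbn, hΨb⟩ := exists_lift_rochberg hX hY hq (right G)
  have hΨan' : ‖Ψa‖ ≤ 4 * ‖G‖ := hΨan.trans (by gcongr; exact le_max_left _ _)
  have hΨbn' : ‖Ψb‖ ≤ 4 * ‖G‖ := hΨbn.trans (by gcongr; exact le_max_right _ _)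
  simp only [← fn_left] at hΨa
  simp only [← fn_right] at hΨb
  obtain ⟨dRa, cRa, bRa, eRa⟩ := hRa Ψa
  obtain ⟨dRb, cRb, bRb, eRb⟩ := hRb Ψb
  obtain ⟨Ua, nUa, hUa⟩ := hAa Ψa
  obtain ⟨Ub, nUb, hUb⟩ := hAb Ψb
  obtain ⟨Wa, nWa, hWa⟩ := hBa Ψa
  obtain ⟨Wb, nWb, hWb⟩ := hBb Ψb
  have hπ : (2 * Real.pi : ℂ) ≠ 0 := by exact_mod_cast Real.two_pi_pos.ne'
  have hπ1 : ‖(2 * Real.pi : ℂ)⁻¹‖ ≤ 1 := by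
    rw [norm_inv]
    refine inv_le_one_of_one_le₀ ?_
    rw [norm_mul, Complex.norm_real, Real.norm_of_nonneg Real.pi_pos.le, Complex.norm_ofNat]
    linarith [Real.pi_gt_three]
  -- The remainders extend analytically across both inner lines, so `E` is available at `c`; the
  -- factor normalises Cauchy's formula.
  set E : ℂ → V := fun z => (2 * Real.pi : ℂ)⁻¹ •
    (remainderIntegral c n b Ψb z - remainderIntegral c n a Ψa z) with hE
  -- The left side is analytic on the whole strip and has Taylor list `G c` at `c`. The right side
  -- makes sense only off the inner lines but takes values in `X` and `Y` on the outer edges. They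
  -- agree there by Cauchy's formula for the polynomial parts.
  have key : ∀ z ∈ closedStrip α β, z.re < a ∨ b < z.re →
      polyEval (fn _ _ a b G c) (z - c) + (z - c) ^ n • E z = (2 * Real.pi : ℂ)⁻¹ •
        ((∫ t : ℝ, (lineWeight c n b t * ((z - c) / (z - (b + t * Complex.I))) ^ n) •
          fn X Y α β (Ψb t) (z - t * Complex.I)) -
        ∫ t : ℝ, (lineWeight c n a t * ((z - c) / (z - (a + t * Complex.I))) ^ n) •
          fn X Y α β (Ψa t) (z - t * Complex.I)) := by
    intro z hz hzab
    have ea := eRa z hz (by rcases hzab with h | h <;> intro h' <;> linarith)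
    have eb := eRb z hz (by rcases hzab with h | h <;> intro h' <;> linarith)
    simp only [hΨa] at ea
    simp only [hΨb] at eb
    have h1 := polyIntegral_sub_polyIntegral hac hcb (by linarith) G.differentiableOn_fn
      G.continuousOn_fn (hM G) hzab
    have hzc : (z - c) ^ n ≠ 0 := pow_ne_zero _ fun h => by
      have := congrArg Complex.re h
      simp at this
      rcases hzab with h | h <;> linarith
    rw [sub_eq_iff_eq_add] at h1
    rw [h1] at eb
    rw [hE, smul_comm, smul_sub ((z - c) ^ n), ea, eb, smul_add, smul_comm ((z - c) ^ n) (2 * _ : ℂ),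
      smul_smul ((z - c) ^ n) ((z - c) ^ n)⁻¹, mul_inv_cancel₀ hzc, one_smul]
    rw [smul_sub, smul_sub, smul_sub, smul_sub, smul_add, smul_smul _ (2 * _ : ℂ),
      inv_mul_cancel₀ hπ, one_smul]
    abel
  obtain ⟨u, hu, hun⟩ := exists_cutoff_smul (x := α) hK hK0 (by linarith)
    ((2 * Real.pi : ℂ)⁻¹ • (Ub - Ua))
  obtain ⟨w, hw, hwn⟩ := exists_cutoff_smul (x := β) hK hK0 (by linarith)
    ((2 * Real.pi : ℂ)⁻¹ • (Wb - Wa))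
  obtain ⟨f, hf, hfn⟩ := exists_taylorCoeffs_eq hαβ hαc hcβ (fn _ _ a b G c) (E := E)
    ((dRb.sub dRa).const_smul _) ((cRb.sub cRa).const_smul _)
    (M := ‖(2 * Real.pi : ℂ)⁻¹‖ * (Rb * ‖Ψb‖ + Ra * ‖Ψa‖))
    (fun z hz => by
      rw [hE, norm_smul]
      gcongr
      exact (norm_sub_le _ _).trans (add_le_add (bRb z hz) (bRa z hz))) u w
    (fun t => by
      rw [key _ (add_mul_I_mem_closedStrip le_rfl (hαc.trans hcβ).le t) (Or.inl (by simpa using ha)),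
        hu, ← hUa, ← hUb]
      simp)
    (fun t => by
      rw [key _ (add_mul_I_mem_closedStrip (hαc.trans hcβ).le le_rfl t) (Or.inr (by simpa using hb)),
        hw, ← hWa, ← hWb]
      simp)
  refine ⟨f, hf, hfn.trans_le ?_⟩
  -- The factor 4 is the norm loss in the lifts `Ψa` and `Ψb`.
  have hbound : ∀ {Z : SeminormedSubspace V} {U₁ U₂ v : ℝ →ᵇ Z.Space} {A B : ℝ}, 0 ≤ A → 0 ≤ B →
      ‖v‖ ≤ K * ‖(2 * Real.pi : ℂ)⁻¹ • (U₂ - U₁)‖ → ‖U₁‖ ≤ A * ‖Ψa‖ → ‖U₂‖ ≤ B * ‖Ψb‖ →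
      ‖v‖ ≤ K * (4 * (A + B)) * ‖G‖ := by
    intro Z U₁ U₂ v A B hA hB hv h1 h2
    refine hv.trans ?_
    rw [mul_assoc]
    gcongr
    refine (norm_smul_le _ _).trans ((mul_le_of_le_one_left (norm_nonneg _) hπ1).trans ?_)
    refine (norm_sub_le _ _).trans ((add_le_add h2 h1).trans ?_)
    have h3 := mul_le_mul_of_nonneg_left hΨan' hA
    have h4 := mul_le_mul_of_nonneg_left hΨbn' hB
    linarith
  refine max_le ((hbound hAa0 hAb0 hun nUa nUb).trans ?_) ((hbound hBa0 hBb0 hwn nWa nWb).trans ?_)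
  · gcongr; exact le_max_left _ _
  · gcongr; exact le_max_right _ _

end Calderon

namespace SeminormedSubspace

theorem ofRange_le_ofRange {V F F' : Type*} [AddCommGroup V] [Module ℂ V] [SeminormedAddCommGroup F]
    [NormedSpace ℂ F] [SeminormedAddCommGroup F'] [NormedSpace ℂ F'] {T : F →ₗ[ℂ] V}
    {S : F' →ₗ[ℂ] V} {K : ℝ} (hK : 0 ≤ K) (h : ∀ f, ∃ g, S g = T f ∧ ‖g‖ ≤ K * ‖f‖) :
    ∃ hle : (ofRange T).carrier ≤ (ofRange S).carrier, ∀ x : (ofRange T).carrier,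
      (ofRange S).seminorm (Submodule.inclusion hle x) ≤ K * (ofRange T).seminorm x := by
  have hle : (ofRange T).carrier ≤ (ofRange S).carrier := by
    rintro _ ⟨f, rfl⟩
    obtain ⟨g, hg, -⟩ := h f
    exact ⟨g, hg⟩
  refine ⟨hle, fun x => norm_le_of_forall_toRange (w := x) hK fun f hf => ?_⟩
  obtain ⟨g, hg, hgn⟩ := h f
  have : toRange S g = Submodule.inclusion hle x := by
    rw [← hf]
    exact (ofRange S).incl_injective hg
  rw [← this]
  exact (norm_toRange_le S g).trans hgn

theorem eqWithEquivalentNorms_ofRange {V F F' : Type*} [AddCommGroup V] [Module ℂ V]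
    [SeminormedAddCommGroup F] [NormedSpace ℂ F] [SeminormedAddCommGroup F'] [NormedSpace ℂ F']
    {T : F →ₗ[ℂ] V} {S : F' →ₗ[ℂ] V} {K L : ℝ} (hK : 0 ≤ K) (hL : 0 ≤ L)
    (h : ∀ f, ∃ g, S g = T f ∧ ‖g‖ ≤ K * ‖f‖) (h' : ∀ g, ∃ f, T f = S g ∧ ‖f‖ ≤ L * ‖g‖) :
    EqWithEquivalentNorms (ofRange T) (ofRange S) := by
  obtain ⟨h1, h2⟩ := ofRange_le_ofRange hK h
  obtain ⟨h3, h4⟩ := ofRange_le_ofRange hL h'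
  -- The added 1 makes both constants strictly positive.
  refine ⟨le_antisymm h1 h3, h1, (L + 1)⁻¹, K + 1, by positivity, by positivity, fun x => ⟨?_, ?_⟩⟩
  · rw [inv_mul_le_iff₀ (by positivity)]
    refine (h4 (Submodule.inclusion h1 x)).trans ?_
    gcongr
    linarith
  · refine (h2 x).trans ?_
    gcongr
    linarith

/-- The reiteration theorem for Rochberg spaces. -/
theorem rochberg_eqWithEquivalentNorms {V : Type*} [NormedAddCommGroup V] [NormedSpace ℂ V]
    [CompleteSpace V] {X Y : SeminormedSubspace V} (hX : X.IsBanach) (hY : Y.IsBanach)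
    {α β a b c : ℝ} (hαβ : β - α ≤ 1) (ha : α < a) (hac : a < c) (hcb : c < b) (hb : b < β)
    (n : ℕ) :
    EqWithEquivalentNorms
      (rochberg X Y α β n (ofReal_mem_openStrip (ha.trans hac) (hcb.trans hb)))
      (complexInterpolation
        (rochberg X Y α β n (ofReal_mem_openStrip ha (hac.trans (hcb.trans hb))))
        (rochberg X Y α β n (ofReal_mem_openStrip (ha.trans (hac.trans hcb)) hb)) a b c) := by
  obtain ⟨K, hK, h⟩ := Calderon.exists_fn_eq_taylorCoeffs hX hY hαβ ha hac hcb hb n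
  obtain ⟨L, hL, h'⟩ := Calderon.exists_taylorCoeffs_eq_fn hX hY hαβ ha hac hcb hb n
  exact eqWithEquivalentNorms_ofRange hK hL h h'

end SeminormedSubspace

/-! ### The case `X ⊆ Y` -/

namespace SeminormedSubspace

variable {V : Type*} [NormedAddCommGroup V] [NormedSpace ℂ V] [CompleteSpace V]
  {X Y : SeminormedSubspace V}

/-- By the open mapping theorem the norms of `X` and `V` are equivalent; bounds in `V` then suffice
on the edge belonging to the larger space. -/
theorem IsBanach.exists_rightInverse (hX : X.IsBanach) (htop : X.carrier = ⊤) :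
    ∃ S : V →L[ℂ] X.Space, ∀ v, X.incl (S v) = v := by
  let := hX.normedAddCommGroup
  have : CompleteSpace X.Space := hX.complete
  let e : X.Space ≃L[ℂ] V := ContinuousLinearEquiv.ofBijective hX.inclL
    (LinearMap.ker_eq_bot.2 X.incl_injective)
    (LinearMap.range_eq_top.2 fun v => X.exists_incl_eq (by rw [htop]; trivial))
  exact ⟨e.symm, fun v => e.apply_symm_apply v⟩

theorem incl_polyEval {n : ℕ} (v : Fin n → X.Space) (u : ℂ) :
    X.incl (polyEval v u) = polyEval (fun i => X.incl (v i)) u := by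
  simp [polyEval]

/-- A polynomial with coefficients in `X`, times a cutoff function, on a vertical line. -/
theorem IsBanach.exists_cutoff_smul_polyEval (hX : X.IsBanach) {n : ℕ} {v : Fin n → V}
    (hv : ∀ i, v i ∈ X.carrier) {c x : ℝ} (hx : |x - c| ≤ 1) :
    ∃ u : ℝ →ᵇ X.Space, ∀ t : ℝ, X.incl (u t) =
      cutoff c n (x + t * Complex.I) • polyEval v (x + t * Complex.I - c) := by
  let := hX.normedAddCommGroup
  have : CompleteSpace X.Space := hX.complete
  choose w hw using fun i => X.exists_incl_eq (hv i)
  obtain ⟨K, -, hK⟩ := Calderon.exists_norm_cutoff_smul_le (V := X.Space) c n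
  have hc : Continuous fun t : ℝ =>
      cutoff c n (x + t * Complex.I) • polyEval w (x + t * Complex.I - c) :=
    (Calderon.continuous_cutoff_vertical (by linarith [(abs_le.1 hx).1])).smul
      ((differentiable_polyEval w).continuous.comp (by fun_prop))
  refine ⟨BoundedContinuousFunction.ofNormedAddCommGroup _ hc (K * ∑ i, ‖w i‖) fun t => ?_,
    fun t => ?_⟩
  · simpa using hK (z := x + t * Complex.I) (by simpa using hx) w 0
  · refine (map_smul X.incl _ _).trans ?_
    rw [incl_polyEval]
    simp only [hw]

end SeminormedSubspace

namespace Calderon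

variable {V : Type*} [NormedAddCommGroup V] [NormedSpace ℂ V] [CompleteSpace V]
  {X Y : SeminormedSubspace V} {α β : ℝ} {n : ℕ}

/-- This moves a Taylor list from `a` to `b`. The left edge is controlled in `X` by the integral
over the single line `Re z = a`; on the right edge a bound in `V` is enough, because `Y` is all of
`V`. -/
theorem exists_taylorCoeffs_eq_taylorCoeffs (hX : X.IsBanach) (hY : Y.IsBanach)
    (htop : Y.carrier = ⊤) (hαβ : β - α ≤ 1) {a b : ℝ} (ha : α < a) (hab : a < b) (hb : b < β)
    (n : ℕ) :
    ∃ K, 0 ≤ K ∧ ∀ f : Calderon X Y α β, ∃ g : Calderon X Y α β,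
      taylorCoeffs X Y α β n (ofReal_mem_openStrip (ha.trans hab) hb) g =
        taylorCoeffs X Y α β n (ofReal_mem_openStrip ha (hab.trans hb)) f ∧ ‖g‖ ≤ K * ‖f‖ := by
  have haβ := hab.trans hb
  have hαb := ha.trans hab
  have hp := ofReal_mem_openStrip ha haβ
  obtain ⟨S, hS⟩ := hY.exists_rightInverse htop
  obtain ⟨K, hK0, hK⟩ := exists_norm_cutoff_le b n
  obtain ⟨L, hL0, hL⟩ := exists_norm_cutoff_smul_le (V := V) b n
  obtain ⟨T, hT0, hT⟩ := exists_norm_taylorCoeffs_le hX hY hp n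
  obtain ⟨R, hR0, hR⟩ := exists_remainderIntegral hX hY hαβ hαb hb ha haβ hab.ne n
  obtain ⟨A, hA0, hA⟩ := exists_remainderIntegral_left (Y := Y) hX hαβ hαb hb ha haβ hab.ne n
  have hπ : (2 * Real.pi : ℂ) ≠ 0 := by exact_mod_cast Real.two_pi_pos.ne'
  set C := ‖(2 * Real.pi : ℂ)⁻¹‖ with hC
  refine ⟨max (K * (C * A)) (‖S‖ * (L * (n * T + C * R))), le_max_of_le_left (by positivity),
    fun f => ?_⟩
  -- The constant family has the same list at `a` for every `t`, as the half-plane formula requires.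
  obtain ⟨Ψ, hΨ, hΨn⟩ : ∃ Ψ : ℝ →ᵇ Calderon X Y α β, (∀ t, Ψ t = f) ∧ ‖Ψ‖ ≤ ‖f‖ :=
    ⟨BoundedContinuousFunction.const ℝ f, fun t => rfl, BoundedContinuousFunction.norm_const_le f⟩
  obtain ⟨dR, cR, bR, eR⟩ := hR Ψ
  obtain ⟨U, nU, hU⟩ := hA Ψ
  simp only [hΨ] at hU
  set v := taylorCoeffs X Y α β n hp f with hv
  -- The minus sign is that of Cauchy's formula on the left edge of a half-plane.
  set E : ℂ → V := fun z => -(2 * Real.pi : ℂ)⁻¹ • remainderIntegral b n a Ψ z with hE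
  have hEd : DifferentiableOn ℂ E (openStrip α β) := dR.const_smul _
  have hEc : ContinuousOn E (closedStrip α β) := cR.const_smul _
  have hEn : ∀ z ∈ closedStrip α β, ‖E z‖ ≤ C * (R * ‖f‖) := fun z hz => by
    rw [hE, norm_smul, norm_neg]
    gcongr
    exact (bR z hz).trans (by gcongr)
  obtain ⟨u, hu, hun⟩ := exists_cutoff_smul (x := α) hK hK0 (by linarith)
    (-(2 * Real.pi : ℂ)⁻¹ • U)
  set w : ℝ → V := fun t => cutoff b n (β + t * Complex.I) •
    (polyEval v (β + t * Complex.I - b) +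
      (β + t * Complex.I - b : ℂ) ^ n • E (β + t * Complex.I)) with hw
  have hwc : Continuous w := by
    refine (continuous_cutoff_vertical (by linarith)).smul (Continuous.add ?_ ?_)
    · exact (differentiable_polyEval v).continuous.comp (by fun_prop)
    · exact Continuous.smul (by fun_prop) (continuous_vertical (hαb.trans hb).le le_rfl hEc)
  have hwn : ∀ t, ‖w t‖ ≤ L * (n * T + C * R) * ‖f‖ := fun t => by
    refine (hL (abs_le.2 ⟨?_, ?_⟩) v _).trans ?_
    · simp; linarith
    · simp; linarith
    have h1 : ∑ i, ‖v i‖ ≤ n * (T * ‖f‖) := by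
      refine (Finset.sum_le_card_nsmul _ _ _ fun i _ =>
        (norm_le_pi_norm v i).trans (hT f)).trans_eq ?_
      simp
    have h2 := hEn _ (add_mul_I_mem_closedStrip (hαb.trans hb).le le_rfl t)
    rw [mul_assoc, add_mul, mul_assoc, mul_assoc]
    gcongr
  have hSn : ∀ t, ‖S (w t)‖ ≤ ‖S‖ * (L * (n * T + C * R)) * ‖f‖ := fun t => by
    rw [mul_assoc]
    exact S.le_opNorm_of_le (hwn t)
  obtain ⟨g, hg, hgn⟩ := exists_taylorCoeffs_eq hαβ hαb hb v hEd hEc hEn u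
    (BoundedContinuousFunction.ofNormedAddCommGroup (fun t => S (w t)) (S.continuous.comp hwc) _ hSn)
    (fun t => by
      have hre : ((α : ℂ) + t * Complex.I).re = α := by simp
      have hmem := add_mul_I_mem_closedStrip le_rfl (hαb.trans hb).le t
      have e1 := eR _ hmem (by rw [hre]; exact ha.ne)
      have e2 := polyIntegral_const hab (by linarith) v (z := α + t * Complex.I)
        (by rw [hre]; exact ha)
      have hzc : (α + t * Complex.I - b : ℂ) ^ n ≠ 0 := pow_ne_zero _ fun h => by
        have := congrArg Complex.re h
        simp at this
        linarith
      simp only [hΨ] at e1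
      rw [← hv, e2, smul_neg, sub_neg_eq_add, smul_comm _ (2 * _ : ℂ), smul_smul _ (_)⁻¹,
        mul_inv_cancel₀ hzc, one_smul] at e1
      rw [hu, map_smul, BoundedContinuousFunction.coe_smul, map_smul, hU]
      simp only [hE]
      congr 1
      rw [smul_comm ((_ : ℂ) ^ n), e1, smul_add, neg_smul _ ((2 * _ : ℂ) • _), smul_smul,
        inv_mul_cancel₀ hπ, one_smul, add_comm (polyEval _ _), neg_add_cancel_right])
    (fun t => hS _)
  refine ⟨g, hg, hgn.trans_le (max_le ?_ ?_)⟩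
  · refine hun.trans ?_
    calc K * ‖-(2 * Real.pi : ℂ)⁻¹ • U‖ ≤ K * (C * (A * ‖f‖)) := by
          gcongr
          refine (norm_smul_le _ _).trans ?_
          rw [norm_neg]
          gcongr
          exact nU.trans (by gcongr)
      _ = K * (C * A) * ‖f‖ := by ring
      _ ≤ _ := by gcongr; exact le_max_left _ _
  · refine (BoundedContinuousFunction.norm_ofNormedAddCommGroup_le _ (by positivity) hSn).trans ?_
    gcongr
    exact le_max_right _ _

end Calderon

/-! ### Density -/

/-- The Calderón space carries only a seminorm instance, so Bochner integrals are taken in its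
separation quotient and lifted back. Continuous maps into normed spaces do not notice the choice of
lift. -/
theorem SeparationQuotient.apply_outCLM_mk {E W : Type*} [SeminormedAddCommGroup E]
    [NormedSpace ℂ E] [NormedAddCommGroup W] [NormedSpace ℂ W] (e : E →L[ℂ] W) (x : E) :
    e (outCLM ℂ E (mk x)) = e x :=
  ((mk_eq_mk.1 (mk_outCLM ℂ (mk x))).map e.continuous).eq

theorem integral_exp_neg_sq_ne_zero : (∫ s : ℝ, (Real.exp (-s ^ 2) : ℂ)) ≠ 0 := by
  have h : ∫ s : ℝ, Real.exp (-s ^ 2) = √Real.pi := by simpa using integral_gaussian 1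
  rw [integral_complex_ofReal, h]
  exact_mod_cast (Real.sqrt_pos.2 Real.pi_pos).ne'

theorem integrable_exp_neg_sq : Integrable fun s : ℝ => Real.exp (-s ^ 2) := by
  simpa using integrable_exp_neg_mul_sq one_pos

namespace Calderon

variable {V : Type*} [NormedAddCommGroup V] [NormedSpace ℂ V] [CompleteSpace V]
  {X Y : SeminormedSubspace V} {α β : ℝ} {n : ℕ}

/-- Vertical convolution with a Gaussian. -/
theorem exists_norm_sub_lt_fn_eq_integral (hX : X.IsBanach) (hY : Y.IsBanach) (hαβ : α < β)
    (f : Calderon X Y α β) (hl : Tendsto (left f) (cocompact ℝ) (𝓝 0))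
    (hr : Tendsto (right f) (cocompact ℝ) (𝓝 0)) {ε : ℝ} (hε : 0 < ε) :
    ∃ g : Calderon X Y α β, ‖f - g‖ < ε ∧ ∃ r : ℝ, 0 < r ∧ ∃ C : ℂ, ∀ z ∈ closedStrip α β,
      fn X Y α β g z =
        C • ∫ s : ℝ, (Real.exp (-s ^ 2) : ℂ) • fn X Y α β f (z + (r * s : ℝ) * Complex.I) := by
  have := completeSpace hX hY hαβ
  set w : ℝ → ℝ → SeparationQuotient (Calderon X Y α β) := fun r s =>
    (Real.exp (-s ^ 2) : ℂ) • SeparationQuotient.mk (translate (r * s) f) with hw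
  have hcont := continuous_translate hl hr
  have hwc : ∀ r, Continuous (w r) := fun r => by
    have h1 : Continuous fun s : ℝ => (Real.exp (-s ^ 2) : ℂ) := by fun_prop
    exact h1.smul (SeparationQuotient.continuous_mk.comp
      (hcont.comp (by fun_prop : Continuous fun s => r * s)))
  have hwc' : ∀ s, Continuous fun r => w r s := fun s => by
    have h1 : Continuous fun _ : ℝ => (Real.exp (-s ^ 2) : ℂ) := continuous_const
    exact h1.smul (SeparationQuotient.continuous_mk.comp
      (hcont.comp (by fun_prop : Continuous fun r => r * s)))
  have hwn : ∀ r s, ‖w r s‖ ≤ Real.exp (-s ^ 2) * ‖f‖ := fun r s => by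
    rw [hw, norm_smul, Complex.norm_real, Real.norm_of_nonneg (Real.exp_pos _).le,
      SeparationQuotient.norm_mk]
    gcongr
    exact norm_translate_le _ _
  have hint : Integrable fun s : ℝ => Real.exp (-s ^ 2) * ‖f‖ := integrable_exp_neg_sq.mul_const _
  have hwi : ∀ r, Integrable (w r) := fun r =>
    hint.mono' (hwc r).aestronglyMeasurable (Eventually.of_forall (hwn r))
  set I := ∫ s : ℝ, (Real.exp (-s ^ 2) : ℂ) with hI
  have hI0 : I ≠ 0 := integral_exp_neg_sq_ne_zero
  have hc : Continuous fun r => I⁻¹ • ∫ s, w r s := by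
    have h1 : Continuous fun _ : ℝ => I⁻¹ := continuous_const
    refine h1.smul ?_
    exact continuous_of_dominated (fun r => (hwc r).aestronglyMeasurable)
      (fun r => Eventually.of_forall (hwn r)) hint (Eventually.of_forall hwc')
  have h0 : translate 0 f = f := by
    refine Subtype.ext (Prod.ext (funext fun z => ?_) (Prod.ext ?_ ?_))
    · change fn X Y α β f (z + (0 : ℝ) * Complex.I) = fn X Y α β f z
      simp
    · ext t
      change left f (t + 0) = left f t
      rw [add_zero]
    · ext t
      change right f (t + 0) = right f t
      rw [add_zero]
  have hw0 : I⁻¹ • ∫ s, w 0 s = SeparationQuotient.mk f := by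
    simp only [hw, zero_mul, h0]
    rw [integral_smul_const, smul_smul, inv_mul_cancel₀ hI0, one_smul]
  -- The average depends continuously on the width `r` and equals `f` at `r = 0`, so a small
  -- positive width gives the approximation.
  have hlim : Tendsto (fun r => I⁻¹ • ∫ s, w r s) (𝓝[>] 0) (𝓝 (SeparationQuotient.mk f)) := by
    rw [← hw0]
    exact (hc.tendsto 0).mono_left nhdsWithin_le_nhds
  obtain ⟨r, hrε, hr0⟩ := ((hlim.eventually (Metric.ball_mem_nhds _ hε)).and
    self_mem_nhdsWithin).exists
  refine ⟨SeparationQuotient.outCLM ℂ _ (I⁻¹ • ∫ s, w r s), ?_, r, hr0, I⁻¹, fun z hz => ?_⟩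
  · rw [← SeparationQuotient.norm_mk, SeparationQuotient.mk_sub, SeparationQuotient.mk_outCLM,
      ← dist_eq_norm, dist_comm]
    exact hrε
  · obtain ⟨K, -, hK⟩ := exists_norm_fn_le hX hY hαβ
    let e : Calderon X Y α β →L[ℂ] V :=
      (LinearMap.proj z ∘ₗ fn X Y α β).mkContinuous K fun f => hK f z hz
    change (e ∘L SeparationQuotient.outCLM ℂ _) _ = _
    rw [map_smul, ← ContinuousLinearMap.integral_comp_comm _ (hwi r)]
    congr 1
    refine integral_congr_ae (Eventually.of_forall fun s => ?_)
    refine (map_smul (e ∘L SeparationQuotient.outCLM ℂ _) _ _).trans ?_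
    congr 1
    exact SeparationQuotient.apply_outCLM_mk e _

theorem norm_exp_sub_div_sq (ζ z : ℂ) (r : ℝ) : ‖Complex.exp (((ζ - z) / r) ^ 2)‖ =
    Real.exp (((ζ.re - z.re) / r) ^ 2) * Real.exp (-((ζ.im - z.im) / r) ^ 2) := by
  rw [Complex.norm_exp, ← Real.exp_add]
  congr 1
  rw [sq, Complex.mul_re, Complex.div_ofReal_re, Complex.div_ofReal_im, Complex.sub_re,
    Complex.sub_im]
  ring

theorem norm_exp_sub_div_sq_le {ζ z : ℂ} (hζ : ζ ∈ closedStrip α β) (hz : z ∈ closedStrip α β)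
    (r : ℝ) : ‖Complex.exp (((ζ - z) / r) ^ 2)‖ ≤
      Real.exp (((β - α) / r) ^ 2) * Real.exp (-((ζ.im - z.im) / r) ^ 2) := by
  have h : (ζ.re - z.re) ^ 2 ≤ (β - α) ^ 2 := sq_le_sq' (by linarith [hζ.1, hz.2])
    (by linarith [hζ.2, hz.1])
  rw [norm_exp_sub_div_sq, div_pow, div_pow (β - α)]
  gcongr

/-- Supplies the `K / |z.im|` decay needed to shift the contour. -/
theorem abs_mul_exp_neg_sq_le {r : ℝ} (hr : 0 < r) (t y : ℝ) :
    |t| * Real.exp (-((t - y) / r) ^ 2) ≤ |y| + r := by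
  set q := (t - y) / r with hq
  have ht : t = y + r * q := by rw [hq]; field_simp; ring
  have h1 : Real.exp (-q ^ 2) ≤ 1 := Real.exp_le_one_iff.2 (by nlinarith [sq_nonneg q])
  have h2 : |q| * Real.exp (-q ^ 2) ≤ 1 := by
    rw [Real.exp_neg, ← div_eq_mul_inv, div_le_one (Real.exp_pos _)]
    nlinarith [Real.add_one_le_exp (q ^ 2), sq_abs q, sq_nonneg (|q| - 1)]
  calc |t| * Real.exp (-q ^ 2) ≤ (|y| + r * |q|) * Real.exp (-q ^ 2) := by
        gcongr
        rw [ht]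
        refine (abs_add_le _ _).trans_eq ?_
        rw [abs_mul, abs_of_pos hr]
    _ = |y| * Real.exp (-q ^ 2) + r * (|q| * Real.exp (-q ^ 2)) := by ring
    _ ≤ |y| * 1 + r * 1 := by gcongr
    _ = |y| + r := by ring

/-- The Gaussian is entire, so the contour can be moved from the vertical line through `z` to the
left edge, where the function takes values in `X`. -/
theorem integral_exp_neg_sq_smul_eq (f : Calderon X Y α β) {M : ℝ}
    (hM : ∀ z ∈ closedStrip α β, ‖fn X Y α β f z‖ ≤ M) {r : ℝ} (hr : 0 < r) {z : ℂ}
    (hz : z ∈ openStrip α β) :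
    ∫ s : ℝ, (Real.exp (-s ^ 2) : ℂ) • fn X Y α β f (z + (r * s : ℝ) * Complex.I) =
      r⁻¹ • ∫ t : ℝ, Complex.exp (((α + t * Complex.I - z) / r) ^ 2) • X.incl (left f t) := by
  set φ : ℂ → V := fun ζ => Complex.exp (((ζ - z) / r) ^ 2) • fn X Y α β f ζ with hφ
  have hz' := openStrip_subset_closedStrip α β hz
  have hM0 : 0 ≤ M := (norm_nonneg _).trans (hM z hz')
  have hφn : ∀ ζ ∈ closedStrip α β, ‖φ ζ‖ ≤
      Real.exp (((β - α) / r) ^ 2) * Real.exp (-((ζ.im - z.im) / r) ^ 2) * M := fun ζ hζ => by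
    rw [hφ, norm_smul]
    exact mul_le_mul (norm_exp_sub_div_sq_le hζ hz' r) (hM ζ hζ) (norm_nonneg _) (by positivity)
  have hφc : ContinuousOn φ (closedStrip α β) :=
    ContinuousOn.smul (by fun_prop) f.continuousOn_fn
  have hφd : DifferentiableOn ℂ φ (openStrip α β) :=
    DifferentiableOn.smul (by fun_prop) f.differentiableOn_fn
  have hint : Integrable fun t : ℝ =>
      Real.exp (((β - α) / r) ^ 2) * Real.exp (-((t - z.im) / r) ^ 2) * M :=
    (((integrable_exp_neg_sq.comp_div hr.ne').comp_sub_right z.im).const_mul _).mul_const _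
  have hφi : ∀ {x : ℝ}, α ≤ x → x ≤ β → Integrable fun t : ℝ => φ (x + t * Complex.I) :=
    fun {x} h1 h2 => hint.mono' (continuous_vertical h1 h2 hφc).aestronglyMeasurable
      (Eventually.of_forall fun t => by
        simpa using hφn _ (add_mul_I_mem_closedStrip h1 h2 t))
  have hshift : ∫ s : ℝ, (Real.exp (-s ^ 2) : ℂ) • fn X Y α β f (z + (r * s : ℝ) * Complex.I) =
      r⁻¹ • ∫ t : ℝ, φ (z.re + t * Complex.I) := by
    rw [← integral_add_right_eq_self (fun t : ℝ => φ (z.re + t * Complex.I)) z.im,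
      ← abs_of_pos (inv_pos.2 hr), ← Measure.integral_comp_mul_left]
    congr 1
    ext s
    have e1 : (z.re + (r * s + z.im : ℝ) * Complex.I : ℂ) = z + (r * s : ℝ) * Complex.I := by
      conv_rhs => rw [← Complex.re_add_im z]
      push_cast
      ring
    have e2 : (((z + (r * s : ℝ) * Complex.I - z) / r) ^ 2 : ℂ) = (-s ^ 2 : ℝ) := by
      have : (r : ℂ) ≠ 0 := by exact_mod_cast hr.ne'
      push_cast
      rw [add_sub_cancel_left, mul_assoc, mul_div_cancel_left₀ _ this, mul_pow, Complex.I_sq]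
      ring
    simp only [hφ]
    rw [e1, e2, Complex.ofReal_exp]
  rw [hshift]
  congr 1
  rw [← integral_vertical_line_eq hz'.1 (hφd.mono fun ζ hζ => ⟨hζ.1, hζ.2.trans hz.2⟩)
    (hφc.mono fun ζ hζ => ⟨hζ.1, hζ.2.trans hz'.2⟩) (hφi le_rfl (hz.1.trans hz.2).le)
    (hφi hz'.1 hz'.2) (K := Real.exp (((β - α) / r) ^ 2) * (|z.im| + r) * M) fun ζ hζ h1 => ?_]
  · congr 1
    ext t
    rw [← fn_left]
  · rw [le_div_iff₀ (by linarith)]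
    calc ‖φ ζ‖ * |ζ.im| ≤ Real.exp (((β - α) / r) ^ 2) * Real.exp (-((ζ.im - z.im) / r) ^ 2) * M *
          |ζ.im| := by gcongr; exact hφn ζ ⟨hζ.1, hζ.2.trans hz'.2⟩
      _ = Real.exp (((β - α) / r) ^ 2) * (|ζ.im| * Real.exp (-((ζ.im - z.im) / r) ^ 2)) * M := by
          ring
      _ ≤ _ := by gcongr; exact abs_mul_exp_neg_sq_le hr _ _

/-- The kernel is analytic in `z` and has a Gaussian majorant uniform for `|z.im| < 1`, so the
integral converges in `X` to an `X`-valued analytic function. -/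
theorem exists_differentiableOn_incl_eq_integral (hX : X.IsBanach) (hαβ : α < β)
    (u : ℝ →ᵇ X.Space) {r : ℝ} (hr : 0 < r) :
    let := hX.normedAddCommGroup
    ∃ Φ : ℂ → X.Space, DifferentiableOn ℂ Φ (openStrip α β ∩ {z | |z.im| < 1}) ∧
      ∀ z ∈ openStrip α β ∩ {z | |z.im| < 1}, X.incl (Φ z) =
        ∫ t : ℝ, Complex.exp (((α + t * Complex.I - z) / r) ^ 2) • X.incl (u t) := by
  intro
  have : CompleteSpace X.Space := hX.complete
  have hU : IsOpen (openStrip α β ∩ {z : ℂ | |z.im| < 1}) :=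
    (isOpen_openStrip α β).inter (isOpen_lt (by fun_prop) continuous_const)
  set A := Real.exp (((β - α) / r) ^ 2) * Real.exp (1 / r ^ 2) with hA
  have hint : Integrable fun t : ℝ => A * Real.exp (-(1 / (2 * r ^ 2)) * t ^ 2) * ‖u‖ :=
    ((integrable_exp_neg_mul_sq (by positivity)).const_mul _).mul_const _
  have hcont : ∀ z, Continuous fun t : ℝ =>
      Complex.exp (((α + t * Complex.I - z) / r) ^ 2) • u t := fun z => by
    have h1 : Continuous fun t : ℝ => Complex.exp (((α + t * Complex.I - z) / r) ^ 2) := by fun_prop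
    exact h1.smul u.continuous
  have hb : ∀ z ∈ openStrip α β ∩ {z : ℂ | |z.im| < 1}, ∀ t : ℝ,
      ‖Complex.exp (((α + t * Complex.I - z) / r) ^ 2) • u t‖ ≤
        A * Real.exp (-(1 / (2 * r ^ 2)) * t ^ 2) * ‖u‖ := fun z hz t => by
    rw [norm_smul]
    refine mul_le_mul ?_ (u.norm_coe_le_norm t) (norm_nonneg _) (by positivity)
    refine (norm_exp_sub_div_sq_le (add_mul_I_mem_closedStrip le_rfl hαβ.le t)
      (openStrip_subset_closedStrip α β hz.1) r).trans ?_
    rw [hA, mul_assoc, ← Real.exp_add (1 / r ^ 2)]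
    gcongr
    have hy : z.im ^ 2 ≤ 1 := (sq_le_one_iff_abs_le_one _).2 (le_of_lt hz.2)
    -- Completing the square: `(t - y) ^ 2 ≥ t ^ 2 / 2 - y ^ 2`, with `y ^ 2 ≤ 1`, removes `z` from
    -- the majorant.
    have e : 1 / r ^ 2 + -(1 / (2 * r ^ 2)) * t ^ 2 - -((t - z.im) / r) ^ 2 =
        ((t - 2 * z.im) ^ 2 / 2 + (1 - z.im ^ 2)) / r ^ 2 := by
      field_simp
      ring
    have h0 : 0 ≤ ((t - 2 * z.im) ^ 2 / 2 + (1 - z.im ^ 2)) / r ^ 2 :=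
      div_nonneg (add_nonneg (by positivity) (by linarith)) (by positivity)
    simp only [Complex.add_im, Complex.ofReal_im, Complex.mul_im, Complex.ofReal_re, Complex.I_im,
      Complex.I_re, mul_one, mul_zero, add_zero, zero_add]
    linarith
  refine ⟨fun z => ∫ t : ℝ, Complex.exp (((α + t * Complex.I - z) / r) ^ 2) • u t, ?_, ?_⟩
  · refine differentiableOn_integral_of_dominated hU hint (fun t => ?_)
      (fun z _ => (hcont z).aestronglyMeasurable) hb
    exact DifferentiableOn.smul_const (by fun_prop) _
  · intro z hz
    refine (hX.inclL.integral_comp_comm (hint.mono' (hcont z).aestronglyMeasurable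
      (Eventually.of_forall (hb z hz)))).symm.trans ?_
    exact integral_congr_ae (Eventually.of_forall fun t => map_smul X.incl _ _)

/-- The inclusion is continuous and linear, so it commutes with differentiation: the derivatives in
`V` are images of derivatives taken in `X`. -/
theorem taylorCoeffs_mem_of_eventuallyEq (hX : X.IsBanach) (g : Calderon X Y α β) {p : ℂ}
    (hp : p ∈ openStrip α β) {Φ : ℂ → X.Space} {U : Set ℂ} (hU : U ∈ 𝓝 p)
    (hΦ : let := hX.normedAddCommGroup; DifferentiableOn ℂ Φ U)
    (h : ∀ z ∈ U, fn X Y α β g z = X.incl (Φ z)) (i : Fin n) :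
    taylorCoeffs X Y α β n hp g i ∈ X.carrier := by
  let := hX.normedAddCommGroup
  have : CompleteSpace X.Space := hX.complete
  refine X.carrier.smul_mem _ ?_
  have h1 : ContDiffAt ℂ (i : ℕ) Φ p := (DifferentiableOn.analyticAt hΦ hU).contDiffAt
  have h2 : fn X Y α β g =ᶠ[𝓝 p] hX.inclL ∘ Φ := by
    filter_upwards [hU] with z hz using h z hz
  rw [h2.iteratedDeriv_eq, iteratedDeriv_eq_iteratedFDeriv,
    hX.inclL.iteratedFDeriv_comp_left h1 le_rfl]
  exact X.incl_mem _

/-- The elements of the Calderón space whose Taylor coefficients at `a` belong to `X` are dense, up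
to elements with the same Taylor coefficients. -/
theorem exists_norm_sub_lt_taylorCoeffs_mem (hX : X.IsBanach) (hY : Y.IsBanach) (hαβ : β - α ≤ 1)
    {a : ℝ} (ha : α < a) (haβ : a < β) (f : Calderon X Y α β) {ε : ℝ} (hε : 0 < ε) :
    ∃ f' g : Calderon X Y α β,
      taylorCoeffs X Y α β n (ofReal_mem_openStrip ha haβ) f' =
        taylorCoeffs X Y α β n (ofReal_mem_openStrip ha haβ) f ∧ ‖f' - g‖ < ε ∧
      ∀ i, taylorCoeffs X Y α β n (ofReal_mem_openStrip ha haβ) g i ∈ X.carrier := by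
  have hlt := ha.trans haβ
  have hp := ofReal_mem_openStrip ha haβ
  obtain ⟨K, hK0, hK⟩ := exists_norm_cutoff_le a n
  obtain ⟨f', -, hf', hl, hr⟩ := f.exists_mul_cutoff hαβ ha haβ hK0 hK
  obtain ⟨g, hg, r, hr0, C, hgC⟩ := exists_norm_sub_lt_fn_eq_integral hX hY hlt f' hl hr hε
  obtain ⟨M, -, hM⟩ := exists_norm_fn_le hX hY hlt
  obtain ⟨Φ, hΦd, hΦ⟩ := exists_differentiableOn_incl_eq_integral hX hlt (left f') hr0
  refine ⟨f', g, hf', hg, taylorCoeffs_mem_of_eventuallyEq hX g hp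
    (U := openStrip α β ∩ {z | |z.im| < 1}) (Φ := fun z => (C * (r⁻¹ : ℝ)) • Φ z)
    (IsOpen.mem_nhds ?_ ⟨hp, by simp⟩) ?_ fun z hz => ?_⟩
  · exact (isOpen_openStrip α β).inter (isOpen_lt (by fun_prop) continuous_const)
  · let := hX.normedAddCommGroup
    exact DifferentiableOn.const_smul (R := ℂ) hΦd _
  · rw [hgC z (openStrip_subset_closedStrip α β hz.1),
      integral_exp_neg_sq_smul_eq f' (hM f') hr0 hz.1, map_smul, hΦ z hz, mul_smul, Complex.coe_smul]

/-- Lists of elements of the intersection are lists of Taylor coefficients. -/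
theorem mem_rochberg_of_mem_inf (hX : X.IsBanach) (hY : Y.IsBanach) (hαβ : β - α ≤ 1) {c : ℝ}
    (hc : α < c) (hcβ : c < β) {v : Fin n → V} (hv : ∀ i, v i ∈ X.carrier ⊓ Y.carrier) :
    v ∈ (rochberg X Y α β n (ofReal_mem_openStrip hc hcβ)).carrier := by
  obtain ⟨u, hu⟩ := hX.exists_cutoff_smul_polyEval (fun i => (hv i).1) (c := c) (x := α)
    (abs_le.2 ⟨by linarith, by linarith⟩)
  obtain ⟨w, hw⟩ := hY.exists_cutoff_smul_polyEval (fun i => (hv i).2) (c := c) (x := β)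
    (abs_le.2 ⟨by linarith, by linarith⟩)
  obtain ⟨f, hf, -⟩ := exists_taylorCoeffs_eq hαβ hc hcβ v (E := fun _ => 0) (M := 0)
    (differentiableOn_const _) continuousOn_const (fun z _ => by simp) u w
    (fun t => by simpa using hu t) (fun t => by simpa using hw t)
  exact ⟨f, hf⟩

end Calderon

namespace SeminormedSubspace

variable {V : Type*} [NormedAddCommGroup V] [NormedSpace ℂ V] [CompleteSpace V]
  {X Y : SeminormedSubspace V} {α β : ℝ}

/-- When `X` embeds boundedly in `Y`, the norm of the intersection is equivalent to that of `X`, so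
approximation in `X` suffices. -/
theorem isDenseIn_inter_of_forall_exists {V : Type*} [AddCommGroup V] [Module ℂ V]
    {X Y : SeminormedSubspace V} {D : Set V} (hle : X.carrier ≤ Y.carrier) {K : ℝ} (hK : 0 ≤ K)
    (h : ∀ x : X.carrier, Y.seminorm (Submodule.inclusion hle x) ≤ K * X.seminorm x)
    (hD : D ⊆ X.carrier)
    (hd : ∀ x : X.carrier, ∀ ε > 0, ∃ y : X.carrier, (y : V) ∈ D ∧ X.seminorm (x - y) < ε) :
    IsDenseIn D (X.inter Y) := by
  refine ⟨fun v hv => ⟨hD hv, hle (hD hv)⟩, Metric.dense_iff.2 fun x r hr => ?_⟩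
  let x' : (X.carrier ⊓ Y.carrier : Submodule ℂ V) := x
  obtain ⟨y, hy, hxy⟩ := hd (Submodule.inclusion inf_le_left x') (r / (K + 1)) (by positivity)
  rw [lt_div_iff₀ (by positivity)] at hxy
  obtain ⟨y', hy'⟩ := (X.inter Y).exists_incl_eq (v := y) ⟨y.2, hle y.2⟩
  obtain rfl : y = Submodule.inclusion inf_le_left
      (show (X.carrier ⊓ Y.carrier : Submodule ℂ V) from y') := Subtype.ext hy'.symm
  refine ⟨y', ?_, hy⟩
  rw [Metric.mem_ball, dist_comm, dist_eq_norm]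
  set q := Submodule.inclusion inf_le_left x' - Submodule.inclusion inf_le_left
    (show (X.carrier ⊓ Y.carrier : Submodule ℂ V) from y') with hq
  have hX := apply_nonneg X.seminorm q
  have hY := h q
  refine max_lt (?_ : X.seminorm q < r) (?_ : Y.seminorm (Submodule.inclusion hle q) < r)
  · nlinarith
  · nlinarith

/-- If `X ⊆ Y`, the lists of elements of the intersection are dense in the intersection of two
Rochberg spaces. -/
theorem isDenseIn_rochberg_inter_rochberg (hX : X.IsBanach) (hY : Y.IsBanach)
    (htop : Y.carrier = ⊤) (hαβ : β - α ≤ 1) {a b : ℝ} (ha : α < a) (hab : a < b) (hb : b < β)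
    (n : ℕ) :
    IsDenseIn (setPower ((X.carrier ⊓ Y.carrier : Submodule ℂ V) : Set V) n)
      ((rochberg X Y α β n (ofReal_mem_openStrip ha (hab.trans hb))).inter
        (rochberg X Y α β n (ofReal_mem_openStrip (ha.trans hab) hb))) := by
  obtain ⟨K, hK, h⟩ := Calderon.exists_taylorCoeffs_eq_taylorCoeffs hX hY htop hαβ ha hab hb n
  obtain ⟨hle, hle'⟩ := ofRange_le_ofRange hK h
  refine isDenseIn_inter_of_forall_exists hle hK hle'
    (fun v hv => Calderon.mem_rochberg_of_mem_inf hX hY hαβ ha (hab.trans hb) hv) ?_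
  -- Replacing `f` by `f'` leaves the list unchanged. Its distance to the list of `g` is at most
  -- `‖f' - g‖`, and the coefficients of `g` lie in `X`, hence in the intersection because `Y` is
  -- everything.
  rintro ⟨_, f, rfl⟩ ε hε
  obtain ⟨f', g, hf', hfg, hg⟩ :=
    Calderon.exists_norm_sub_lt_taylorCoeffs_mem (n := n) hX hY hαβ ha (hab.trans hb) f hε
  refine ⟨⟨_, g, rfl⟩, fun i => ⟨hg i, by rw [htop]; trivial⟩, lt_of_le_of_lt ?_ hfg⟩
  refine le_of_eq_of_le (congrArg _ (Subtype.ext ?_)) (norm_toRange_le _ (f' - g))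
  exact ((congrArg (· - taylorCoeffs X Y α β n _ g) hf').symm.trans (map_sub _ f' g).symm)

end SeminormedSubspace

end

theorem mainTheorem7 {V : Type*} [NormedAddCommGroup V] [NormedSpace ℂ V] [CompleteSpace V]
    (X₀ X₁ : SeminormedSubspace V)
    (hcouple : SeminormedSubspace.IsCompatibleCouple X₀ X₁)
    (hsum : X₀.carrier ⊔ X₁.carrier = ⊤)
    (hregular : SeminormedSubspace.IsRegularCouple X₀ X₁)
    (a b : ℝ) (ha : 0 < a) (hab : a < b) (hb : b < 1) (n : ℕ) (hn : 1 ≤ n) :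
    let Δ : Set V := ((X₀.carrier ⊓ X₁.carrier : Submodule ℂ V) : Set V)
    let Ya : SeminormedSubspace (Fin n → V) :=
      rochberg X₀ X₁ 0 1 n (ofReal_mem_openStrip ha (hab.trans hb))
    let Yb : SeminormedSubspace (Fin n → V) :=
      rochberg X₀ X₁ 0 1 n (ofReal_mem_openStrip (ha.trans hab) hb)
    SeminormedSubspace.IsCompatibleCouple Ya Yb ∧
    (∀ (c : ℝ) (hac : a < c) (hcb : c < b),
      SeminormedSubspace.IsIsomorphicallyEmbedded
        (rochberg X₀ X₁ 0 1 n (ofReal_mem_openStrip (ha.trans hac) (hcb.trans hb)))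
        (complexInterpolation Ya Yb a b c)) ∧
    (SeminormedSubspace.IsDenseIn (setPower Δ n) (Ya.inter Yb) →
      ∀ (c : ℝ) (hac : a < c) (hcb : c < b),
        SeminormedSubspace.EqWithEquivalentNorms
          (rochberg X₀ X₁ 0 1 n (ofReal_mem_openStrip (ha.trans hac) (hcb.trans hb)))
          (complexInterpolation Ya Yb a b c)) ∧
    (X₀.carrier ≤ X₁.carrier →
      SeminormedSubspace.IsDenseIn (setPower Δ n) (Ya.inter Yb)) := by
  intro Δ Ya Yb
  obtain ⟨h₀, h₁⟩ := hcouple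
  have hαβ : (1 : ℝ) - 0 ≤ 1 := by norm_num
  have key : ∀ (c : ℝ) (hac : a < c) (hcb : c < b), SeminormedSubspace.EqWithEquivalentNorms
      (rochberg X₀ X₁ 0 1 n (ofReal_mem_openStrip (ha.trans hac) (hcb.trans hb)))
      (complexInterpolation Ya Yb a b c) := fun c hac hcb =>
    SeminormedSubspace.rochberg_eqWithEquivalentNorms h₀ h₁ hαβ ha hac hcb hb n
  refine ⟨⟨SeminormedSubspace.isBanach_rochberg h₀ h₁ _ n,
    SeminormedSubspace.isBanach_rochberg h₀ h₁ _ n⟩, fun c hac hcb => (key c hac hcb).2,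
    fun _ => key, fun hle => ?_⟩
  -- Under the inclusion the sum of the two spaces is `X₁`, which is therefore the whole ambient
  -- space.
  exact SeminormedSubspace.isDenseIn_rochberg_inter_rochberg h₀ h₁
    (by rwa [sup_eq_right.2 hle] at hsum) hαβ ha hab hb n
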